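/- Let $d\ge 1$, let $\Omega\subset[-1,1]^d$ be a nonempty open set, and let $\rho$ be the uniform probability distribution on $\Omega$, i.e. $d\rho=|\Omega|^{-1}\,dx$ on $\Omega$ (Lebesgue measure itself if $|\Omega|=1$, e.g. for the unit cube). Let $y:\Omega\to\mathbb{R}$ be measurable with $|y(x)|\le Y$ for all $x\in\Omega$, where $Y>0$. For $u\in H^1(\Omega)$ put $$L(u)=\int_\Omega \big(u^2-2uy+|\nabla u|^2\big)\,d\rho,\qquad \|u\|_{H^1}^2=\int_\Omega\big(|u|^2+|\nabla u|^2\big)\,d\rho,$$ and for points $x_1,\dots,x_N\in\Omega$ and a differentiable function $\phi$ put $$L_N(\phi)=\frac1N\sum_{i=1}^N\big(\phi(x_i)^2-2\phi(x_i)y(x_i)+|\nabla\phi(x_i)|^2\big).$$ For $f:\Omega\to\mathbb{R}$ let $$\|f\|_{\mathcal B}=\inf_{\tilde f}\int_{\mathbb{R}^d}(1+|\omega|_1)^2|\tilde f(\omega)|\,d\omega,$$ the infimum being over all measurable $\tilde f:\mathbb{R}^d\to\mathbb{C}$ for which this integral is finite and $f(x)=\int_{\mathbb{R}^d}e^{i\omega\cdot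 x}\tilde f(\omega)\,d\omega$ for all $x\in\Omega$; $f$ belongs to the Barron space $\mathcal B(\Omega)$ if such an $\tilde f$ exists. For $m\ge 1$ and $B>0$ let $\tau=\sqrt m$, $\mathrm{SP}_\tau(z)=\frac1\tau\log(1+e^{\tau z})$, and $$\mathcal F^m_{\mathrm{SP}_\tau}(B)=\Big\{c+\frac1m\sum_{k=1}^m a_k\,\mathrm{SP}_\tau(\omega_k\cdot x+b_k)\;:\;|c|\le 2B,\ |a_k|\le 16B,\ |\omega_k|_1=1,\ |b_k|\le 1\Big\}.$$ There are constants $Z_1$ depending only on $B,d,Y$, $Z_3$ depending only on $B,d$, and $M_2$ depending only on $B,Y$, such that the following holds for all $m,N\ge1$, $\delta\ge 0$ and $\varepsilon\in(0,1)$. Let $\hat u$ be a minimizer of $L$ over $H^1(\Omega)$ and assume that $\hat u\in\mathcal B(\Omega)$ and $\|\hat u\|_{\mathcal B}<B$. Then, with probability at least $1-\varepsilon$ over i.i.d. points $x_1,\dots,x_N$ with law $\rho$, every $\delta$-minimizer $\hat\phi^N$ of $L_N$ over $\mathcal F^m_{\mathrm{SP}_\tau}(B)$, i.e. every $\hat\phi^N\in\mathcal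 F^m_{\mathrm{SP}_\tau}(B)$ with $L_N(\hat\phi^N)\le\inf_{\mathcal F^m_{\mathrm{SP}_\tau}(B)}L_N+\delta$, satisfies $\hat\phi^N-\hat u\in H^1(\Omega)$ and $$\|\hat\phi^N-\hat u\|_{H^1}^2\le\frac{\|\hat u\|_{\mathcal B}^2}{m}(24\log m+65)^2+4\frac{\sqrt m}{\sqrt N}\big(Z_1+Z_3\sqrt{\log m}\big)+2M_2\frac{\sqrt{-2\log\varepsilon}}{\sqrt N}+2\delta.$$ -/

import Mathlib

open MeasureTheory
open scoped ContDiff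

noncomputable section

/-- The `d`-dimensional Euclidean space (with the `ℓ²` norm and Lebesgue measure). -/
abbrev Eucl (d : ℕ) : Type := EuclideanSpace ℝ (Fin d)

/-- The `ℓ¹` norm `|w|₁` of a vector. -/
def l1norm {d : ℕ} (w : Eucl d) : ℝ := ∑ i, |w i|

/-- The softplus activation `SP_τ(z) = τ⁻¹ log (1 + exp (τ z))`. -/
def softplus (τ z : ℝ) : ℝ := Real.log (1 + Real.exp (τ * z)) / τ

/-- The two-layer networks of width `m` with activation `σ` and parameters bounded through `B`:
`φ(x) = c + (1/m) ∑ₖ aₖ σ(wₖ · x + bₖ)`, `|c| ≤ 2B`, `|aₖ| ≤ 16B`, `|wₖ|₁ = 1`, `|bₖ| ≤ 1`. -/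
def twoLayer (d m : ℕ) (σ : ℝ → ℝ) (B : ℝ) : Set (Eucl d → ℝ) :=
  {φ | ∃ (c : ℝ) (a : Fin m → ℝ) (w : Fin m → Eucl d) (b : Fin m → ℝ),
    |c| ≤ 2 * B ∧ (∀ k, |a k| ≤ 16 * B) ∧ (∀ k, l1norm (w k) = 1) ∧ (∀ k, |b k| ≤ 1) ∧
    ∀ x, φ x = c + (1 / (m : ℝ)) * ∑ k, a k * σ (inner ℝ (w k) x + b k)}

/-- `F` is the Fourier transform of an extension of `f` from `Ω` to the whole space, with finite
moment of order `s`: `f(x) = ∫ exp(i w·x) F(w) dw` on `Ω` and `∫ (1 + |w|₁)^s |F(w)| dw < ∞`. -/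
def IsBarronRep {d : ℕ} (s : ℕ) (Ω : Set (Eucl d)) (f : Eucl d → ℝ) (F : Eucl d → ℂ) : Prop :=
  AEStronglyMeasurable F volume ∧
  Integrable (fun w => (1 + l1norm w) ^ s * ‖F w‖) volume ∧
  ∀ x ∈ Ω, (f x : ℂ) = ∫ w, Complex.exp (Complex.I * ((inner ℝ w x : ℝ) : ℂ)) * F w

/-- Membership in the Barron space `𝓑^s(Ω)`. -/
def MemBarron {d : ℕ} (s : ℕ) (Ω : Set (Eucl d)) (f : Eucl d → ℝ) : Prop :=
  ∃ F, IsBarronRep s Ω f F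

/-- The Barron norm: the infimum of `∫ (1 + |w|₁)^s |F(w)| dw` over all representations. -/
def barronNorm {d : ℕ} (s : ℕ) (Ω : Set (Eucl d)) (f : Eucl d → ℝ) : ℝ :=
  sInf {r | ∃ F, IsBarronRep s Ω f F ∧ r = ∫ w, (1 + l1norm w) ^ s * ‖F w‖}

/-- `G` is the weak (distributional) gradient of `u` on `Ω`. -/
def HasWeakGradient {d : ℕ} (Ω : Set (Eucl d)) (u : Eucl d → ℝ) (G : Eucl d → Eucl d) : Prop :=
  LocallyIntegrableOn u Ω volume ∧ LocallyIntegrableOn G Ω volume ∧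
  ∀ ψ : Eucl d → ℝ, ContDiff ℝ ∞ ψ → HasCompactSupport ψ → tsupport ψ ⊆ Ω →
    ∀ v : Eucl d, ∫ x in Ω, u x * fderiv ℝ ψ x v = - ∫ x in Ω, inner ℝ (G x) v * ψ x

open Classical in
/-- The weak gradient of `u` on `Ω` (determined up to null sets; `0` if there is none). -/
def weakGradient {d : ℕ} (Ω : Set (Eucl d)) (u : Eucl d → ℝ) : Eucl d → Eucl d :=
  if h : ∃ G, HasWeakGradient Ω u G then h.choose else 0

/-- Membership in the Sobolev space `H¹(Ω)`. -/
def MemH1 {d : ℕ} (Ω : Set (Eucl d)) (u : Eucl d → ℝ) : Prop :=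
  MemLp u 2 (volume.restrict Ω) ∧
  ∃ G, HasWeakGradient Ω u G ∧ MemLp G 2 (volume.restrict Ω)

/-- The uniform probability distribution on `Ω`: normalized Lebesgue measure. It is the Lebesgue
measure on `Ω` itself when `Ω` has volume one. -/
def uniformLaw {d : ℕ} (Ω : Set (Eucl d)) : Measure (Eucl d) :=
  (volume Ω)⁻¹ • volume.restrict Ω

/-- The squared `H¹(Ω)` norm `∫ |u|² + |∇u|²`, with respect to the uniform law on `Ω`. -/
def h1NormSq {d : ℕ} (Ω : Set (Eucl d)) (u : Eucl d → ℝ) : ℝ :=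
  ∫ x, (u x ^ 2 + ‖weakGradient Ω u x‖ ^ 2) ∂(uniformLaw Ω)

/-- The Tikhonov regularized expected loss `∫ u² - 2 u y + |∇u|²` under the uniform law. -/
def tikLoss {d : ℕ} (Ω : Set (Eucl d)) (y u : Eucl d → ℝ) : ℝ :=
  ∫ x, (u x ^ 2 - 2 * u x * y x + ‖weakGradient Ω u x‖ ^ 2) ∂(uniformLaw Ω)

/-- The empirical Tikhonov loss at the sample points `X 0, …, X (N - 1)`, for a differentiable
function `φ`. -/
def tikLossEmp {d N : ℕ} (y : Eucl d → ℝ) (X : Fin N → Eucl d) (φ : Eucl d → ℝ) : ℝ :=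
  (1 / (N : ℝ)) * ∑ i, (φ (X i) ^ 2 - 2 * φ (X i) * y (X i) + ‖gradient φ (X i)‖ ^ 2)

/-- `u ∈ V` is a `δ`-minimizer of `L` over `V`: `L u ≤ inf_V L + δ`. -/
def IsDeltaMinimizer {α : Type*} (L : α → ℝ) (V : Set α) (δ : ℝ) (u : α) : Prop :=
  u ∈ V ∧ ∀ v ∈ V, L u ≤ L v + δ

end

/-! ### The bounded difference inequality -/

/-! The loss is quadratic and its minimizer `uhat` is taken over a vector space, so the first
variation at `uhat` vanishes and the excess loss of any `H¹` function equals its squared `H¹`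
distance to `uhat` (`tikLoss_sub_eq_h1NormSq`). For a network `φ` and a fixed reference network
`φ₀`, write `L(φ) - L(uhat)` as `[(L - L_N)(φ) - (L - L_N)(φ₀)] + [L_N(φ) - L_N(φ₀)] + [L(φ₀) -
L(uhat)]`. The second bracket is at most `δ`. The first is an estimation error, the third an
approximation error.

Estimation (`tikLoss_deviation_confidence`): the supremum of the first bracket over `φ` is a
function of the sample with bounded differences, hence close to its mean with high probability;
symmetrization bounds the mean by a Rademacher average. The contraction principle strips off the
squares and the activation, and an average of `m` neurons has no larger Rademacher average than a
single signed neuron, so one is left with affine functions. The width enters only through the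
temperature `τ = √m`, which is the Lipschitz constant used for the derivative of the activation.

Approximation (`exists_network_approx`): values and gradients are joined into jets in `L²(ρ)`. By
`exists_norm_sum_sub_le` it suffices that every functional be nearly as large on some scaled neuron
as on the target: a greedy choice then gives the rate `1/√m`. This is a duality statement
(`integral_inner_barron_le`). A Fourier mode is a function of one variable along a direction of unit
`ℓ¹` norm, and Taylor's formula with integral remainder writes it as a superposition of ReLU ridge
functions whose total mass is at most a multiple of `(1 + |w|₁)²|F w|`. Replacing ReLU by softplus
costs `O(1/τ)` after integration over the kink position, for the value and for the derivative alike.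
With `τ = √m` this smoothing error has the same order as the greedy error, and no logarithm appears.
-/

lemma integrable_of_abs_le {α : Type*} [MeasurableSpace α] {μ : Measure α} [IsFiniteMeasure μ]
    {f : α → ℝ} (hf : Measurable f) {K : ℝ} (hK : ∀ x, |f x| ≤ K) : Integrable f μ :=
  Integrable.of_bound hf.aestronglyMeasurable K (Filter.Eventually.of_forall hK)

/-- Fubini with the first coordinate split off. It drives the induction on the number of variables
below. -/
lemma integral_pi_succ {α : Type*} [MeasurableSpace α] (ρ : Measure α) [IsProbabilityMeasure ρ]
    {N : ℕ} {f : (Fin (N + 1) → α) → ℝ} (hf : Measurable f) {K : ℝ} (hK : ∀ x, |f x| ≤ K) :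
    ∫ X, f X ∂(Measure.pi fun _ : Fin (N + 1) => ρ) =
      ∫ x, ∫ X, f (Fin.cons x X) ∂(Measure.pi fun _ : Fin N => ρ) ∂ρ := by
  have h := (measurePreserving_piFinSuccAbove (fun _ : Fin (N + 1) => ρ) 0).symm
  rw [← h.integral_comp']
  rw [integral_prod]
  · simp only [MeasurableEquiv.piFinSuccAbove_symm_apply, Fin.insertNthEquiv, Fin.insertNth_zero]
    rfl
  · exact integrable_of_abs_le (hf.comp (MeasurableEquiv.measurable _)) (fun x => hK _)

lemma measurable_finCons {α : Type*} [MeasurableSpace α] {N : ℕ} :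
    Measurable fun p : α × (Fin N → α) => (Fin.cons p.1 p.2 : Fin (N + 1) → α) := by
  refine measurable_pi_lambda _ fun i => ?_
  refine Fin.cases ?_ (fun j => ?_) i
  · simpa using measurable_fst
  · simp only [Fin.cons_succ]
    fun_prop

/-- A bounded function of `N` independent variables, which changes by at most `c` when one of them
is changed, is sub-Gaussian. -/
theorem mgf_le_of_bounded_differences {α : Type*} [MeasurableSpace α] (ρ : Measure α)
    [IsProbabilityMeasure ρ] {c K : ℝ} (hc : 0 ≤ c) (t : ℝ) :
    ∀ (N : ℕ) (f : (Fin N → α) → ℝ), Measurable f → (∀ X, |f X| ≤ K) →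
      (∀ X i a, |f (Function.update X i a) - f X| ≤ c) →
      ∫ X, Real.exp (t * f X) ∂(Measure.pi fun _ : Fin N => ρ) ≤
        Real.exp (t * (∫ X, f X ∂(Measure.pi fun _ : Fin N => ρ)) + N * c ^ 2 * t ^ 2 / 2) := by
  intro N
  induction N with
  | zero =>
    intro f hf hK hd
    simp [Measure.pi_of_empty (fun _ : Fin 0 => ρ) (Fin.elim0)]
  | succ N ih =>
    intro f hf hK hd
    set π := Measure.pi fun _ : Fin N => ρ
    have hexp : ∀ X, |Real.exp (t * f X)| ≤ Real.exp (|t| * K) := fun X => by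
      rw [abs_of_pos (Real.exp_pos _), Real.exp_le_exp]
      calc t * f X ≤ |t * f X| := le_abs_self _
        _ = |t| * |f X| := abs_mul _ _
        _ ≤ |t| * K := by gcongr; exact hK X
    have hfc : ∀ x, Measurable fun X : Fin N → α => f (Fin.cons x X) := fun x =>
      hf.comp (measurable_finCons.comp measurable_prodMk_left)
    rw [integral_pi_succ ρ (f := fun X => Real.exp (t * f X)) (by fun_prop) hexp,
      integral_pi_succ ρ hf hK]
    set g : α → ℝ := fun x => ∫ X, f (Fin.cons x X) ∂π with hg
    have hgm : Measurable g := by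
      have : StronglyMeasurable g := StronglyMeasurable.integral_prod_right (f := fun x X => f (Fin.cons x X)) (hf.comp measurable_finCons).stronglyMeasurable
      exact this.measurable
    have hgK : ∀ x, |g x| ≤ K := fun x => by
      have := norm_integral_le_of_norm_le_const (μ := π) (f := fun X => f (Fin.cons x X)) (C := K)
        (Filter.Eventually.of_forall fun X => hK _)
      simpa using this
    have hgd : ∀ x x', |g x - g x'| ≤ c := fun x x' => by
      rw [hg]
      simp only
      rw [← integral_sub (integrable_of_abs_le (hfc x) fun _ => hK _)
        (integrable_of_abs_le (hfc x') fun _ => hK _)]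
      have := norm_integral_le_of_norm_le_const (μ := π)
        (f := fun X => f (Fin.cons x X) - f (Fin.cons x' X)) (C := c)
        (Filter.Eventually.of_forall fun X => ?_)
      · simpa using this
      · have := hd (Fin.cons x' X) 0 x
        rwa [Fin.update_cons_zero] at this
    -- With the first variable frozen, the remaining ones fall under the induction hypothesis; what
    -- is left is the conditional mean `g`, a function of one variable with oscillation at most `c`.
    have step : ∀ x, ∫ X, Real.exp (t * f (Fin.cons x X)) ∂π ≤
        Real.exp (t * g x) * Real.exp (N * c ^ 2 * t ^ 2 / 2) := fun x => by
      rw [← Real.exp_add]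
      refine ih (fun X => f (Fin.cons x X)) (hfc x) (fun _ => hK _) fun X i a => ?_
      have := hd (Fin.cons x X) i.succ a
      rwa [Fin.cons_update]
    have hgt : ∀ x, |Real.exp (t * g x)| ≤ Real.exp (|t| * K) := fun x => by
      rw [abs_of_pos (Real.exp_pos _), Real.exp_le_exp]
      calc t * g x ≤ |t * g x| := le_abs_self _
        _ = |t| * |g x| := abs_mul _ _
        _ ≤ |t| * K := by gcongr; exact hgK x
    have hint : Integrable (fun x => Real.exp (t * g x)) ρ :=
      integrable_of_abs_le (by fun_prop) hgt
    obtain ⟨x₀⟩ : Nonempty α := nonempty_of_isProbabilityMeasure ρ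
    -- Hoeffding's lemma on an interval of length `2c` centred at a value of `g`. This gives
    -- variance proxy `c²` instead of the optimal `c²/4` and avoids locating the infimum of `g`.
    have hsub := ProbabilityTheory.hasSubgaussianMGF_of_mem_Icc (μ := ρ) (X := g)
      (a := g x₀ - c) (b := g x₀ + c) hgm.aemeasurable
      (Filter.Eventually.of_forall fun x => by
        have := abs_le.1 (hgd x x₀); constructor <;> linarith)
    have hmgf := hsub.mgf_le t
    rw [ProbabilityTheory.mgf] at hmgf
    have e1 : ∫ x, Real.exp (t * (g x - ∫ x, g x ∂ρ)) ∂ρ =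
        (∫ x, Real.exp (t * g x) ∂ρ) * Real.exp (-(t * ∫ x, g x ∂ρ)) := by
      rw [← integral_mul_const]
      congr 1; ext x; rw [← Real.exp_add]; ring_nf
    have e2 : ((((‖g x₀ + c - (g x₀ - c)‖₊ / 2) ^ 2 : NNReal)) : ℝ) = c ^ 2 := by
      push_cast
      rw [show g x₀ + c - (g x₀ - c) = 2 * c by ring, Real.norm_eq_abs, abs_of_nonneg (by positivity)]
      ring
    rw [e1, e2] at hmgf
    have hmgf' : ∫ x, Real.exp (t * g x) ∂ρ ≤ Real.exp (t * ∫ x, g x ∂ρ + c ^ 2 * t ^ 2 / 2) := by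
      rw [Real.exp_add]
      calc _ = (∫ x, Real.exp (t * g x) ∂ρ) * Real.exp (-(t * ∫ x, g x ∂ρ)) *
              Real.exp (t * ∫ x, g x ∂ρ) := by
              rw [mul_assoc, ← Real.exp_add]; simp
        _ ≤ Real.exp (c ^ 2 * t ^ 2 / 2) * Real.exp (t * ∫ x, g x ∂ρ) := by gcongr
        _ = _ := mul_comm _ _
    calc ∫ x, ∫ X, Real.exp (t * f (Fin.cons x X)) ∂π ∂ρ
        ≤ ∫ x, Real.exp (t * g x) * Real.exp (N * c ^ 2 * t ^ 2 / 2) ∂ρ := by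
          refine integral_mono_of_nonneg (Filter.Eventually.of_forall fun x =>
            integral_nonneg fun _ => (Real.exp_pos _).le) (hint.mul_const _)
            (Filter.Eventually.of_forall step)
      _ = (∫ x, Real.exp (t * g x) ∂ρ) * Real.exp (N * c ^ 2 * t ^ 2 / 2) := integral_mul_const _ _
      _ ≤ Real.exp (t * ∫ x, g x ∂ρ + c ^ 2 * t ^ 2 / 2) * Real.exp (N * c ^ 2 * t ^ 2 / 2) := by
          gcongr
      _ = _ := by
          rw [← Real.exp_add]; congr 1; push_cast; ring

/-- The bounded difference inequality, in the form of a confidence bound. -/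
theorem bounded_differences_confidence {α : Type*} [MeasurableSpace α] (ρ : Measure α)
    [IsProbabilityMeasure ρ] {N : ℕ} (hN : 1 ≤ N) {c K : ℝ} (hc : 0 < c) {f : (Fin N → α) → ℝ}
    (hf : Measurable f) (hK : ∀ X, |f X| ≤ K)
    (hd : ∀ X i a, |f (Function.update X i a) - f X| ≤ c) {ε : ℝ} (hε : 0 < ε) (hε1 : ε < 1) :
    ENNReal.ofReal (1 - ε) ≤ Measure.pi (fun _ : Fin N => ρ)
      {X | f X ≤ (∫ X, f X ∂(Measure.pi fun _ : Fin N => ρ)) +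
        c * Real.sqrt N * Real.sqrt (-2 * Real.log ε)} := by
  set π := Measure.pi fun _ : Fin N => ρ
  set E := ∫ X, f X ∂π
  have hint : ∀ t, Integrable (fun X => Real.exp (t * (f X - E))) π := fun t =>
    integrable_of_abs_le (K := Real.exp (|t| * (K + |E|))) (by fun_prop) fun X => by
      rw [abs_of_pos (Real.exp_pos _), Real.exp_le_exp]
      calc t * (f X - E) ≤ |t * (f X - E)| := le_abs_self _
        _ = |t| * |f X - E| := abs_mul _ _
        _ ≤ |t| * (K + |E|) := by
          gcongr; exact (abs_sub _ _).trans (add_le_add_left (hK X) _)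
  obtain ⟨V, hV⟩ : ∃ V : NNReal, (V : ℝ) = N * c ^ 2 := ⟨⟨N * c ^ 2, by positivity⟩, rfl⟩
  have hsub : ProbabilityTheory.HasSubgaussianMGF (fun X => f X - E)
      V π := by
    refine ⟨hint, fun t => ?_⟩
    have := mgf_le_of_bounded_differences ρ hc.le t N f hf hK hd
    rw [ProbabilityTheory.mgf]
    have e1 : ∫ X, Real.exp (t * (f X - E)) ∂π =
        (∫ X, Real.exp (t * f X) ∂π) * Real.exp (-(t * E)) := by
      rw [← integral_mul_const]
      congr 1; ext x; rw [← Real.exp_add]; ring_nf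
    rw [e1]
    calc _ ≤ Real.exp (t * E + N * c ^ 2 * t ^ 2 / 2) * Real.exp (-(t * E)) := by gcongr
      _ = _ := by rw [← Real.exp_add]; congr 1; rw [hV]; ring
  have hlog : 0 < -2 * Real.log ε := by have := Real.log_neg hε hε1; linarith
  -- Chosen so that the sub-Gaussian tail `exp(-s² / (2 N c²))` is exactly `ε`.
  set s := c * Real.sqrt N * Real.sqrt (-2 * Real.log ε)
  have hNpos : (0 : ℝ) < N := by exact_mod_cast hN
  have htail := hsub.measure_ge_le (ε := s) (by positivity)
  have hs : Real.exp (-s ^ 2 / (2 * (V : ℝ))) = ε := by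
    have : s ^ 2 = c ^ 2 * N * (-2 * Real.log ε) := by
      simp only [s, mul_pow]
      rw [Real.sq_sqrt hNpos.le, Real.sq_sqrt hlog.le]
    rw [this, hV]
    rw [show -(c ^ 2 * N * (-2 * Real.log ε)) / (2 * (N * c ^ 2)) = Real.log ε by field_simp]
    exact Real.exp_log hε
  rw [hs] at htail
  have hms : MeasurableSet {X | s ≤ f X - E} := measurableSet_le measurable_const (by fun_prop)
  have hcompl : π.real {X | s ≤ f X - E}ᶜ ≥ 1 - ε := by
    rw [probReal_compl_eq_one_sub hms]; linarith
  calc ENNReal.ofReal (1 - ε) ≤ ENNReal.ofReal (π.real {X | s ≤ f X - E}ᶜ) :=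
        ENNReal.ofReal_le_ofReal hcompl
    _ = π {X | s ≤ f X - E}ᶜ := ofReal_measureReal
    _ ≤ _ := by
      refine measure_mono fun X hX => ?_
      simp only [Set.mem_compl_iff, Set.mem_ofPred_eq, not_le] at hX ⊢
      linarith

/-! ### Rademacher averages -/

/-- The sign `±1` encoded by a Boolean. -/
def boolSign (b : Bool) : ℝ := if b then 1 else -1

/-- The average of `F` over all `2 ^ N` sign vectors. -/
noncomputable def signAvg (N : ℕ) (F : (Fin N → ℝ) → ℝ) : ℝ :=
  (2 ^ N : ℝ)⁻¹ * ∑ s : Fin N → Bool, F fun i => boolSign (s i)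

lemma boolSign_not (b : Bool) : boolSign (!b) = -boolSign b := by cases b <;> simp [boolSign]

lemma boolSign_sq (b : Bool) : boolSign b * boolSign b = 1 := by cases b <;> simp [boolSign]

lemma abs_boolSign (b : Bool) : |boolSign b| = 1 := by cases b <;> simp [boolSign]

section SignAvg

variable {N : ℕ}

lemma signAvg_mono {F G : (Fin N → ℝ) → ℝ}
    (h : ∀ s : Fin N → Bool, F (fun i => boolSign (s i)) ≤ G fun i => boolSign (s i)) :
    signAvg N F ≤ signAvg N G :=
  mul_le_mul_of_nonneg_left (Finset.sum_le_sum fun s _ => h s) (by positivity)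

lemma signAvg_add (F G : (Fin N → ℝ) → ℝ) :
    signAvg N (fun e => F e + G e) = signAvg N F + signAvg N G := by
  simp only [signAvg, Finset.sum_add_distrib, mul_add]

lemma signAvg_const_mul (c : ℝ) (F : (Fin N → ℝ) → ℝ) :
    signAvg N (fun e => c * F e) = c * signAvg N F := by
  simp only [signAvg, ← Finset.mul_sum]; ring

lemma signAvg_sum {ι : Type*} (S : Finset ι) (F : ι → (Fin N → ℝ) → ℝ) :
    signAvg N (fun e => ∑ j ∈ S, F j e) = ∑ j ∈ S, signAvg N (F j) := by
  simp only [signAvg]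
  rw [Finset.sum_comm, Finset.mul_sum]

lemma signAvg_const (c : ℝ) : signAvg N (fun _ => c) = c := by
  simp [signAvg]

lemma signAvg_neg_comp (F : (Fin N → ℝ) → ℝ) :
    signAvg N (fun e => F fun i => -e i) = signAvg N F := by
  simp only [signAvg]
  congr 1
  refine Fintype.sum_equiv (Equiv.piCongrRight fun _ : Fin N => Equiv.boolNot) _ _ fun s => ?_
  simp [boolSign_not]

/-- Changing the sign of one coordinate. -/
def flipAt (j : Fin N) (s : Fin N → Bool) : Fin N → Bool := Function.update s j (!s j)

lemma flipAt_involutive (j : Fin N) : Function.Involutive (flipAt j) := fun s => by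
  simp [flipAt]

lemma sum_flipAt (j : Fin N) (F : (Fin N → Bool) → ℝ) :
    ∑ s, F (flipAt j s) = ∑ s, F s :=
  Equiv.sum_comp (flipAt_involutive j).toPerm F

/-- Flipping the `j`-th sign permutes the sign vectors and reverses the product. This orthogonality
is the only independence property of the signs needed for the second moment. -/
lemma signAvg_mul_of_ne {i j : Fin N} (h : i ≠ j) : signAvg N (fun e => e i * e j) = 0 := by
  have h1 : ∑ s : Fin N → Bool, boolSign (s i) * boolSign (s j) = 0 := by
    have := sum_flipAt j fun s => boolSign (s i) * boolSign (s j)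
    simp only [flipAt, Function.update_self, Function.update_of_ne h, boolSign_not, mul_neg,
      Finset.sum_neg_distrib] at this
    linarith
  simp [signAvg, h1]

lemma signAvg_sq_sum (c : Fin N → ℝ) :
    signAvg N (fun e => (∑ i, e i * c i) ^ 2) = ∑ i, c i ^ 2 := by
  have h : ∀ e : Fin N → ℝ, (∑ i, e i * c i) ^ 2 = ∑ i, ∑ j, (c i * c j) * (e i * e j) := fun e => by
    rw [sq, Finset.sum_mul_sum]
    refine Finset.sum_congr rfl fun i _ => Finset.sum_congr rfl fun j _ => by ring
  simp only [h, signAvg_sum, signAvg_const_mul]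
  refine Finset.sum_congr rfl fun i _ => ?_
  rw [Finset.sum_eq_single i]
  · have : signAvg N (fun e => e i * e i) = 1 := by
      simp only [signAvg, boolSign_sq]; simp
    rw [this]; ring
  · intro j _ hj
    rw [signAvg_mul_of_ne hj.symm, mul_zero]
  · simp

/-- The variance of `|F|` is nonnegative. -/
lemma signAvg_abs_le (F : (Fin N → ℝ) → ℝ) :
    signAvg N (fun e => |F e|) ≤ Real.sqrt (signAvg N fun e => F e ^ 2) := by
  refine Real.le_sqrt_of_sq_le ?_
  set A := signAvg N fun e => |F e|
  have h : 0 ≤ signAvg N fun e => (|F e| - A) ^ 2 := by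
    rw [← signAvg_const (N := N) 0]
    exact signAvg_mono fun s => sq_nonneg _
  have h2 : signAvg N (fun e => (|F e| - A) ^ 2) = signAvg N (fun e => F e ^ 2) - A ^ 2 := by
    have : (fun e : Fin N → ℝ => (|F e| - A) ^ 2) =
        fun e => F e ^ 2 + ((-2 * A) * |F e| + A ^ 2) := by
      ext e; rw [sub_sq, sq_abs]; ring
    rw [this, signAvg_add, signAvg_add, signAvg_const_mul, signAvg_const]
    simp only [A]; ring
  linarith

lemma signAvg_abs_sum_le (c : Fin N → ℝ) {K : ℝ} (hK : 0 ≤ K) (hc : ∀ i, |c i| ≤ K) :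
    signAvg N (fun e => |∑ i, e i * c i|) ≤ K * Real.sqrt N := by
  refine (signAvg_abs_le _).trans ?_
  rw [signAvg_sq_sum]
  refine Real.sqrt_le_iff.2 ⟨by positivity, ?_⟩
  rw [mul_pow, Real.sq_sqrt (Nat.cast_nonneg _)]
  calc ∑ i, c i ^ 2 ≤ ∑ _i : Fin N, K ^ 2 := Finset.sum_le_sum fun i _ => sq_le_sq' (abs_le.1 (hc i)).1 (abs_le.1 (hc i)).2
    _ = K ^ 2 * N := by simp [mul_comm]

lemma bddAbove_signSum {T : Type*} {a : T → Fin N → ℝ} {K : ℝ} (ha : ∀ t i, |a t i| ≤ K)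
    {e : Fin N → ℝ} (he : ∀ i, |e i| ≤ 1) : BddAbove (Set.range fun t => ∑ i, e i * a t i) := by
  refine ⟨∑ _i : Fin N, K, ?_⟩
  rintro _ ⟨t, rfl⟩
  refine Finset.sum_le_sum fun i _ => ?_
  calc e i * a t i ≤ |e i * a t i| := le_abs_self _
    _ = |e i| * |a t i| := abs_mul _ _
    _ ≤ 1 * |a t i| := by gcongr; exact he i
    _ ≤ K := by rw [one_mul]; exact ha t i

lemma ciSup_add_ciSup_le_of_forall {T : Type*} [Nonempty T] {p q : T → ℝ} {r : ℝ}
    (h : ∀ t t', p t + q t' ≤ r) : (⨆ t, p t) + ⨆ t, q t ≤ r := by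
  have : (⨆ t, p t) ≤ r - ⨆ t, q t := by
    refine ciSup_le fun t => ?_
    have : (⨆ t, q t) ≤ r - p t := ciSup_le fun t' => by linarith [h t t']
    linarith
  linarith

/-- The one-coordinate case of the contraction principle. A sign vector is paired with its flip at
`j`: the sum of the two suprema is a supremum over pairs `(t, t')` in which coordinate `j` enters
only through `±(u t j - u t' j)`. That difference is at most `|v t j - v t' j|`, and the absolute
value can be removed by exchanging `t` and `t'`. -/
lemma signAvg_ciSup_le_of_eq_off {T : Type*} [Nonempty T] {u v : T → Fin N → ℝ} {K : ℝ}
    (hv : ∀ t i, |v t i| ≤ K) (j : Fin N)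
    (huv : ∀ t i, i ≠ j → u t i = v t i)
    (h : ∀ t t', |u t j - u t' j| ≤ |v t j - v t' j|) :
    signAvg N (fun e => ⨆ t, ∑ i, e i * u t i) ≤ signAvg N (fun e => ⨆ t, ∑ i, e i * v t i) := by
  have key : ∀ s : Fin N → Bool,
      (⨆ t, ∑ i, boolSign (s i) * u t i) + (⨆ t, ∑ i, boolSign (flipAt j s i) * u t i) ≤
      (⨆ t, ∑ i, boolSign (s i) * v t i) + ⨆ t, ∑ i, boolSign (flipAt j s i) * v t i := by
    intro s
    have hs1 : ∀ w : T → Fin N → ℝ, ∀ t, ∑ i, boolSign (s i) * w t i =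
        (∑ i ∈ Finset.univ.erase j, boolSign (s i) * w t i) + boolSign (s j) * w t j := fun w t => by
      rw [Finset.sum_erase_add _ _ (Finset.mem_univ j)]
    have hs2 : ∀ w : T → Fin N → ℝ, ∀ t, ∑ i, boolSign (flipAt j s i) * w t i =
        (∑ i ∈ Finset.univ.erase j, boolSign (s i) * w t i) - boolSign (s j) * w t j := fun w t => by
      rw [← Finset.sum_erase_add _ _ (Finset.mem_univ j), sub_eq_add_neg]
      congr 1
      · refine Finset.sum_congr rfl fun i hi => ?_
        rw [flipAt, Function.update_of_ne (Finset.ne_of_mem_erase hi)]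
      · simp [flipAt, boolSign_not]
    have hc : ∀ t, ∑ i ∈ Finset.univ.erase j, boolSign (s i) * u t i =
        ∑ i ∈ Finset.univ.erase j, boolSign (s i) * v t i := fun t =>
      Finset.sum_congr rfl fun i hi => by rw [huv t i (Finset.ne_of_mem_erase hi)]
    have b1 := bddAbove_signSum hv (e := fun i => boolSign (s i)) fun i => (abs_boolSign _).le
    have b2 := bddAbove_signSum hv (e := fun i => boolSign (flipAt j s i))
      fun i => (abs_boolSign _).le
    refine ciSup_add_ciSup_le_of_forall fun t t' => ?_
    have u1 := le_ciSup b1 t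
    have u2 := le_ciSup b2 t'
    have u3 := le_ciSup b1 t'
    have u4 := le_ciSup b2 t
    rw [hs1, hs2, hc, hc]
    rw [hs1] at u1 u3
    rw [hs2] at u2 u4
    have hle : boolSign (s j) * (u t j - u t' j) ≤ |v t j - v t' j| := by
      calc _ ≤ |boolSign (s j) * (u t j - u t' j)| := le_abs_self _
        _ ≤ _ := by rw [abs_mul, abs_boolSign, one_mul]; exact h t t'
    -- According to the sign, the competitors in the two suprema are `(t, t')` or `(t', t)`.
    have hcase : |v t j - v t' j| = boolSign (s j) * (v t j - v t' j) ∨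
        |v t j - v t' j| = -(boolSign (s j) * (v t j - v t' j)) := by
      have : |v t j - v t' j| = |boolSign (s j) * (v t j - v t' j)| := by
        rw [abs_mul, abs_boolSign, one_mul]
      rw [this]; exact abs_choice _
    rcases hcase with h' | h' <;> rw [h'] at hle <;> linarith
  unfold signAvg
  refine mul_le_mul_of_nonneg_left ?_ (by positivity)
  have := Finset.sum_le_sum fun s (_ : s ∈ Finset.univ) => key s
  rw [Finset.sum_add_distrib, Finset.sum_add_distrib,
    sum_flipAt j (fun s => ⨆ t, ∑ i, boolSign (s i) * u t i),
    sum_flipAt j (fun s => ⨆ t, ∑ i, boolSign (s i) * v t i)] at this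
  linarith

/-- The contraction principle for Rademacher averages. -/
theorem signAvg_ciSup_contraction {T : Type*} [Nonempty T] {b a : T → Fin N → ℝ} {K : ℝ}
    (hb : ∀ t i, |b t i| ≤ K) (ha : ∀ t i, |a t i| ≤ K)
    (h : ∀ t t' i, |b t i - b t' i| ≤ |a t i - a t' i|) :
    signAvg N (fun e => ⨆ t, ∑ i, e i * b t i) ≤ signAvg N (fun e => ⨆ t, ∑ i, e i * a t i) := by
  classical
  -- Coordinates are switched from `b` to `a` one at a time.
  have key : ∀ S : Finset (Fin N), signAvg N (fun e => ⨆ t, ∑ i, e i * b t i) ≤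
      signAvg N (fun e => ⨆ t, ∑ i, e i * (if i ∈ S then a t i else b t i)) := by
    intro S
    induction S using Finset.induction_on with
    | empty => simp
    | insert j S hj ih =>
      refine ih.trans (signAvg_ciSup_le_of_eq_off (K := K) (fun t i => ?_) j (fun t i hi => ?_)
        fun t t' => ?_)
      · split_ifs
        exacts [ha t i, hb t i]
      · simp [hi]
      · simpa [hj] using h t t' j
  simpa using key Finset.univ

/-- The contraction principle with a Lipschitz constant. -/
theorem signAvg_ciSup_contraction_mul {T : Type*} [Nonempty T] {b a : T → Fin N → ℝ} {K L : ℝ}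
    (hL : 0 ≤ L) (hb : ∀ t i, |b t i| ≤ K) (ha : ∀ t i, |a t i| ≤ K)
    (h : ∀ t t' i, |b t i - b t' i| ≤ L * |a t i - a t' i|) :
    signAvg N (fun e => ⨆ t, ∑ i, e i * b t i) ≤
      L * signAvg N (fun e => ⨆ t, ∑ i, e i * a t i) := by
  have h1 := signAvg_ciSup_contraction (b := b) (a := fun t i => L * a t i) (K := max K (L * K))
    (fun t i => (hb t i).trans (le_max_left _ _))
    (fun t i => by
      rw [abs_mul, abs_of_nonneg hL]
      exact (mul_le_mul_of_nonneg_left (ha t i) hL).trans (le_max_right _ _))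
    (fun t t' i => by rw [← mul_sub, abs_mul, abs_of_nonneg hL]; exact h t t' i)
  refine h1.trans_eq ?_
  rw [← signAvg_const_mul]
  congr 1; ext e
  rw [Real.mul_iSup_of_nonneg hL]
  congr 1; ext t
  rw [Finset.mul_sum]
  exact Finset.sum_congr rfl fun i _ => by ring

/-- Absolute values can be moved into a Rademacher average at the price of a constant. -/
theorem signAvg_ciSup_abs_le {T : Type*} [Nonempty T] {a : T → Fin N → ℝ} {K : ℝ}
    (ha : ∀ t i, |a t i| ≤ K) (t₀ : T) :
    signAvg N (fun e => ⨆ t, |∑ i, e i * a t i|) ≤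
      2 * signAvg N (fun e => ⨆ t, ∑ i, e i * a t i) +
        signAvg N (fun e => |∑ i, e i * a t₀ i|) := by
  have hneg : signAvg N (fun e => ⨆ t, ∑ i, e i * a t i) =
      signAvg N (fun e => ⨆ t, ∑ i, -e i * a t i) :=
    (signAvg_neg_comp fun e => ⨆ t, ∑ i, e i * a t i).symm
  rw [two_mul]
  nth_rewrite 2 [hneg]
  rw [← signAvg_add, ← signAvg_add]
  refine signAvg_mono fun s => ?_
  have b1 := bddAbove_signSum ha (e := fun i => boolSign (s i)) fun i => (abs_boolSign _).le
  have b2 := bddAbove_signSum ha (e := fun i => -boolSign (s i))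
    fun i => by rw [abs_neg, abs_boolSign]
  refine ciSup_le fun t => ?_
  have u1 := le_ciSup b1 t
  have u2 := le_ciSup b2 t
  -- Once `|·|` is resolved into one of the two signs, the supremum with the other sign is bounded
  -- below by its value at `t₀`. That value may be negative, which accounts for the extra term in
  -- the bound.
  have u3 := le_ciSup b1 t₀
  have u4 := le_ciSup b2 t₀
  have hn : ∀ t, ∑ i, -boolSign (s i) * a t i = -∑ i, boolSign (s i) * a t i := fun t => by
    rw [← Finset.sum_neg_distrib]; exact Finset.sum_congr rfl fun i _ => by ring
  simp only [hn] at u2 u4 ⊢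
  have := le_abs_self (∑ i, boolSign (s i) * a t₀ i)
  have := neg_abs_le (∑ i, boolSign (s i) * a t₀ i)
  rcases abs_choice (∑ i, boolSign (s i) * a t i) with h | h <;> rw [h] <;> linarith

end SignAvg

/-! ### Symmetrization and uniform deviations -/

section Symmetrization

variable {α : Type*} [MeasurableSpace α] {N : ℕ}

/-- In each coordinate the map is the identity or a swap of two independent copies, both of which
preserve `ρ × ρ`; the product is regrouped as a power of `α × α` to apply this. -/
lemma measurePreserving_swapAt (ρ : Measure α) [IsProbabilityMeasure ρ] (s : Fin N → Bool) :
    MeasurePreserving (fun p : (Fin N → α) × (Fin N → α) =>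
      ((fun i => if s i then p.1 i else p.2 i, fun i => if s i then p.2 i else p.1 i) :
        (Fin N → α) × (Fin N → α)))
      ((Measure.pi fun _ => ρ).prod (Measure.pi fun _ => ρ))
      ((Measure.pi fun _ => ρ).prod (Measure.pi fun _ => ρ)) := by
  have h1 := measurePreserving_arrowProdEquivProdArrow α α (Fin N) (fun _ => ρ) fun _ => ρ
  have h2 : MeasurePreserving (fun (a : Fin N → α × α) i => (if s i then id else Prod.swap) (a i))
      (Measure.pi fun _ => ρ.prod ρ) (Measure.pi fun _ => ρ.prod ρ) := by
    refine measurePreserving_pi _ _ (f := fun i => if s i then id else Prod.swap) fun i => ?_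
    split_ifs
    · exact MeasurePreserving.id _
    · exact Measure.measurePreserving_swap
  have h3 := (h1.comp h2).comp h1.symm
  convert h3 using 1
  funext p
  refine Prod.ext (funext fun i => ?_) (funext fun i => ?_) <;>
  · simp only [Function.comp, MeasurableEquiv.arrowProdEquivProdArrow, MeasurableEquiv.coe_mk,
      Equiv.arrowProdEquivProdArrow]
    by_cases h : s i <;> simp [h]

lemma measurable_signSum_ciSup {T : Type*} [Countable T] {g : T → α → ℝ}
    (hg : ∀ t, Measurable (g t)) (e : Fin N → ℝ) :
    Measurable fun X : Fin N → α => ⨆ t, ∑ i, e i * g t (X i) :=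
  Measurable.iSup fun t => Finset.measurable_sum _ fun i _ =>
    ((hg t).comp (measurable_pi_apply i)).const_mul _

lemma abs_ciSup_le_of_forall {T : Type*} [Nonempty T] {f : T → ℝ} {K : ℝ} (h : ∀ t, |f t| ≤ K) :
    |⨆ t, f t| ≤ K := by
  obtain ⟨t₀⟩ := ‹Nonempty T›
  refine abs_le.2 ⟨?_, ciSup_le fun t => (abs_le.1 (h t)).2⟩
  exact (abs_le.1 (h t₀)).1.trans (le_ciSup (f := f) ⟨K, by rintro _ ⟨t, rfl⟩; exact (abs_le.1 (h t)).2⟩ t₀)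

lemma abs_sum_le_card_mul {a : Fin N → ℝ} {K : ℝ} (h : ∀ i, |a i| ≤ K) : |∑ i, a i| ≤ N * K := by
  calc |∑ i, a i| ≤ ∑ i, |a i| := Finset.abs_sum_le_sum_abs _ _
    _ ≤ ∑ _i : Fin N, K := Finset.sum_le_sum fun i _ => h i
    _ = N * K := by simp

lemma integral_pi_eval (ρ : Measure α) [IsProbabilityMeasure ρ] (i : Fin N) {h : α → ℝ}
    (hh : Measurable h) : ∫ X : Fin N → α, h (X i) ∂(Measure.pi fun _ => ρ) = ∫ x, h x ∂ρ := by
  have he := measurePreserving_eval (fun _ : Fin N => ρ) i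
  rw [← he.map_eq, integral_map he.measurable.aemeasurable hh.aestronglyMeasurable]
  simp [he.map_eq]

/-- The symmetrization inequality. -/
theorem integral_ciSup_deviation_le {T : Type*} [Countable T] [Nonempty T] (ρ : Measure α)
    [IsProbabilityMeasure ρ] {g : T → α → ℝ} {M : ℝ} (hg : ∀ t, Measurable (g t))
    (hM : ∀ t x, |g t x| ≤ M) :
    ∫ X, ⨆ t, ∑ i, ((∫ x, g t x ∂ρ) - g t (X i)) ∂(Measure.pi fun _ : Fin N => ρ) ≤
      2 * ∫ X, signAvg N (fun e => ⨆ t, ∑ i, e i * g t (X i)) ∂(Measure.pi fun _ : Fin N => ρ) := by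
  set π := Measure.pi fun _ : Fin N => ρ
  set Ψ : (Fin N → α) × (Fin N → α) → ℝ := fun p => ⨆ t, ∑ i, (g t (p.2 i) - g t (p.1 i)) with hΨ
  have hterm : ∀ t x x', |g t x' - g t x| ≤ 2 * M := fun t x x' => by
    have := (abs_sub (g t x') (g t x)).trans (add_le_add (hM t x') (hM t x)); linarith
  have hΨb : ∀ p, |Ψ p| ≤ N * (2 * M) := fun p =>
    abs_ciSup_le_of_forall fun t => abs_sum_le_card_mul fun i => hterm _ _ _
  have hΨbdd : ∀ p : (Fin N → α) × (Fin N → α),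
      BddAbove (Set.range fun t => ∑ i, (g t (p.2 i) - g t (p.1 i))) := fun p => by
    refine ⟨N * (2 * M), ?_⟩
    rintro _ ⟨t, rfl⟩
    exact (abs_le.1 (abs_sum_le_card_mul fun i => hterm _ _ _)).2
  have hΨm : Measurable Ψ := Measurable.iSup fun t => Finset.measurable_sum _ fun i _ => by
    have := hg t
    fun_prop
  have hΨi : Integrable Ψ (π.prod π) := integrable_of_abs_le hΨm hΨb
  set R : (Fin N → Bool) → (Fin N → α) → ℝ :=
    fun s X => ⨆ t, ∑ i, boolSign (s i) * g t (X i) with hR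
  have hRm : ∀ s, Measurable (R s) := fun s => measurable_signSum_ciSup hg _
  have hsg : ∀ (s : Fin N → Bool) (t : T) (X : Fin N → α) (i : Fin N),
      |boolSign (s i) * g t (X i)| ≤ M := fun s t X i => by
    rw [abs_mul, abs_boolSign, one_mul]; exact hM _ _
  have hRb : ∀ s X, |R s X| ≤ N * M := fun s X =>
    abs_ciSup_le_of_forall fun t => abs_sum_le_card_mul (hsg s t X)
  have hRbdd : ∀ (s : Fin N → Bool) (X : Fin N → α), BddAbove (Set.range fun t => ∑ i, boolSign (s i) * g t (X i)) := fun s X => by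
    refine ⟨N * M, ?_⟩
    rintro _ ⟨t, rfl⟩
    exact (abs_le.1 (abs_sum_le_card_mul (hsg s t X))).2
  have hRi : ∀ s, Integrable (R s) π := fun s => integrable_of_abs_le (hRm s) (hRb s)
  -- introduce a ghost sample
  have step1 : ∫ X, ⨆ t, ∑ i, ((∫ x, g t x ∂ρ) - g t (X i)) ∂π ≤ ∫ p, Ψ p ∂(π.prod π) := by
    rw [integral_prod _ hΨi]
    refine integral_mono (integrable_of_abs_le (K := N * (2 * M)) ?_ fun X => ?_)
      hΨi.integral_prod_left fun X => ?_
    · exact Measurable.iSup fun t => Finset.measurable_sum _ fun i _ =>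
        measurable_const.sub ((hg t).comp (measurable_pi_apply i))
    · refine abs_ciSup_le_of_forall fun t => abs_sum_le_card_mul fun i => ?_
      have h1 : |∫ x, g t x ∂ρ| ≤ M := by
        simpa using norm_integral_le_of_norm_le_const (μ := ρ) (f := g t)
          (Filter.Eventually.of_forall (hM t))
      have := (abs_sub (∫ x, g t x ∂ρ) (g t (X i))).trans (add_le_add h1 (hM t _)); linarith
    · refine ciSup_le fun t => ?_
      have hti : ∀ i, Integrable (fun X' : Fin N → α => g t (X' i) - g t (X i)) π := fun i =>
        integrable_of_abs_le (((hg t).comp (measurable_pi_apply i)).sub_const _)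
          fun X' => hterm t _ _
      have : ∑ i, ((∫ x, g t x ∂ρ) - g t (X i)) = ∫ X', ∑ i, (g t (X' i) - g t (X i)) ∂π := by
        rw [integral_finsetSum _ fun i _ => hti i]
        refine Finset.sum_congr rfl fun i _ => ?_
        have hi : Integrable (fun X' : Fin N → α => g t (X' i)) π :=
          integrable_of_abs_le ((hg t).comp (measurable_pi_apply i)) fun _ => hM t _
        rw [integral_sub hi (integrable_const _), integral_pi_eval ρ i (hg t)]
        simp
      rw [this]
      refine integral_mono (integrable_finsetSum _ fun i _ => hti i)
        (integrable_of_abs_le (hΨm.comp measurable_prodMk_left) fun X' => hΨb _) fun X' => ?_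
      exact le_ciSup (hΨbdd (X, X')) t
  -- exchange the two samples in the coordinates where the sign is negative
  have step2 : ∀ s : Fin N → Bool, ∫ p, Ψ p ∂(π.prod π) ≤
      (∫ X, R s X ∂π) + ∫ X, R (fun i => !s i) X ∂π := by
    intro s
    have h := measurePreserving_swapAt ρ s
    have e1 : ∫ p, Ψ p ∂(π.prod π) = ∫ p : (Fin N → α) × (Fin N → α),
        Ψ (fun i => if s i then p.1 i else p.2 i, fun i => if s i then p.2 i else p.1 i)
          ∂(π.prod π) := by
      conv_lhs => rw [← h.map_eq]
      rw [integral_map h.measurable.aemeasurable hΨm.aestronglyMeasurable]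
    rw [e1]
    have e2 : (∫ X, R s X ∂π) = ∫ p : (Fin N → α) × (Fin N → α), R s p.2 ∂(π.prod π) := by
      rw [integral_fun_snd]; simp
    have e3 : (∫ X, R (fun i => !s i) X ∂π) =
        ∫ p : (Fin N → α) × (Fin N → α), R (fun i => !s i) p.1 ∂(π.prod π) := by
      rw [integral_fun_fst]; simp
    have i2 : Integrable (fun p : (Fin N → α) × (Fin N → α) => R s p.2) (π.prod π) :=
      integrable_of_abs_le ((hRm s).comp measurable_snd) fun p => hRb s _
    have i3 : Integrable (fun p : (Fin N → α) × (Fin N → α) => R (fun i => !s i) p.1)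
        (π.prod π) :=
      integrable_of_abs_le ((hRm _).comp measurable_fst) fun p => hRb _ _
    rw [e2, e3, ← integral_add i2 i3]
    refine integral_mono (integrable_of_abs_le (hΨm.comp h.measurable) fun p => hΨb _)
      (i2.add i3) fun p => ?_
    refine ciSup_le fun t => ?_
    refine le_trans (le_of_eq ?_) (add_le_add (le_ciSup (hRbdd s p.2) t)
      (le_ciSup (hRbdd (fun i => !s i) p.1) t))
    simp only
    rw [← Finset.sum_add_distrib]
    refine Finset.sum_congr rfl fun i _ => ?_
    cases s i <;> simp [boolSign] <;> ring
  have hsum : ∑ s : Fin N → Bool, ∫ X, R (fun i => !s i) X ∂π = ∑ s, ∫ X, R s X ∂π :=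
    Equiv.sum_comp (Equiv.piCongrRight fun _ : Fin N => Equiv.boolNot) fun s => ∫ X, R s X ∂π
  have htot := Finset.sum_le_sum fun s (_ : s ∈ Finset.univ) => step2 s
  rw [Finset.sum_add_distrib, hsum] at htot
  have hcard : ∑ _s : Fin N → Bool, ∫ p, Ψ p ∂(π.prod π) = 2 ^ N * ∫ p, Ψ p ∂(π.prod π) := by simp
  rw [hcard] at htot
  have hfin : ∫ X, signAvg N (fun e => ⨆ t, ∑ i, e i * g t (X i)) ∂π =
      (2 ^ N : ℝ)⁻¹ * ∑ s, ∫ X, R s X ∂π := by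
    simp only [signAvg]
    rw [integral_const_mul, integral_finsetSum _ fun s _ => hRi s]
  rw [hfin]
  refine step1.trans ?_
  have h2 : (0 : ℝ) < 2 ^ N := by positivity
  rw [← mul_assoc, mul_comm 2, mul_assoc, ← div_eq_inv_mul, le_div_iff₀ h2]
  linarith

/-- Uniform deviation bound for a countable bounded class with controlled Rademacher averages,
relative to a reference element of the class. -/
theorem uniform_deviation_confidence {T : Type*} [Countable T] (t₀ : T) (ρ : Measure α)
    [IsProbabilityMeasure ρ] (hN : 1 ≤ N) {g : T → α → ℝ} {M r : ℝ} (hM0 : 0 < M)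
    (hg : ∀ t, Measurable (g t)) (hM : ∀ t x, |g t x| ≤ M)
    (hr : ∀ᵐ X ∂(Measure.pi fun _ : Fin N => ρ),
      signAvg N (fun e => ⨆ t, ∑ i, e i * g t (X i)) ≤ r)
    {ε : ℝ} (hε : 0 < ε) (hε1 : ε < 1) :
    ∃ A : Set (Fin N → α), MeasurableSet A ∧
      ENNReal.ofReal (1 - ε) ≤ Measure.pi (fun _ : Fin N => ρ) A ∧ ∀ X ∈ A, ∀ t,
        ((∫ x, g t x ∂ρ) - (1 / (N : ℝ)) * ∑ i, g t (X i)) -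
          ((∫ x, g t₀ x ∂ρ) - (1 / (N : ℝ)) * ∑ i, g t₀ (X i)) ≤
        2 * r / N + 4 * M * (Real.sqrt (-2 * Real.log ε) / Real.sqrt N) := by
  have : Nonempty T := ⟨t₀⟩
  set π := Measure.pi fun _ : Fin N => ρ
  set D : T → (Fin N → α) → ℝ := fun t X => ∑ i, ((∫ x, g t x ∂ρ) - g t (X i)) with hD
  have hPg : ∀ t, |∫ x, g t x ∂ρ| ≤ M := fun t => by
    simpa using norm_integral_le_of_norm_le_const (μ := ρ) (f := g t)
      (Filter.Eventually.of_forall (hM t))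
  have hDt : ∀ t X, |D t X| ≤ N * (2 * M) := fun t X => abs_sum_le_card_mul fun i => by
    have := (abs_sub (∫ x, g t x ∂ρ) (g t (X i))).trans (add_le_add (hPg t) (hM t _)); linarith
  have hDbdd : ∀ X, BddAbove (Set.range fun t => D t X) := fun X =>
    ⟨N * (2 * M), by rintro _ ⟨t, rfl⟩; exact (abs_le.1 (hDt t X)).2⟩
  have hDm : ∀ t, Measurable (D t) := fun t => Finset.measurable_sum _ fun i _ =>
    measurable_const.sub ((hg t).comp (measurable_pi_apply i))
  -- Subtracting the deviation of the reference element controls both with a single event, so no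
  -- union bound is paid. That deviation has mean zero, so the mean of `f` is still the mean of the
  -- supremum, while the bounded difference doubles from `2M` to `4M`.
  set f : (Fin N → α) → ℝ := fun X => (⨆ t, D t X) - D t₀ X with hf
  have hfm : Measurable f := (Measurable.iSup hDm).sub (hDm t₀)
  have hsupb : ∀ X, |⨆ t, D t X| ≤ N * (2 * M) := fun X => abs_ciSup_le_of_forall fun t => hDt t X
  have hfb : ∀ X, |f X| ≤ N * (2 * M) + N * (2 * M) := fun X =>
    (abs_sub _ _).trans (add_le_add (hsupb X) (hDt t₀ X))
  have hupd : ∀ t X i a, |D t (Function.update X i a) - D t X| ≤ 2 * M := fun t X i a => by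
    have : D t (Function.update X i a) - D t X = g t (X i) - g t a := by
      simp only [hD]
      rw [← Finset.sum_sub_distrib, Finset.sum_eq_single i]
      · simp
      · intro j _ hj
        simp [Function.update_of_ne hj]
      · simp
    rw [this]
    have := (abs_sub (g t (X i)) (g t a)).trans (add_le_add (hM t _) (hM t _)); linarith
  have hfd : ∀ X i a, |f (Function.update X i a) - f X| ≤ 4 * M := fun X i a => by
    have h1 : ∀ X X', (∀ t, |D t X' - D t X| ≤ 2 * M) → (⨆ t, D t X') - (⨆ t, D t X) ≤ 2 * M := by
      intro X X' h
      rw [sub_le_iff_le_add]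
      refine ciSup_le fun t => ?_
      have := le_ciSup (hDbdd X) t
      have := (abs_le.1 (h t)).2
      linarith
    have h2 := h1 X (Function.update X i a) fun t => hupd t X i a
    have h3 := h1 (Function.update X i a) X fun t => by rw [abs_sub_comm]; exact hupd t X i a
    have h4 := abs_le.1 (hupd t₀ X i a)
    simp only [hf]
    rw [abs_le]; constructor <;> linarith
  refine ⟨{X | f X ≤ (∫ X, f X ∂π) + 4 * M * Real.sqrt N * Real.sqrt (-2 * Real.log ε)},
    measurableSet_le hfm measurable_const,
    bounded_differences_confidence ρ hN (by positivity) hfm hfb hfd hε hε1, fun X hX t => ?_⟩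
  rw [Set.mem_ofPred_eq] at hX
  have hD0 : ∫ X, D t₀ X ∂π = 0 := by
    simp only [hD]
    have hint : ∀ i : Fin N, Integrable (fun X : Fin N → α => g t₀ (X i)) π := fun i =>
      integrable_of_abs_le ((hg t₀).comp (measurable_pi_apply i)) fun _ => hM t₀ _
    have hint' : ∀ i : Fin N,
        Integrable (fun X : Fin N → α => (∫ x, g t₀ x ∂ρ) - g t₀ (X i)) π := fun i =>
      (integrable_const _).sub (hint i)
    rw [integral_finsetSum _ fun i _ => hint' i]
    refine Finset.sum_eq_zero fun i _ => ?_
    rw [integral_sub (integrable_const _) (hint i), integral_pi_eval ρ i (hg t₀)]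
    simp
  have hEf : ∫ X, f X ∂π ≤ 2 * r := by
    simp only [hf]
    rw [integral_sub (integrable_of_abs_le (Measurable.iSup hDm) hsupb)
      (integrable_of_abs_le (hDm t₀) (hDt t₀)), hD0, sub_zero]
    refine (integral_ciSup_deviation_le ρ hg hM).trans ?_
    refine mul_le_mul_of_nonneg_left ?_ (by norm_num)
    have hsi : Integrable (fun X : Fin N → α => signAvg N fun e => ⨆ t, ∑ i, e i * g t (X i)) π := by
      simp only [signAvg]
      refine Integrable.const_mul (integrable_finsetSum _ fun s _ => ?_) _
      refine integrable_of_abs_le (measurable_signSum_ciSup hg _) (K := N * M) fun X => ?_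
      refine abs_ciSup_le_of_forall fun t => abs_sum_le_card_mul fun i => ?_
      rw [abs_mul, abs_boolSign, one_mul]; exact hM _ _
    calc _ ≤ ∫ _X : Fin N → α, r ∂π := integral_mono_ae hsi (integrable_const _) hr
      _ = r := by simp
  have hNpos : (0 : ℝ) < N := by exact_mod_cast hN
  have hDN : ∀ t, (∫ x, g t x ∂ρ) - (1 / (N : ℝ)) * ∑ i, g t (X i) = D t X / N := fun t => by
    simp only [hD, Finset.sum_sub_distrib]
    simp only [Finset.sum_const, Finset.card_univ, Fintype.card_fin, nsmul_eq_mul]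
    field_simp
  rw [hDN, hDN, ← sub_div]
  have hle : D t X - D t₀ X ≤ 2 * r + 4 * M * Real.sqrt N * Real.sqrt (-2 * Real.log ε) := by
    have := le_ciSup (hDbdd X) t
    simp only [hf] at hX hEf
    linarith
  calc _ ≤ (2 * r + 4 * M * Real.sqrt N * Real.sqrt (-2 * Real.log ε)) / N := by gcongr
    _ = _ := by
      rw [add_div]; congr 1
      rw [show 4 * M * Real.sqrt N * Real.sqrt (-2 * Real.log ε) / N =
        4 * M * Real.sqrt (-2 * Real.log ε) * (Real.sqrt N / N) by ring,
        Real.sqrt_div_self]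
      field_simp

end Symmetrization

/-! ### The softplus activation -/

lemma hasDerivAt_softplus {τ : ℝ} (hτ : 0 < τ) (z : ℝ) :
    HasDerivAt (softplus τ) (Real.sigmoid (τ * z)) z := by
  have h1 : HasDerivAt (fun z : ℝ => τ * z) τ z := by simpa using (hasDerivAt_id z).const_mul τ
  have h2 := ((h1.exp.const_add 1).log (by positivity)).div_const τ
  refine h2.congr_deriv ?_
  rw [Real.sigmoid_def, Real.exp_neg]
  have := Real.exp_pos (τ * z)
  field_simp
  ring

lemma contDiff_softplus (τ : ℝ) : ContDiff ℝ ∞ (softplus τ) := by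
  unfold softplus
  refine ContDiff.div_const (ContDiff.log (by fun_prop) fun z => ?_) _
  positivity

lemma continuous_softplus (τ : ℝ) : Continuous (softplus τ) := (contDiff_softplus τ).continuous

lemma max_le_softplus {τ : ℝ} (hτ : 0 < τ) (z : ℝ) : max z 0 ≤ softplus τ z := by
  unfold softplus
  rw [le_div_iff₀ hτ, Real.le_log_iff_exp_le (by positivity)]
  rcases le_total z 0 with h | h
  · simp [max_eq_right h, Real.exp_nonneg]
  · rw [max_eq_left h, mul_comm]; linarith

lemma softplus_le {τ : ℝ} (hτ : 0 < τ) (z : ℝ) : softplus τ z ≤ max z 0 + 1 / τ := by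
  unfold softplus
  rw [div_le_iff₀ hτ, Real.log_le_iff_le_exp (by positivity), add_mul, one_div_mul_cancel hτ.ne',
    Real.exp_add]
  have h2 : (2 : ℝ) ≤ Real.exp 1 := by have := Real.add_one_le_exp (1 : ℝ); linarith
  rcases le_total z 0 with h | h
  · rw [max_eq_right h]
    have : Real.exp (τ * z) ≤ 1 := Real.exp_le_one_iff.2 (mul_nonpos_of_nonneg_of_nonpos hτ.le h)
    simp only [zero_mul, Real.exp_zero]; linarith
  · rw [max_eq_left h, mul_comm z]
    have : 1 ≤ Real.exp (τ * z) := Real.one_le_exp (by positivity)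
    nlinarith

lemma abs_softplus_le {τ : ℝ} (hτ : 1 ≤ τ) {z : ℝ} (hz : |z| ≤ 2) : |softplus τ z| ≤ 3 := by
  have h0 : 0 < τ := by linarith
  have h1 := max_le_softplus h0 z
  have h2 := softplus_le h0 z
  have h3 : max z 0 ≤ 2 := max_le (abs_le.1 hz).2 (by norm_num)
  have h4 : 1 / τ ≤ 1 := by rw [div_le_one h0]; exact hτ
  rw [abs_of_nonneg ((le_max_right _ _).trans h1)]
  linarith

/-- As for ReLU, two opposite neurons reproduce the identity exactly; this realizes the linear
Taylor term without smoothing error. -/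
lemma softplus_sub_softplus_neg {τ : ℝ} (hτ : 0 < τ) (z : ℝ) :
    softplus τ z - softplus τ (-z) = z := by
  unfold softplus
  rw [← sub_div, ← Real.log_div (by positivity) (by positivity), div_eq_iff hτ.ne']
  have : (1 + Real.exp (τ * z)) / (1 + Real.exp (τ * -z)) = Real.exp (τ * z) := by
    rw [mul_neg, Real.exp_neg]
    have := Real.exp_pos (τ * z)
    field_simp
    ring
  rw [this, Real.log_exp, mul_comm]

lemma abs_sigmoid_le_one (z : ℝ) : |Real.sigmoid z| ≤ 1 := by
  rw [abs_of_pos (Real.sigmoid_pos z)]; exact Real.sigmoid_le_one z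

lemma abs_softplus_sub_le {τ : ℝ} (hτ : 0 < τ) (z z' : ℝ) :
    |softplus τ z - softplus τ z'| ≤ 1 * |z - z'| := by
  have := Convex.norm_image_sub_le_of_norm_hasDerivWithin_le (f := softplus τ)
    (f' := fun z => Real.sigmoid (τ * z)) (s := Set.univ) (C := 1) (x := z') (y := z)
    (fun x _ => (hasDerivAt_softplus hτ x).hasDerivWithinAt)
    (fun x _ => by rw [Real.norm_eq_abs]; exact abs_sigmoid_le_one _)
    convex_univ (Set.mem_univ _) (Set.mem_univ _)
  simpa using this

/-- The gradient of a network involves this function, and its Lipschitz constant is the source of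
the factor `τ = √m` in the estimation error. The sharp constant would be `τ/4`. -/
lemma abs_sigmoid_mul_sub_le {τ : ℝ} (hτ : 0 ≤ τ) (z z' : ℝ) :
    |Real.sigmoid (τ * z) - Real.sigmoid (τ * z')| ≤ τ * |z - z'| := by
  have := Convex.norm_image_sub_le_of_norm_hasDerivWithin_le (f := Real.sigmoid)
    (f' := fun z => Real.sigmoid z * (1 - Real.sigmoid z)) (s := Set.univ) (C := 1)
    (x := τ * z') (y := τ * z)
    (fun x _ => (Real.hasDerivAt_sigmoid x).hasDerivWithinAt)
    (fun x _ => by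
      have h1 := Real.sigmoid_nonneg x
      have h2 := Real.sigmoid_le_one x
      rw [Real.norm_eq_abs, abs_of_nonneg (mul_nonneg h1 (by linarith))]
      nlinarith)
    convex_univ (Set.mem_univ _) (Set.mem_univ _)
  rwa [Real.norm_eq_abs, Real.norm_eq_abs, one_mul, ← mul_sub, abs_mul, abs_of_nonneg hτ] at this

/-! ### Two-layer networks -/

section Network

variable {d m : ℕ}

lemma l1norm_nonneg (w : Eucl d) : 0 ≤ l1norm w := Finset.sum_nonneg fun _ _ => abs_nonneg _

lemma inner_eq_sum (w x : Eucl d) : inner ℝ w x = ∑ j, w j * x j := by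
  rw [PiLp.inner_apply]
  exact Finset.sum_congr rfl fun j _ => by simp [mul_comm]

lemma abs_inner_le_l1norm (w : Eucl d) {x : Eucl d} {R : ℝ} (hx : ∀ j, |x j| ≤ R) :
    |inner ℝ w x| ≤ l1norm w * R := by
  rw [inner_eq_sum, l1norm, Finset.sum_mul]
  refine (Finset.abs_sum_le_sum_abs _ _).trans (Finset.sum_le_sum fun j _ => ?_)
  rw [abs_mul]
  exact mul_le_mul_of_nonneg_left (hx j) (abs_nonneg _)

lemma norm_le_l1norm (w : Eucl d) : ‖w‖ ≤ l1norm w := by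
  refine (sq_le_sq₀ (norm_nonneg _) (l1norm_nonneg _)).1 ?_
  rw [← real_inner_self_eq_norm_sq, sq]
  have hj : ∀ j, |w j| ≤ l1norm w := fun j =>
    Finset.single_le_sum (f := fun i => |w i|) (fun i _ => abs_nonneg _) (Finset.mem_univ j)
  exact (le_abs_self _).trans (abs_inner_le_l1norm w hj)

lemma abs_apply_le_l1norm (w : Eucl d) (j : Fin d) : |w j| ≤ l1norm w :=
  Finset.single_le_sum (f := fun i => |w i|) (fun _ _ => abs_nonneg _) (Finset.mem_univ j)

lemma l1norm_smul (c : ℝ) (w : Eucl d) : l1norm (c • w) = |c| * l1norm w := by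
  simp [l1norm, abs_mul, Finset.mul_sum]

/-- The parameters `(w, b)` of a single neuron. -/
abbrev NeuronParam (d : ℕ) : Type := {p : Eucl d × ℝ // l1norm p.1 = 1 ∧ |p.2| ≤ 1}

/-- The affine function `w · x + b` of a neuron. -/
noncomputable def preact (p : NeuronParam d) (x : Eucl d) : ℝ := inner ℝ p.1.1 x + p.1.2

lemma abs_preact_le (p : NeuronParam d) {x : Eucl d} (hx : ∀ j, |x j| ≤ 1) : |preact p x| ≤ 2 := by
  have h1 := abs_inner_le_l1norm p.1.1 hx
  rw [p.2.1] at h1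
  have := (abs_add_le (inner ℝ p.1.1 x) p.1.2).trans (add_le_add h1 p.2.2)
  unfold preact
  linarith

lemma continuous_preact_right (p : NeuronParam d) : Continuous (preact p) := by
  unfold preact; fun_prop

lemma continuous_preact_left (x : Eucl d) : Continuous fun p : NeuronParam d => preact p x := by
  unfold preact; fun_prop

/-- The parameters of a two-layer network of width `m`. -/
abbrev NetParam (d m : ℕ) (B : ℝ) : Type :=
  {c : ℝ // |c| ≤ 2 * B} × (Fin m → {a : ℝ // |a| ≤ 16 * B}) × (Fin m → NeuronParam d)

variable {B : ℝ}

/-- The two-layer network with given parameters. -/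
noncomputable def network (σ : ℝ → ℝ) (θ : NetParam d m B) (x : Eucl d) : ℝ :=
  θ.1 + (1 / (m : ℝ)) * ∑ k, (θ.2.1 k : ℝ) * σ (preact (θ.2.2 k) x)

/-- The gradient of the two-layer softplus network with given parameters. -/
noncomputable def networkGrad (τ : ℝ) (θ : NetParam d m B) (x : Eucl d) : Eucl d :=
  (1 / (m : ℝ)) • ∑ k, ((θ.2.1 k : ℝ) * Real.sigmoid (τ * preact (θ.2.2 k) x)) • (θ.2.2 k).1.1

lemma twoLayer_eq_range (σ : ℝ → ℝ) : twoLayer d m σ B = Set.range (network (d := d) (m := m) (B := B) σ) := by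
  ext φ
  constructor
  · rintro ⟨c, a, w, b, hc, ha, hw, hb, h⟩
    exact ⟨⟨⟨c, hc⟩, fun k => ⟨a k, ha k⟩, fun k => ⟨(w k, b k), hw k, hb k⟩⟩, funext fun x => (h x).symm⟩
  · rintro ⟨θ, rfl⟩
    exact ⟨θ.1, fun k => θ.2.1 k, fun k => (θ.2.2 k).1.1, fun k => (θ.2.2 k).1.2, θ.1.2,
      fun k => (θ.2.1 k).2, fun k => (θ.2.2 k).2.1, fun k => (θ.2.2 k).2.2, fun x => rfl⟩

lemma hasGradientAt_softplus_preact {τ : ℝ} (hτ : 0 < τ) (p : NeuronParam d) (x : Eucl d) :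
    HasGradientAt (fun x => softplus τ (preact p x)) (Real.sigmoid (τ * preact p x) • p.1.1) x := by
  rw [hasGradientAt_iff_hasFDerivAt]
  have h1 : HasFDerivAt (preact p) (innerSL ℝ p.1.1) x :=
    ((innerSL ℝ p.1.1).hasFDerivAt (x := x)).add_const p.1.2
  refine ((hasDerivAt_softplus hτ (preact p x)).comp_hasFDerivAt x h1).congr_fderiv ?_
  ext v
  simp

lemma hasGradientAt_network {τ : ℝ} (hτ : 0 < τ) (θ : NetParam d m B) (x : Eucl d) :
    HasGradientAt (network (softplus τ) θ) (networkGrad τ θ x) x := by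
  rw [hasGradientAt_iff_hasFDerivAt]
  have h1 := ((HasFDerivAt.fun_sum (u := Finset.univ) fun k _ =>
    ((hasGradientAt_softplus_preact hτ (θ.2.2 k) x).hasFDerivAt).const_mul
      (θ.2.1 k : ℝ)).const_mul (1 / (m : ℝ))).const_add (θ.1 : ℝ)
  refine h1.congr_fderiv ?_
  simp only [networkGrad, map_smul, map_sum, mul_smul]

lemma gradient_network {τ : ℝ} (hτ : 0 < τ) (θ : NetParam d m B) (x : Eucl d) :
    gradient (network (softplus τ) θ) x = networkGrad τ θ x :=
  (hasGradientAt_network hτ θ x).gradient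

lemma continuous_network (τ : ℝ) (θ : NetParam d m B) : Continuous (network (softplus τ) θ) := by
  have h := continuous_softplus τ
  have h' := fun k => continuous_preact_right (θ.2.2 k)
  unfold network
  fun_prop

lemma continuous_networkGrad (τ : ℝ) (θ : NetParam d m B) : Continuous (networkGrad τ θ) := by
  have h' := fun k => continuous_preact_right (θ.2.2 k)
  have := continuous_sigmoid
  unfold networkGrad
  fun_prop

/-- Continuity in the parameters, here and for the gradient, allows deviation bounds to pass from a
countable dense set of parameters to all of them. -/
lemma continuous_network_param (τ : ℝ) (x : Eucl d) :
    Continuous fun θ : NetParam d m B => network (softplus τ) θ x := by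
  have h := continuous_softplus τ
  have h' := continuous_preact_left x
  unfold network
  fun_prop

lemma continuous_networkGrad_param (τ : ℝ) (x : Eucl d) :
    Continuous fun θ : NetParam d m B => networkGrad τ θ x := by
  have h' := continuous_preact_left x
  have := continuous_sigmoid
  unfold networkGrad
  fun_prop

lemma abs_average_mul_le {a s : Fin m → ℝ} {A K : ℝ} (hA : 0 ≤ A) (hK : 0 ≤ K)
    (ha : ∀ k, |a k| ≤ A) (hs : ∀ k, |s k| ≤ K) : |(1 / (m : ℝ)) * ∑ k, a k * s k| ≤ A * K := by
  rcases Nat.eq_zero_or_pos m with rfl | hm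
  · simpa using mul_nonneg hA hK
  have hm' : (0 : ℝ) < m := by exact_mod_cast hm
  rw [abs_mul, abs_of_pos (by positivity), one_div, inv_mul_le_iff₀ hm']
  refine abs_sum_le_card_mul fun k => ?_
  rw [abs_mul]
  exact mul_le_mul (ha k) (hs k) (abs_nonneg _) hA

lemma abs_network_le (hB : 0 ≤ B) {τ : ℝ} (hτ : 1 ≤ τ) (θ : NetParam d m B) {x : Eucl d}
    (hx : ∀ j, |x j| ≤ 1) : |network (softplus τ) θ x| ≤ 50 * B := by
  unfold network
  -- Preactivations on the cube are at most `2` in size, so activations are at most `3`, and `50 = 2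
  -- + 16 · 3`.
  have h1 := abs_average_mul_le (a := fun k => (θ.2.1 k : ℝ)) (A := 16 * B) (K := 3) (by positivity)
    (by norm_num) (fun k => (θ.2.1 k).2)
    fun k => abs_softplus_le hτ (abs_preact_le (θ.2.2 k) hx)
  have h2 := θ.1.2
  refine (abs_add_le _ _).trans ?_
  linarith

lemma networkGrad_apply (τ : ℝ) (θ : NetParam d m B) (x : Eucl d) (j : Fin d) :
    networkGrad τ θ x j = (1 / (m : ℝ)) *
      ∑ k, ((θ.2.1 k : ℝ) * (θ.2.2 k).1.1 j) * Real.sigmoid (τ * preact (θ.2.2 k) x) := by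
  simp only [networkGrad, PiLp.smul_apply, smul_eq_mul]
  congr 1
  have : ∀ (S : Finset (Fin m)) (f : Fin m → Eucl d), (∑ k ∈ S, f k) j = ∑ k ∈ S, f k j := fun S f => by
    simp
  rw [this]
  exact Finset.sum_congr rfl fun k _ => by simp; ring

lemma abs_mul_weight_le (θ : NetParam d m B) (k : Fin m) (j : Fin d) :
    |(θ.2.1 k : ℝ) * (θ.2.2 k).1.1 j| ≤ 16 * B := by
  have h1 := (abs_apply_le_l1norm (θ.2.2 k).1.1 j).trans_eq (θ.2.2 k).2.1
  have h2 := (θ.2.1 k).2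
  rw [abs_mul]
  nlinarith [abs_nonneg (θ.2.1 k : ℝ), abs_nonneg ((θ.2.2 k).1.1 j)]

lemma abs_networkGrad_apply_le (hB : 0 ≤ B) (τ : ℝ) (θ : NetParam d m B) (x : Eucl d) (j : Fin d) :
    |networkGrad τ θ x j| ≤ 16 * B := by
  rw [networkGrad_apply]
  have := abs_average_mul_le (A := 16 * B) (K := 1) (by positivity) (by norm_num)
    (fun k => abs_mul_weight_le θ k j) fun k => abs_sigmoid_le_one (τ * preact (θ.2.2 k) x)
  linarith

lemma norm_networkGrad_le (hB : 0 ≤ B) (τ : ℝ) (θ : NetParam d m B) (x : Eucl d) :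
    ‖networkGrad τ θ x‖ ≤ 16 * B := by
  rcases Nat.eq_zero_or_pos m with rfl | hm
  · simp [networkGrad, hB]
  have hm' : (0 : ℝ) < m := by exact_mod_cast hm
  unfold networkGrad
  rw [norm_smul, Real.norm_eq_abs, abs_of_pos (by positivity), one_div, inv_mul_le_iff₀ hm']
  calc _ ≤ ∑ _k : Fin m, 16 * B := norm_sum_le_of_le _ fun k _ => ?_
    _ = m * (16 * B) := by simp
  rw [norm_smul, Real.norm_eq_abs, abs_mul]
  have h1 := (norm_le_l1norm (θ.2.2 k).1.1).trans_eq (θ.2.2 k).2.1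
  have h2 := (θ.2.1 k).2
  have h3 := abs_sigmoid_le_one (τ * preact (θ.2.2 k) x)
  have h4 : |(θ.2.1 k : ℝ)| * |Real.sigmoid (τ * preact (θ.2.2 k) x)| ≤ 16 * B * 1 := by
    gcongr
  calc _ ≤ (16 * B * 1) * 1 := by gcongr
    _ = 16 * B := by ring

/-! ### Rademacher averages of networks -/

variable {N : ℕ}

/-- Duality of `ℓ¹` and `ℓ^∞`: the signed sum is linear in `(w, b)`, so its supremum is at most the
sum over coordinates of absolute signed sums, each of mean at most `√N` by the second moment. -/
lemma signAvg_affine_le [Nonempty (NeuronParam d)] {x : Fin N → Eucl d}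
    (hx : ∀ i j, |x i j| ≤ 1) :
    signAvg N (fun e => ⨆ p : NeuronParam d, ∑ i, e i * preact p (x i)) ≤
      (d + 1) * Real.sqrt N := by
  calc _ ≤ signAvg N (fun e => (∑ j : Fin d, |∑ i, e i * x i j|) + |∑ i, e i * 1|) := by
        refine signAvg_mono fun s => ciSup_le fun p => ?_
        have : ∑ i, boolSign (s i) * preact p (x i) =
            (∑ j, p.1.1 j * ∑ i, boolSign (s i) * x i j) + p.1.2 * ∑ i, boolSign (s i) * 1 := by
          simp only [preact, inner_eq_sum, mul_add, Finset.sum_add_distrib, Finset.mul_sum]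
          congr 1
          · rw [Finset.sum_comm]
            exact Finset.sum_congr rfl fun j _ => Finset.sum_congr rfl fun i _ => by ring
          · exact Finset.sum_congr rfl fun i _ => by ring
        rw [this]
        refine add_le_add (Finset.sum_le_sum fun j _ => ?_) ?_
        · refine (le_abs_self _).trans ?_
          rw [abs_mul]
          exact mul_le_of_le_one_left (abs_nonneg _)
            ((abs_apply_le_l1norm p.1.1 j).trans_eq p.2.1)
        · refine (le_abs_self _).trans ?_
          rw [abs_mul]
          exact mul_le_of_le_one_left (abs_nonneg _) p.2.2
    _ ≤ ∑ _j : Fin d, Real.sqrt N + Real.sqrt N := by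
        rw [signAvg_add, signAvg_sum]
        refine add_le_add (Finset.sum_le_sum fun j _ => ?_) ?_
        · simpa using signAvg_abs_sum_le (fun i => x i j) zero_le_one fun i => hx i j
        · simpa using signAvg_abs_sum_le (fun _ : Fin N => (1 : ℝ)) zero_le_one fun i => by simp
    _ = _ := by simp; ring

/-- Contraction applies to suprema without absolute values. Removing them costs the factor `2` and
one fixed neuron, which gives the terms `2L(d + 1)` and `K`. -/
lemma signAvg_neuron_abs_le [Nonempty (NeuronParam d)] {x : Fin N → Eucl d}
    (hx : ∀ i j, |x i j| ≤ 1) {σ : ℝ → ℝ} {L K : ℝ} (hL : 0 ≤ L) (hK : 0 ≤ K)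
    (hσL : ∀ z z', |σ z - σ z'| ≤ L * |z - z'|) (hσ : ∀ z, |z| ≤ 2 → |σ z| ≤ K) :
    signAvg N (fun e => ⨆ p : NeuronParam d, |∑ i, e i * σ (preact p (x i))|) ≤
      (2 * L * (d + 1) + K) * Real.sqrt N := by
  obtain ⟨p₀⟩ := ‹Nonempty (NeuronParam d)›
  have hb : ∀ (p : NeuronParam d) i, |σ (preact p (x i))| ≤ K := fun p i =>
    hσ _ (abs_preact_le p (hx i))
  have h1 := signAvg_ciSup_abs_le (a := fun (p : NeuronParam d) i => σ (preact p (x i))) hb p₀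
  have h2 := signAvg_ciSup_contraction_mul (T := NeuronParam d) (N := N)
    (b := fun p i => σ (preact p (x i))) (a := fun p i => preact p (x i)) (K := max K 2) hL
    (fun p i => (hb p i).trans (le_max_left _ _))
    (fun p i => (abs_preact_le p (hx i)).trans (le_max_right _ _)) fun p p' i => hσL _ _
  have h3 : signAvg N (fun e => ⨆ p : NeuronParam d, ∑ i, e i * preact p (x i)) ≤
      (d + 1) * Real.sqrt N := by
    have : Nonempty (NeuronParam d) := ⟨p₀⟩
    exact signAvg_affine_le hx
  have h4 := signAvg_abs_sum_le (fun i => σ (preact p₀ (x i))) hK (hb p₀)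
  have h5 := mul_le_mul_of_nonneg_left h3 hL
  calc _ ≤ _ := h1
    _ ≤ 2 * (L * ((d + 1) * Real.sqrt N)) + K * Real.sqrt N := by linarith
    _ = _ := by ring

/-- The signed sum of an average of neurons is an average of signed sums of neurons, hence at most
`A` times the supremum over one neuron. The width drops out. -/
lemma signAvg_superposition_le {T : Type*} [Nonempty T] (hm : 1 ≤ m) {x : Fin N → Eucl d}
    (hx : ∀ i j, |x i j| ≤ 1) {σ : ℝ → ℝ} {L K C A : ℝ} (hL : 0 ≤ L) (hK : 0 ≤ K) (hA : 0 ≤ A)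
    (hC : 0 ≤ C)
    (hσL : ∀ z z', |σ z - σ z'| ≤ L * |z - z'|) (hσ : ∀ z, |z| ≤ 2 → |σ z| ≤ K)
    (c : T → ℝ) (a : T → Fin m → ℝ) (p : T → Fin m → NeuronParam d)
    (hc : ∀ t, |c t| ≤ C) (ha : ∀ t k, |a t k| ≤ A) :
    signAvg N (fun e => ⨆ t, ∑ i, e i *
      (c t + (1 / (m : ℝ)) * ∑ k, a t k * σ (preact (p t k) (x i)))) ≤
      (C + A * (2 * L * (d + 1) + K)) * Real.sqrt N := by
  -- Since the width is positive, a member of the class supplies a neuron; no assumption on `d` is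
  -- needed.
  have : Nonempty (NeuronParam d) := ⟨p (Classical.arbitrary T) ⟨0, hm⟩⟩
  calc _ ≤ signAvg N (fun e => C * |∑ i, e i * 1| +
        A * ⨆ p : NeuronParam d, |∑ i, e i * σ (preact p (x i))|) := by
        refine signAvg_mono fun s => ciSup_le fun t => ?_
        have hbdd : BddAbove (Set.range fun p : NeuronParam d =>
            |∑ i, boolSign (s i) * σ (preact p (x i))|) := by
          refine ⟨N * K, ?_⟩
          rintro _ ⟨q, rfl⟩
          refine abs_sum_le_card_mul fun i => ?_
          rw [abs_mul, abs_boolSign, one_mul]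
          exact hσ _ (abs_preact_le q (hx i))
        have e1 : ∑ i, boolSign (s i) *
            (c t + (1 / (m : ℝ)) * ∑ k, a t k * σ (preact (p t k) (x i))) =
            c t * (∑ i, boolSign (s i) * 1) + (1 / (m : ℝ)) *
              ∑ k, a t k * ∑ i, boolSign (s i) * σ (preact (p t k) (x i)) := by
          simp only [mul_add, Finset.sum_add_distrib, Finset.mul_sum]
          congr 1
          · exact Finset.sum_congr rfl fun i _ => by ring
          · rw [Finset.sum_comm]
            exact Finset.sum_congr rfl fun k _ => Finset.sum_congr rfl fun i _ => by ring
        rw [e1]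
        refine add_le_add ?_ ?_
        · refine (le_abs_self _).trans ?_
          rw [abs_mul]
          exact mul_le_mul_of_nonneg_right (hc t) (abs_nonneg _)
        · refine (le_abs_self _).trans (abs_average_mul_le hA ?_ (ha t) fun k => ?_)
          · exact (abs_nonneg _).trans (le_ciSup hbdd (p t ⟨0, hm⟩))
          · exact le_ciSup hbdd (p t k)
    _ ≤ C * Real.sqrt N + A * ((2 * L * (d + 1) + K) * Real.sqrt N) := by
        rw [signAvg_add, signAvg_const_mul, signAvg_const_mul]
        refine add_le_add (mul_le_mul_of_nonneg_left ?_ hC) (mul_le_mul_of_nonneg_left ?_ hA)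
        · simpa using signAvg_abs_sum_le (fun _ : Fin N => (1 : ℝ)) zero_le_one fun i => by simp
        · exact signAvg_neuron_abs_le hx hL hK hσL hσ
    _ = _ := by ring

/-- The integrand of the Tikhonov loss of a softplus network, at a point with label `v`. -/
noncomputable def networkLoss (τ : ℝ) (θ : NetParam d m B) (x : Eucl d) (v : ℝ) : ℝ :=
  network (softplus τ) θ x ^ 2 - 2 * network (softplus τ) θ x * v + ‖networkGrad τ θ x‖ ^ 2

lemma abs_networkLoss_le (hB : 0 ≤ B) {τ : ℝ} (hτ : 1 ≤ τ) (θ : NetParam d m B) {x : Eucl d}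
    (hx : ∀ j, |x j| ≤ 1) {v Y : ℝ} (hv : |v| ≤ Y) :
    |networkLoss τ θ x v| ≤ 2756 * B ^ 2 + 100 * B * Y := by
  have h1 := abs_network_le hB hτ θ hx
  have h2 := norm_networkGrad_le hB τ θ x
  unfold networkLoss
  -- The constant is `2756 = 50² + 16²`.
  have e1 : |network (softplus τ) θ x ^ 2| ≤ (50 * B) ^ 2 := by
    rw [abs_pow]; gcongr
  have e2 : |2 * network (softplus τ) θ x * v| ≤ 2 * (50 * B) * Y := by
    rw [abs_mul, abs_mul, abs_two]; gcongr
  have e3 : |‖networkGrad τ θ x‖ ^ 2| ≤ (16 * B) ^ 2 := by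
    rw [abs_pow, abs_norm]; gcongr
  calc _ ≤ (50 * B) ^ 2 + 2 * (50 * B) * Y + (16 * B) ^ 2 :=
        (abs_add_le _ _).trans (add_le_add ((abs_sub _ _).trans (add_le_add e1 e2)) e3)
    _ = _ := by ring

lemma abs_sq_sub_sq_le {a b K : ℝ} (ha : |a| ≤ K) (hb : |b| ≤ K) :
    |a ^ 2 - b ^ 2| ≤ 2 * K * |a - b| := by
  rw [sq_sub_sq, abs_mul]
  refine mul_le_mul_of_nonneg_right ?_ (abs_nonneg _)
  refine (abs_add_le a b).trans ?_
  linarith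

/-- The Rademacher average of the Tikhonov loss over a class of softplus networks. -/
theorem signAvg_networkLoss_le {T : Type*} [Nonempty T] (hB : 0 ≤ B) (hm : 1 ≤ m) {τ : ℝ}
    (hτ : 1 ≤ τ) {x : Fin N → Eucl d} (hx : ∀ i j, |x i j| ≤ 1) {v : Fin N → ℝ} {Y : ℝ}
    (hY : 0 ≤ Y) (hv : ∀ i, |v i| ≤ Y) (θ : T → NetParam d m B) :
    signAvg N (fun e => ⨆ t, ∑ i, e i * networkLoss τ (θ t) (x i) (v i)) ≤
      ((100 * B + 2 * Y) * (2 * B + 16 * B * (2 * (d + 1) + 3)) +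
        d * (32 * B * (16 * B * (2 * (d + 1) + 1)))) * (τ * Real.sqrt N) := by
  have hτ0 : 0 < τ := by linarith
  set φ : T → Fin N → ℝ := fun t i => network (softplus τ) (θ t) (x i) with hφ
  set ψ : Fin d → T → Fin N → ℝ := fun j t i => networkGrad τ (θ t) (x i) j with hψ
  have hφb : ∀ t i, |φ t i| ≤ 50 * B := fun t i => abs_network_le hB hτ _ (hx i)
  have hψb : ∀ j t i, |ψ j t i| ≤ 16 * B := fun j t i => abs_networkGrad_apply_le hB τ _ _ j
  have hφ2b : ∀ t i, |φ t i ^ 2| ≤ (50 * B) ^ 2 := fun t i => by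
    rw [abs_pow]; have := hφb t i; gcongr
  have hφvb : ∀ t i, |-2 * φ t i * v i| ≤ 2 * (50 * B) * Y := fun t i => by
    rw [abs_mul, abs_mul, abs_neg, abs_two]; have := hφb t i; have := hv i; gcongr
  have hψ2b : ∀ j t i, |ψ j t i ^ 2| ≤ (16 * B) ^ 2 := fun j t i => by
    rw [abs_pow]; have := hψb j t i; gcongr
  -- The squared gradient norm is split into coordinates, at the price of a factor `d`, so that
  -- scalar contraction suffices.
  have hsplit : signAvg N (fun e => ⨆ t, ∑ i, e i * networkLoss τ (θ t) (x i) (v i)) ≤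
      signAvg N (fun e => ⨆ t, ∑ i, e i * φ t i ^ 2) +
      signAvg N (fun e => ⨆ t, ∑ i, e i * (-2 * φ t i * v i)) +
      ∑ j, signAvg N (fun e => ⨆ t, ∑ i, e i * ψ j t i ^ 2) := by
    rw [← signAvg_sum, ← signAvg_add, ← signAvg_add]
    refine signAvg_mono fun s => ciSup_le fun t => ?_
    have hs : ∀ i, |boolSign (s i)| ≤ 1 := fun i => (abs_boolSign _).le
    have e1 : ∑ i, boolSign (s i) * networkLoss τ (θ t) (x i) (v i) =
        (∑ i, boolSign (s i) * φ t i ^ 2) + (∑ i, boolSign (s i) * (-2 * φ t i * v i)) +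
          ∑ j, ∑ i, boolSign (s i) * ψ j t i ^ 2 := by
      rw [Finset.sum_comm, ← Finset.sum_add_distrib, ← Finset.sum_add_distrib]
      refine Finset.sum_congr rfl fun i _ => ?_
      rw [networkLoss, EuclideanSpace.norm_sq_eq, ← Finset.mul_sum]
      simp only [Real.norm_eq_abs, sq_abs, hφ, hψ]
      ring
    rw [e1]
    exact add_le_add (add_le_add (le_ciSup (bddAbove_signSum hφ2b hs) t)
      (le_ciSup (bddAbove_signSum hφvb hs) t))
      (Finset.sum_le_sum fun j _ => le_ciSup (bddAbove_signSum (hψ2b j) hs) t)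
  have hφlin : signAvg N (fun e => ⨆ t, ∑ i, e i * φ t i) ≤
      (2 * B + 16 * B * (2 * 1 * (d + 1) + 3)) * Real.sqrt N :=
    signAvg_superposition_le hm hx (σ := softplus τ) zero_le_one (by norm_num) (by positivity)
      (by positivity) (abs_softplus_sub_le hτ0) (fun z hz => abs_softplus_le hτ hz)
      (fun t => ((θ t).1 : ℝ)) (fun t k => ((θ t).2.1 k : ℝ)) (fun t => (θ t).2.2)
      (fun t => (θ t).1.2) fun t k => ((θ t).2.1 k).2
  have hψlin : ∀ j, signAvg N (fun e => ⨆ t, ∑ i, e i * ψ j t i) ≤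
      (0 + 16 * B * (2 * τ * (d + 1) + 1)) * Real.sqrt N := fun j => by
    have := signAvg_superposition_le (T := T) (m := m) (C := 0) hm hx (σ := fun z => Real.sigmoid (τ * z))
      hτ0.le (by norm_num) (A := 16 * B) (K := 1) (by positivity) le_rfl
      (abs_sigmoid_mul_sub_le hτ0.le)
      (fun z _ => abs_sigmoid_le_one _) (fun _ => 0) (fun t k => ((θ t).2.1 k : ℝ) * ((θ t).2.2 k).1.1 j)
      (fun t => (θ t).2.2) (fun t => by simp) fun t k => abs_mul_weight_le (θ t) k j
    simpa only [hψ, networkGrad_apply, zero_add] using this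
  have c1 := signAvg_ciSup_contraction_mul (N := N) (b := fun t i => φ t i ^ 2) (a := φ)
    (K := max ((50 * B) ^ 2) (50 * B)) (L := 2 * (50 * B)) (by positivity)
    (fun t i => (hφ2b t i).trans (le_max_left _ _)) (fun t i => (hφb t i).trans (le_max_right _ _))
    fun t t' i => abs_sq_sub_sq_le (hφb t i) (hφb t' i)
  have c2 := signAvg_ciSup_contraction_mul (N := N) (b := fun t i => -2 * φ t i * v i) (a := φ)
    (K := max (2 * (50 * B) * Y) (50 * B)) (L := 2 * Y) (by positivity)
    (fun t i => (hφvb t i).trans (le_max_left _ _)) (fun t i => (hφb t i).trans (le_max_right _ _))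
    fun t t' i => by
      rw [show -2 * φ t i * v i - -2 * φ t' i * v i = (-2 * v i) * (φ t i - φ t' i) by ring,
        abs_mul, abs_mul, abs_neg, abs_two]
      have := hv i
      gcongr
  have c3 := fun j => signAvg_ciSup_contraction_mul (N := N) (b := fun t i => ψ j t i ^ 2)
    (a := ψ j) (K := max ((16 * B) ^ 2) (16 * B)) (L := 2 * (16 * B)) (by positivity)
    (fun t i => (hψ2b j t i).trans (le_max_left _ _))
    (fun t i => (hψb j t i).trans (le_max_right _ _))
    fun t t' i => abs_sq_sub_sq_le (hψb j t i) (hψb j t' i)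
  have hsum : ∑ j, signAvg N (fun e => ⨆ t, ∑ i, e i * ψ j t i ^ 2) ≤
      ∑ _j : Fin d, 2 * (16 * B) * ((0 + 16 * B * (2 * τ * (d + 1) + 1)) * Real.sqrt N) :=
    Finset.sum_le_sum fun j _ => (c3 j).trans (mul_le_mul_of_nonneg_left (hψlin j) (by positivity))
  rw [Finset.sum_const, Finset.card_univ, Fintype.card_fin, nsmul_eq_mul] at hsum
  have d1 := c1.trans (mul_le_mul_of_nonneg_left hφlin (by positivity))
  have d2 := c2.trans (mul_le_mul_of_nonneg_left hφlin (by positivity))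
  -- The value terms are of order `√N` and only the gradient terms of order `τ√N`; `τ ≥ 1` brings
  -- them to a common form.
  have hsq : Real.sqrt N ≤ τ * Real.sqrt N := le_mul_of_one_le_left (Real.sqrt_nonneg _) hτ
  have f1 : (2 * (50 * B) + 2 * Y) * ((2 * B + 16 * B * (2 * 1 * (d + 1) + 3)) * Real.sqrt N) ≤
      (100 * B + 2 * Y) * (2 * B + 16 * B * (2 * (d + 1) + 3)) * (τ * Real.sqrt N) := by
    calc _ = (100 * B + 2 * Y) * (2 * B + 16 * B * (2 * (d + 1) + 3)) * Real.sqrt N := by ring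
      _ ≤ _ := by gcongr
  have f2 : (d : ℝ) * (2 * (16 * B) * ((0 + 16 * B * (2 * τ * (d + 1) + 1)) * Real.sqrt N)) ≤
      d * (32 * B * (16 * B * (2 * (d + 1) + 1))) * (τ * Real.sqrt N) := by
    calc _ = d * (32 * B * (16 * B)) * ((2 * τ * (d + 1) + 1) * Real.sqrt N) := by ring
      _ ≤ d * (32 * B * (16 * B)) * ((2 * τ * (d + 1) + τ) * Real.sqrt N) := by gcongr
      _ = _ := by ring
  linarith [hsplit]

end Network

/-! ### Greedy approximation in a Hilbert space -/

/-- If every continuous functional is almost as large at some element of `G` as it is at `f`, then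
averages of `m` elements of `G` approximate `f` at the rate `1 / √m`. -/
theorem exists_norm_sum_sub_le {H : Type*} [NormedAddCommGroup H] [InnerProductSpace ℝ H]
    {G : Set H} {f : H} {η R : ℝ} (hη : 0 ≤ η) (hR : 0 ≤ R) (hG : ∀ g ∈ G, ‖g - f‖ ≤ R)
    (h : ∀ S : H, ∃ g ∈ G, inner ℝ S f ≤ inner ℝ S g + η * ‖S‖) (m : ℕ) :
    ∃ g : Fin m → H, (∀ k, g k ∈ G) ∧ ‖∑ k, (g k - f)‖ ≤ m * η + Real.sqrt m * R := by
  induction m with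
  | zero => exact ⟨Fin.elim0, fun k => k.elim0, by simp⟩
  | succ m ih =>
    obtain ⟨g, hgG, hg⟩ := ih
    set S := ∑ k, (g k - f) with hS
    -- The next element is tested against the accumulated error with reversed sign, so that adding
    -- it increases the squared norm by at most `2η‖S‖ + R²`.
    obtain ⟨g', hg'G, hg'⟩ := h (-S)
    refine ⟨Fin.snoc g g', fun k => ?_, ?_⟩
    · refine Fin.lastCases ?_ (fun j => ?_) k
      · simpa using hg'G
      · simpa using hgG j
    · rw [Fin.sum_univ_castSucc]
      simp only [Fin.snoc_castSucc, Fin.snoc_last]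
      rw [← hS]
      rw [inner_neg_left, inner_neg_left, norm_neg] at hg'
      have h1 : inner ℝ S (g' - f) ≤ η * ‖S‖ := by rw [inner_sub_right]; linarith
      have h2 := hG g' hg'G
      have hm : (0 : ℝ) ≤ m := Nat.cast_nonneg m
      have hs1 := Real.sq_sqrt hm
      have hs2 := Real.sq_sqrt (show (0 : ℝ) ≤ m + 1 by linarith)
      have hs3 : Real.sqrt m ≤ Real.sqrt (m + 1) := Real.sqrt_le_sqrt (by linarith)
      have hs0 := Real.sqrt_nonneg (m : ℝ)
      have hs4 := Real.sqrt_nonneg ((m : ℝ) + 1)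
      push_cast
      refine abs_le_of_sq_le_sq' ?_ (by positivity) |>.2
      rw [norm_add_sq_real]
      have e1 : ‖S‖ ^ 2 ≤ (m * η + Real.sqrt m * R) ^ 2 := by gcongr
      have e2 : η * ‖S‖ ≤ η * (m * η + Real.sqrt m * R) := by gcongr
      have e3 : ‖g' - f‖ ^ 2 ≤ R ^ 2 := by gcongr
      have e4 : Real.sqrt m * ((m + 1) * (η * R)) ≤ Real.sqrt (m + 1) * ((m + 1) * (η * R)) := by
        gcongr
      -- After expansion the claimed square exceeds the bound obtained by `η²` plus twice the gap in
      -- `e4`.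
      nlinarith [sq_nonneg η]

/-! ### Smoothing the integral form of Taylor's formula -/

lemma intervalIntegral_exp_decay_le {τ : ℝ} (hτ : 0 < τ) {a b : ℝ} :
    ∫ t in a..b, Real.exp (τ * (t - b)) ≤ 1 / τ := by
  have h : ∀ t ∈ Set.uIcc a b, HasDerivAt (fun t => Real.exp (τ * (t - b)) / τ)
      (Real.exp (τ * (t - b))) t := fun t _ => by
    have h1 : HasDerivAt (fun t : ℝ => τ * (t - b)) τ t := by
      simpa using ((hasDerivAt_id t).sub_const b).const_mul τ
    refine (h1.exp.div_const τ).congr_deriv ?_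
    field_simp
  rw [intervalIntegral.integral_eq_sub_of_hasDerivAt h
    (Continuous.intervalIntegrable (by fun_prop) _ _)]
  have : 0 ≤ Real.exp (τ * (a - b)) / τ := by positivity
  simp only [sub_self, mul_zero, Real.exp_zero]
  linarith

lemma intervalIntegral_exp_decay_le' {τ : ℝ} (hτ : 0 < τ) {a b : ℝ} :
    ∫ t in a..b, Real.exp (τ * (a - t)) ≤ 1 / τ := by
  have h : ∀ t ∈ Set.uIcc a b, HasDerivAt (fun t => -(Real.exp (τ * (a - t)) / τ))
      (Real.exp (τ * (a - t))) t := fun t _ => by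
    have h1 : HasDerivAt (fun t : ℝ => τ * (a - t)) (-τ) t := by
      simpa using ((hasDerivAt_id t).const_sub a).const_mul τ
    refine (h1.exp.div_const τ).neg.congr_deriv ?_
    field_simp
  rw [intervalIntegral.integral_eq_sub_of_hasDerivAt h
    (Continuous.intervalIntegrable (by fun_prop) _ _)]
  have : 0 ≤ Real.exp (τ * (a - b)) / τ := by positivity
  simp only [sub_self, mul_zero, Real.exp_zero]
  linarith

section Smoothing

variable {τ D : ℝ} {q k k₀ : ℝ → ℝ}

lemma abs_intervalIntegral_mul_le (hD : 0 ≤ D) {a b C : ℝ} (hab : a ≤ b) {f e : ℝ → ℝ}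
    (he : Continuous e) (hq : ∀ t, |q t| ≤ D)
    (hf : ∀ t ∈ Set.Ioc a b, |f t| ≤ e t) (hC : ∫ t in a..b, e t ≤ C) :
    |∫ t in a..b, q t * f t| ≤ D * C := by
  have := intervalIntegral.norm_integral_le_of_norm_le (f := fun t => q t * f t)
    (g := fun t => D * e t) (μ := volume) hab
    (Filter.Eventually.of_forall fun t ht => by
      rw [Real.norm_eq_abs, abs_mul]
      exact mul_le_mul (hq t) (hf t ht) (abs_nonneg _) hD)
    (Continuous.intervalIntegrable (by fun_prop) _ _)
  rw [Real.norm_eq_abs, intervalIntegral.integral_const_mul] at this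
  exact this.trans (mul_le_mul_of_nonneg_left hC hD)

/-- Convolution with `k` on `[0, 1]` is close to convolution with the cut-off kernel `k₀ 1_{≥ 0}`,
if `k` decays at `-∞` and approaches `k₀` at `+∞` exponentially. -/
lemma abs_convolution_sub_le (hτ : 0 < τ) (hk : Continuous k) (hk₀ : Continuous k₀)
    (hq : Continuous q) (hqD : ∀ t, |q t| ≤ D)
    (h1 : ∀ u, 0 ≤ u → |k u - k₀ u| ≤ Real.exp (-(τ * u)))
    (h2 : ∀ u, u ≤ 0 → |k u| ≤ Real.exp (τ * u)) {z : ℝ} (hz : 0 ≤ z) (hz1 : z ≤ 1) :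
    |(∫ t in (0 : ℝ)..1, q t * k (z - t)) - ∫ t in (0 : ℝ)..z, q t * k₀ (z - t)| ≤ 2 * D / τ := by
  have hD : 0 ≤ D := (abs_nonneg _).trans (hqD 0)
  have i1 : ∀ a b, IntervalIntegrable (fun t => q t * k (z - t)) volume a b := fun a b =>
    Continuous.intervalIntegrable (by fun_prop) _ _
  have i2 : ∀ a b, IntervalIntegrable (fun t => q t * k₀ (z - t)) volume a b := fun a b =>
    Continuous.intervalIntegrable (by fun_prop) _ _
  -- The interval is cut at the kink `t = z`. On each side the error decays exponentially away from
  -- `z`, so each side contributes `D/τ`.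
  rw [← intervalIntegral.integral_add_adjacent_intervals (i1 0 z) (i1 z 1), add_sub_right_comm,
    ← intervalIntegral.integral_sub (i1 0 z) (i2 0 z)]
  simp only [← mul_sub]
  have b1 := abs_intervalIntegral_mul_le (q := q) hD hz (f := fun t => k (z - t) - k₀ (z - t))
    (e := fun t => Real.exp (τ * (t - z))) (by fun_prop) hqD
    (fun t ht => by
      have := h1 (z - t) (by linarith [ht.2])
      rwa [← mul_neg, neg_sub] at this) (intervalIntegral_exp_decay_le hτ)
  have b2 := abs_intervalIntegral_mul_le (q := q) hD hz1 (f := fun t => k (z - t))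
    (e := fun t => Real.exp (τ * (z - t))) (by fun_prop) hqD
    (fun t ht => h2 (z - t) (by linarith [ht.1])) (intervalIntegral_exp_decay_le' hτ)
  refine (abs_add_le _ _).trans ((add_le_add b1 b2).trans_eq ?_)
  ring

/-- For `z ≤ 0` every kink in `[0, 1]` lies to the right of `z`, so the cut-off convolution vanishes
and only the exponential tail remains. This is applied to the ridge functions of the opposite
direction. -/
lemma abs_convolution_le (hτ : 0 < τ) (hqD : ∀ t, |q t| ≤ D)
    (h2 : ∀ u, u ≤ 0 → |k u| ≤ Real.exp (τ * u)) {z : ℝ} (hz : z ≤ 0) :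
    |∫ t in (0 : ℝ)..1, q t * k (z - t)| ≤ D / τ := by
  have hD : 0 ≤ D := (abs_nonneg _).trans (hqD 0)
  have b2 := abs_intervalIntegral_mul_le (q := q) hD zero_le_one (f := fun t => k (z - t))
    (e := fun t => Real.exp (τ * (0 - t))) (by fun_prop) hqD
    (fun t ht => (h2 (z - t) (by linarith [ht.1])).trans
      (Real.exp_le_exp.2 (mul_le_mul_of_nonneg_left (by linarith) hτ.le)))
    (intervalIntegral_exp_decay_le' hτ)
  refine b2.trans_eq ?_
  ring

end Smoothing

lemma softplus_le_exp {τ : ℝ} (hτ : 1 ≤ τ) (u : ℝ) : softplus τ u ≤ Real.exp (τ * u) := by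
  unfold softplus
  have h1 := Real.log_le_sub_one_of_pos (show 0 < 1 + Real.exp (τ * u) by positivity)
  rw [div_le_iff₀ (by linarith)]
  nlinarith [Real.exp_pos (τ * u)]

lemma softplus_nonneg {τ : ℝ} (hτ : 0 < τ) (u : ℝ) : 0 ≤ softplus τ u :=
  (le_max_right _ _).trans (max_le_softplus hτ u)

lemma sigmoid_le_exp (u : ℝ) : Real.sigmoid u ≤ Real.exp u := by
  rw [Real.sigmoid_def]
  refine inv_le_of_inv_le₀ (Real.exp_pos u) ?_
  rw [← Real.exp_neg]; linarith

section Taylor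

variable {τ D : ℝ} {h h' q : ℝ → ℝ}

lemma hasDerivAt_comp_neg' {f : ℝ → ℝ} {f' t : ℝ} (hf : HasDerivAt f f' (-t)) :
    HasDerivAt (fun t => f (-t)) (-f') t :=
  (hf.comp t (hasDerivAt_neg t)).congr_deriv (by ring)

/-- The function `h'(t)(z - t) + h(t)` is a primitive of the integrand. -/
lemma taylor_integral_zero (hh : ∀ t, HasDerivAt h (h' t) t) (hh' : ∀ t, HasDerivAt h' (q t) t)
    (hq : Continuous q) (z : ℝ) : ∫ t in (0 : ℝ)..z, q t * (z - t) = h z - h 0 - h' 0 * z := by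
  have hd : ∀ t ∈ Set.uIcc 0 z, HasDerivAt (fun t => h' t * (z - t) + h t) (q t * (z - t)) t :=
    fun t _ => by
      have h1 : HasDerivAt (fun t : ℝ => z - t) (-1) t := by simpa using (hasDerivAt_id t).const_sub z
      refine (((hh' t).mul h1).add (hh t)).congr_deriv ?_
      ring
  rw [intervalIntegral.integral_eq_sub_of_hasDerivAt hd
    (Continuous.intervalIntegrable (by fun_prop) _ _)]
  ring

/-- Smoothed Taylor formula for the value. -/
lemma abs_sub_smooth_taylor_le (hτ : 1 ≤ τ) (hh : ∀ t, HasDerivAt h (h' t) t)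
    (hh' : ∀ t, HasDerivAt h' (q t) t) (hq : Continuous q) (hqD : ∀ t, |q t| ≤ D) {z : ℝ}
    (hz : |z| ≤ 1) :
    |h z - h 0 - (h' 0 * z + ((∫ t in (0 : ℝ)..1, q t * softplus τ (z - t)) +
      ∫ t in (0 : ℝ)..1, q (-t) * softplus τ (-z - t)))| ≤ 3 * D / τ := by
  have hτ0 : 0 < τ := by linarith
  have k2 : ∀ u, u ≤ 0 → |softplus τ u| ≤ Real.exp (τ * u) := fun u _ => by
    rw [abs_of_nonneg (softplus_nonneg hτ0 u)]; exact softplus_le_exp hτ u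
  have k1 : ∀ u, 0 ≤ u → |softplus τ u - u| ≤ Real.exp (-(τ * u)) := fun u _ => by
    have := softplus_sub_softplus_neg hτ0 u
    rw [show softplus τ u - u = softplus τ (-u) by linarith, abs_of_nonneg (softplus_nonneg hτ0 _),
      ← mul_neg]
    exact softplus_le_exp hτ (-u)
  have pos : ∀ {h h' q : ℝ → ℝ}, (∀ t, HasDerivAt h (h' t) t) → (∀ t, HasDerivAt h' (q t) t) →
      Continuous q → (∀ t, |q t| ≤ D) → ∀ {z : ℝ}, 0 ≤ z → z ≤ 1 →
      |h z - h 0 - (h' 0 * z + ((∫ t in (0 : ℝ)..1, q t * softplus τ (z - t)) +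
      ∫ t in (0 : ℝ)..1, q (-t) * softplus τ (-z - t)))| ≤ 3 * D / τ := by
    intro h h' q hh hh' hq hqD z hz hz1
    have b1 := abs_convolution_sub_le hτ0 (continuous_softplus τ) (k₀ := fun u => u) continuous_id
      hq hqD k1 k2 hz hz1
    have b2 := abs_convolution_le (q := fun t => q (-t)) hτ0 (fun t => hqD (-t)) k2
      (z := -z) (by linarith)
    rw [taylor_integral_zero hh hh' hq] at b1
    rw [abs_le] at b1 b2 ⊢
    have : 3 * D / τ = 2 * D / τ + D / τ := by ring
    constructor <;> linarith
  rcases le_total 0 z with h0 | h0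
  · exact pos hh hh' hq hqD h0 (abs_le.1 hz).2
  -- Reflecting `t` to `-t` reduces to `z ≥ 0` and interchanges the two integrals.
  · have := pos (h := fun t => h (-t)) (h' := fun t => -h' (-t)) (q := fun t => q (-t)) (z := -z)
      (fun t => hasDerivAt_comp_neg' (hh (-t)))
      (fun t => (hasDerivAt_comp_neg' (hh' (-t))).neg.congr_deriv (neg_neg _))
      (by fun_prop) (fun t => hqD (-t)) (by linarith) (by linarith [(abs_le.1 hz).1])
    simp only [neg_neg, neg_zero, neg_mul_neg] at this
    rwa [add_comm (∫ t in (0 : ℝ)..1, q (-t) * softplus τ (-z - t))] at this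

/-- Smoothed Taylor formula for the derivative. -/
lemma abs_deriv_sub_smooth_taylor_le (hτ : 0 < τ)
    (hh' : ∀ t, HasDerivAt h' (q t) t) (hq : Continuous q) (hqD : ∀ t, |q t| ≤ D) {z : ℝ}
    (hz : |z| ≤ 1) :
    |h' z - (h' 0 + ((∫ t in (0 : ℝ)..1, q t * Real.sigmoid (τ * (z - t))) -
      ∫ t in (0 : ℝ)..1, q (-t) * Real.sigmoid (τ * (-z - t))))| ≤ 3 * D / τ := by
  have k2 : ∀ u, u ≤ 0 → |Real.sigmoid (τ * u)| ≤ Real.exp (τ * u) := fun u _ => by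
    rw [abs_of_nonneg (Real.sigmoid_nonneg _)]; exact sigmoid_le_exp _
  have k1 : ∀ u, 0 ≤ u → |Real.sigmoid (τ * u) - 1| ≤ Real.exp (-(τ * u)) := fun u _ => by
    rw [abs_sub_comm, ← Real.sigmoid_neg, abs_of_nonneg (Real.sigmoid_nonneg _)]
    exact sigmoid_le_exp _
  have pos : ∀ {h' q : ℝ → ℝ}, (∀ t, HasDerivAt h' (q t) t) →
      Continuous q → (∀ t, |q t| ≤ D) → ∀ {z : ℝ}, 0 ≤ z → z ≤ 1 →
      |h' z - (h' 0 + ((∫ t in (0 : ℝ)..1, q t * Real.sigmoid (τ * (z - t))) -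
      ∫ t in (0 : ℝ)..1, q (-t) * Real.sigmoid (τ * (-z - t))))| ≤ 3 * D / τ := by
    intro h' q hh' hq hqD z hz hz1
    have b1 := abs_convolution_sub_le (k := fun u => Real.sigmoid (τ * u)) hτ
      (by have := continuous_sigmoid; fun_prop) (k₀ := fun u => 1)
      continuous_const hq hqD k1 k2 hz hz1
    have b2 := abs_convolution_le (k := fun u => Real.sigmoid (τ * u)) (q := fun t => q (-t)) hτ
      (fun t => hqD (-t)) k2 (z := -z) (by linarith)
    simp only [mul_one] at b1
    rw [intervalIntegral.integral_eq_sub_of_hasDerivAt (fun t _ => hh' t)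
      (hq.intervalIntegrable _ _)] at b1
    rw [abs_le] at b1 b2 ⊢
    have : 3 * D / τ = 2 * D / τ + D / τ := by ring
    constructor <;> linarith
  rcases le_total 0 z with h0 | h0
  · exact pos hh' hq hqD h0 (abs_le.1 hz).2
  · have := pos (h' := fun t => -h' (-t)) (q := fun t => q (-t)) (z := -z)
      (fun t => (hasDerivAt_comp_neg' (hh' (-t))).neg.congr_deriv (neg_neg _))
      (by fun_prop) (fun t => hqD (-t)) (by linarith) (by linarith [(abs_le.1 hz).1])
    simp only [neg_neg, neg_zero] at this
    rw [← abs_neg]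
    convert this using 2
    ring

end Taylor

/-! ### Barron functions -/

section Barron

variable {d : ℕ}

/-- The extension to the whole space of a function with Fourier representation `F`. -/
noncomputable def barronExt (F : Eucl d → ℂ) (x : Eucl d) : ℝ :=
  ∫ w, (Complex.exp (Complex.I * ((inner ℝ w x : ℝ) : ℂ)) * F w).re

/-- The gradient of `barronExt F`. -/
noncomputable def barronGrad (F : Eucl d → ℂ) (x : Eucl d) : Eucl d :=
  ∫ w, (Complex.I * Complex.exp (Complex.I * ((inner ℝ w x : ℝ) : ℂ)) * F w).re • w

lemma norm_exp_I_mul_ofReal (t : ℝ) : ‖Complex.exp (Complex.I * (t : ℂ))‖ = 1 := by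
  rw [mul_comm]; exact Complex.norm_exp_ofReal_mul_I t

lemma abs_re_exp_mul_le (t : ℝ) (z : ℂ) : |(Complex.exp (Complex.I * (t : ℂ)) * z).re| ≤ ‖z‖ := by
  refine (Complex.abs_re_le_norm _).trans ?_
  rw [norm_mul, norm_exp_I_mul_ofReal, one_mul]

lemma abs_re_I_exp_mul_le (t : ℝ) (z : ℂ) :
    |(Complex.I * Complex.exp (Complex.I * (t : ℂ)) * z).re| ≤ ‖z‖ := by
  refine (Complex.abs_re_le_norm _).trans ?_
  rw [norm_mul, norm_mul, norm_exp_I_mul_ofReal, Complex.norm_I, one_mul, one_mul]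

lemma norm_le_weight (F : Eucl d → ℂ) (w : Eucl d) : ‖F w‖ ≤ (1 + l1norm w) ^ 2 * ‖F w‖ := by
  refine le_mul_of_one_le_left (norm_nonneg _) ?_
  have := l1norm_nonneg w
  nlinarith

lemma norm_mul_norm_le_weight (F : Eucl d → ℂ) (w : Eucl d) :
    ‖F w‖ * ‖w‖ ≤ (1 + l1norm w) ^ 2 * ‖F w‖ := by
  rw [mul_comm]
  refine mul_le_mul_of_nonneg_right ?_ (norm_nonneg _)
  have := l1norm_nonneg w
  have := norm_le_l1norm w
  nlinarith

lemma norm_re_smul_le (F : Eucl d → ℂ) (x w : Eucl d) :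
    ‖(Complex.I * Complex.exp (Complex.I * ((inner ℝ w x : ℝ) : ℂ)) * F w).re • w‖ ≤
      (1 + l1norm w) ^ 2 * ‖F w‖ := by
  rw [norm_smul, Real.norm_eq_abs]
  refine le_trans ?_ (norm_mul_norm_le_weight F w)
  gcongr
  exact abs_re_I_exp_mul_le _ _

variable {F : Eucl d → ℂ} (hF : AEStronglyMeasurable F volume)
  (hI : Integrable (fun w => (1 + l1norm w) ^ 2 * ‖F w‖) volume)

include hF in
lemma aestronglyMeasurable_barron_integrand (x : Eucl d) : AEStronglyMeasurable
    (fun w => (Complex.exp (Complex.I * ((inner ℝ w x : ℝ) : ℂ)) * F w).re) volume :=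
  Complex.continuous_re.comp_aestronglyMeasurable
    ((Continuous.aestronglyMeasurable (by fun_prop)).mul hF)

include hF in
lemma aestronglyMeasurable_barronGrad_coeff (x : Eucl d) : AEStronglyMeasurable
    (fun w => (Complex.I * Complex.exp (Complex.I * ((inner ℝ w x : ℝ) : ℂ)) * F w).re)
      volume :=
  Complex.continuous_re.comp_aestronglyMeasurable
    ((Continuous.aestronglyMeasurable (by fun_prop)).mul hF)

include hF hI in
lemma integrable_barron_integrand (x : Eucl d) : Integrable
    (fun w => (Complex.exp (Complex.I * ((inner ℝ w x : ℝ) : ℂ)) * F w).re) volume :=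
  hI.mono' (aestronglyMeasurable_barron_integrand hF x) (Filter.Eventually.of_forall fun w =>
    (abs_re_exp_mul_le _ _).trans (norm_le_weight F w))

include hF hI in
lemma integrable_barronGrad_integrand (x : Eucl d) : Integrable
    (fun w => (Complex.I * Complex.exp (Complex.I * ((inner ℝ w x : ℝ) : ℂ)) * F w).re • w)
      volume :=
  hI.mono' ((aestronglyMeasurable_barronGrad_coeff hF x).smul continuous_id.aestronglyMeasurable)
    (Filter.Eventually.of_forall fun w => norm_re_smul_le F x w)

-- Differentiation under the integral sign; the weighted integrand dominates `|w||F w|`. The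
-- gradient is classical on the whole space, which later makes it a weak gradient on any open `Ω`.
include hF hI in
lemma hasGradientAt_barronExt (x : Eucl d) :
    HasGradientAt (barronExt F) (barronGrad F x) x := by
  rw [hasGradientAt_iff_hasFDerivAt]
  have hcoeff : ∀ (x w : Eucl d), HasFDerivAt
      (fun x => (Complex.exp (Complex.I * ((inner ℝ w x : ℝ) : ℂ)) * F w).re)
      ((Complex.I * Complex.exp (Complex.I * ((inner ℝ w x : ℝ) : ℂ)) * F w).re • innerSL ℝ w) x := by
    intro x w
    have h1 : HasFDerivAt (fun x : Eucl d => ((inner ℝ w x : ℝ) : ℂ))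
        (Complex.ofRealCLM.comp (innerSL ℝ w)) x :=
      (Complex.ofRealCLM.comp (innerSL ℝ w)).hasFDerivAt
    have h2 := ((h1.const_mul Complex.I).cexp.mul_const (F w))
    refine (Complex.reCLM.hasFDerivAt.comp x h2).congr_fderiv ?_
    ext v
    simp only [ContinuousLinearMap.comp_apply, smul_apply, smul_eq_mul,
      Complex.reCLM_apply, Complex.ofRealCLM_apply, innerSL_apply_apply]
    rw [← Complex.re_mul_ofReal]
    congr 1
    ring
  have key := hasFDerivAt_integral_of_dominated_of_fderiv_le (μ := (volume : Measure (Eucl d)))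
    (F := fun x w => (Complex.exp (Complex.I * ((inner ℝ w x : ℝ) : ℂ)) * F w).re)
    (F' := fun x w =>
      (Complex.I * Complex.exp (Complex.I * ((inner ℝ w x : ℝ) : ℂ)) * F w).re • innerSL ℝ w)
    (x₀ := x) (s := Set.univ) (bound := fun w => (1 + l1norm w) ^ 2 * ‖F w‖) Filter.univ_mem
    (Filter.Eventually.of_forall fun x => aestronglyMeasurable_barron_integrand hF x)
    (integrable_barron_integrand hF hI x)
    ((aestronglyMeasurable_barronGrad_coeff hF x).smul
      (innerSL ℝ : Eucl d →L⋆[ℝ] _).continuous.aestronglyMeasurable)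
    (Filter.Eventually.of_forall fun w x _ => by
      rw [norm_smul, innerSL_apply_norm, ← norm_smul]
      exact norm_re_smul_le F x w)
    hI (Filter.Eventually.of_forall fun w x _ => hcoeff x w)
  refine key.congr_fderiv ?_
  have := (InnerProductSpace.toDual ℝ (Eucl d)).toContinuousLinearEquiv.toContinuousLinearMap.integral_comp_comm
    (integrable_barronGrad_integrand hF hI x)
  rw [barronGrad]
  refine Eq.trans ?_ this
  refine integral_congr_ae (Filter.Eventually.of_forall fun w => ?_)
  ext v
  simp

include hF hI in
lemma continuous_barronGrad : Continuous (barronGrad F) := by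
  refine continuous_of_dominated (bound := fun w => (1 + l1norm w) ^ 2 * ‖F w‖) (fun x => ?_)
    (fun x => Filter.Eventually.of_forall fun w => norm_re_smul_le F x w) hI
    (Filter.Eventually.of_forall fun w => by fun_prop)
  exact (aestronglyMeasurable_barronGrad_coeff hF x).smul continuous_id.aestronglyMeasurable

include hF hI in
lemma continuous_barronExt : Continuous (barronExt F) :=
  continuous_iff_continuousAt.2 fun x =>
    (hasGradientAt_barronExt hF hI x).hasFDerivAt.continuousAt

include hI in
lemma abs_barronExt_le (x : Eucl d) : |barronExt F x| ≤ ∫ w, (1 + l1norm w) ^ 2 * ‖F w‖ := by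
  rw [← Real.norm_eq_abs]
  exact norm_integral_le_of_norm_le hI (Filter.Eventually.of_forall fun w =>
    (abs_re_exp_mul_le _ _).trans (norm_le_weight F w))

include hI in
lemma norm_barronGrad_le (x : Eucl d) : ‖barronGrad F x‖ ≤ ∫ w, (1 + l1norm w) ^ 2 * ‖F w‖ :=
  norm_integral_le_of_norm_le hI (Filter.Eventually.of_forall fun w => norm_re_smul_le F x w)

end Barron

/-- The left side is real, so real parts may be taken in the representation. It exchanges a function
known only on `Ω` for a globally `C¹` one. -/
lemma IsBarronRep.eq_barronExt {d : ℕ} {Ω : Set (Eucl d)} {f : Eucl d → ℝ} {F : Eucl d → ℂ}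
    (h : IsBarronRep 2 Ω f F) {x : Eucl d} (hx : x ∈ Ω) : f x = barronExt F x := by
  obtain ⟨hF, hI, hf⟩ := h
  have hint : Integrable (fun w => Complex.exp (Complex.I * ((inner ℝ w x : ℝ) : ℂ)) * F w)
      volume :=
    hI.mono' ((Continuous.aestronglyMeasurable (by fun_prop)).mul hF)
      (Filter.Eventually.of_forall fun w => by
        rw [norm_mul, norm_exp_I_mul_ofReal, one_mul]; exact norm_le_weight F w)
  have := congrArg Complex.re (hf x hx)
  rw [Complex.ofReal_re] at this
  rw [this]
  exact (Complex.reCLM.integral_comp_comm hint).symm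

/-! ### Jets -/

section Jet

variable {d : ℕ}

/-- The space of pairs (value, gradient). -/
abbrev Jet (d : ℕ) : Type := WithLp 2 (ℝ × Eucl d)

/-- The pair of a value and a gradient. -/
def mkJet (a : ℝ) (v : Eucl d) : Jet d := WithLp.toLp 2 (a, v)

lemma inner_mkJet (S : Jet d) (a : ℝ) (v : Eucl d) :
    inner ℝ S (mkJet a v) = S.fst * a + inner ℝ S.snd v := by
  rw [WithLp.prod_inner_apply]
  simp [mkJet, mul_comm]

lemma norm_mkJet_sq (a : ℝ) (v : Eucl d) : ‖mkJet a v‖ ^ 2 = a ^ 2 + ‖v‖ ^ 2 := by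
  rw [WithLp.prod_norm_sq_eq_of_L2]
  simp [mkJet]

lemma norm_mkJet_le (a : ℝ) (v : Eucl d) : ‖mkJet a v‖ ≤ |a| + ‖v‖ := by
  refine (sq_le_sq₀ (norm_nonneg _) (by positivity)).1 ?_
  rw [norm_mkJet_sq, ← sq_abs a]
  nlinarith [abs_nonneg a, norm_nonneg v]

lemma abs_fst_le_norm (S : Jet d) : |S.fst| ≤ ‖S‖ := by
  simpa using WithLp.norm_fst_le ℝ S

lemma norm_snd_le_norm (S : Jet d) : ‖S.snd‖ ≤ ‖S‖ := by
  exact WithLp.norm_snd_le ℝ S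

lemma mkJet_add (a b : ℝ) (v w : Eucl d) : mkJet a v + mkJet b w = mkJet (a + b) (v + w) := rfl

lemma mkJet_sub (a b : ℝ) (v w : Eucl d) : mkJet a v - mkJet b w = mkJet (a - b) (v - w) := rfl

lemma smul_mkJet (c a : ℝ) (v : Eucl d) : c • mkJet a v = mkJet (c * a) (c • v) := rfl

/-- `mkJet` as a continuous linear map. -/
noncomputable def mkJetL (d : ℕ) : (ℝ × Eucl d) →L[ℝ] Jet d :=
  (WithLp.prodContinuousLinearEquiv 2 ℝ ℝ (Eucl d)).symm.toContinuousLinearMap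

lemma continuous_mkJet : Continuous fun p : ℝ × Eucl d => mkJet p.1 p.2 := (mkJetL d).continuous

/-- The value and the gradient of the softplus ridge function `SP_τ (w · x + b)`. -/
noncomputable def ridgeJet (τ : ℝ) (w : Eucl d) (b : ℝ) (x : Eucl d) : Jet d :=
  mkJet (softplus τ (inner ℝ w x + b)) (Real.sigmoid (τ * (inner ℝ w x + b)) • w)

lemma continuous_ridgeJet (τ : ℝ) (w : Eucl d) :
    Continuous fun q : ℝ × Eucl d => ridgeJet τ w q.1 q.2 := by
  have h2 := continuous_softplus τ
  have h3 := continuous_sigmoid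
  exact continuous_mkJet.comp (f := fun q : ℝ × Eucl d =>
    (softplus τ (inner ℝ w q.2 + q.1), Real.sigmoid (τ * (inner ℝ w q.2 + q.1)) • w))
    (by fun_prop)

lemma norm_ridgeJet_le {τ : ℝ} (hτ : 1 ≤ τ) {w : Eucl d} (hw : l1norm w = 1) {b : ℝ}
    (hb : |b| ≤ 1) {x : Eucl d} (hx : ∀ j, |x j| ≤ 1) : ‖ridgeJet τ w b x‖ ≤ 4 := by
  refine (norm_mkJet_le _ _).trans ?_
  have h1 := abs_softplus_le hτ (abs_preact_le ⟨(w, b), hw, hb⟩ hx)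
  have h2 := (norm_le_l1norm w).trans_eq hw
  have h3 := abs_sigmoid_le_one (τ * (inner ℝ w x + b))
  rw [norm_smul, Real.norm_eq_abs]
  have := mul_le_mul h3 h2 (norm_nonneg _) zero_le_one
  simp only [preact] at h1
  linarith

end Jet

/-! ### Testing a Barron function against jets of neurons -/

section Duality

variable {d : ℕ}

lemma integrable_inner_of_bound {α E : Type*} [MeasurableSpace α] {μ : Measure α}
    [NormedAddCommGroup E] [InnerProductSpace ℝ E] {S J : α → E} {C : ℝ} (hS : Integrable S μ)
    (hJ : AEStronglyMeasurable J μ) (hC : ∀ᵐ x ∂μ, ‖J x‖ ≤ C) :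
    Integrable (fun x => inner ℝ (S x) (J x)) μ := by
  refine (hS.norm.mul_const C).mono' (hS.1.inner hJ) ?_
  filter_upwards [hC] with x hx
  exact (norm_inner_le_norm _ _).trans (mul_le_mul_of_nonneg_left hx (norm_nonneg _))

/-- The jet of the Fourier mode `Re ((exp (i w · x) - 1) z)`. -/
noncomputable def modeJet (z : ℂ) (w x : Eucl d) : Jet d :=
  mkJet ((Complex.exp (Complex.I * ((inner ℝ w x : ℝ) : ℂ)) * z).re - z.re)
    ((Complex.I * Complex.exp (Complex.I * ((inner ℝ w x : ℝ) : ℂ)) * z).re • w)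

lemma norm_modeJet_le (z : ℂ) (w x : Eucl d) :
    ‖modeJet z w x‖ ≤ 3 * ((1 + l1norm w) ^ 2 * ‖z‖) := by
  refine (norm_mkJet_le _ _).trans ?_
  have h1 := abs_re_exp_mul_le (inner ℝ w x) z
  have h2 := Complex.abs_re_le_norm z
  have h3 := (abs_sub (Complex.exp (Complex.I * ((inner ℝ w x : ℝ) : ℂ)) * z).re z.re).trans
    (add_le_add h1 h2)
  have h4 := norm_re_smul_le (fun _ => z) x w
  have h5 := norm_le_weight (fun _ => z) w
  linarith

/-- The function `Re (exp (i r t) z)`. -/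
noncomputable def mode (r : ℝ) (z : ℂ) (t : ℝ) : ℝ := (Complex.exp (Complex.I * ((r * t : ℝ) : ℂ)) * z).re

lemma hasDerivAt_mode (r : ℝ) (z : ℂ) (t : ℝ) :
    HasDerivAt (mode r z) (mode r (Complex.I * r * z) t) t := by
  have h1 : HasDerivAt (fun t : ℝ => ((r * t : ℝ) : ℂ)) (r : ℂ) t := by
    simpa using ((hasDerivAt_id t).const_mul r).ofReal_comp
  have h2 := ((h1.const_mul Complex.I).cexp.mul_const z)
  refine ((Complex.reCLM.hasFDerivAt.comp_hasDerivAt t h2)).congr_deriv ?_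
  simp only [Complex.reCLM_apply, mode]
  congr 1
  ring

lemma abs_mode_le (r : ℝ) (z : ℂ) (t : ℝ) : |mode r z t| ≤ ‖z‖ := abs_re_exp_mul_le _ _

lemma continuous_mode (r : ℝ) (z : ℂ) : Continuous (mode r z) := by
  unfold mode; fun_prop

variable {ρ : Measure (Eucl d)} [IsProbabilityMeasure ρ] {τ P : ℝ} {S : Eucl d → Jet d}

/-- The pairing of `S` with a neuron is jointly integrable in the point and the bias. -/
lemma integrable_ridge_pairing (hcube : ∀ᵐ x ∂ρ, ∀ j, |x j| ≤ 1) (hS : Integrable S ρ) (hτ : 1 ≤ τ)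
    {e : Eucl d} (he : l1norm e = 1) {q : ℝ → ℝ} (hq : Continuous q) {D : ℝ} (hqD : ∀ t, |q t| ≤ D) :
    Integrable (Function.uncurry fun (t : ℝ) (x : Eucl d) => q t * inner ℝ (S x) (ridgeJet τ e (-t) x))
      ((volume.restrict (Set.uIoc (0 : ℝ) 1)).prod ρ) := by
  have hD : 0 ≤ D := (abs_nonneg _).trans (hqD 0)
  have : IsFiniteMeasure (volume.restrict (Set.uIoc (0 : ℝ) 1)) := by
    rw [Set.uIoc_of_le zero_le_one]; infer_instance
  have hS' : Integrable (fun p : ℝ × Eucl d => S p.2) ((volume.restrict (Set.uIoc (0 : ℝ) 1)).prod ρ) :=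
    hS.comp_snd _
  have h1 : Integrable (fun p : ℝ × Eucl d => inner ℝ (S p.2) (q p.1 • ridgeJet τ e (-p.1) p.2))
      ((volume.restrict (Set.uIoc (0 : ℝ) 1)).prod ρ) := by
    refine integrable_inner_of_bound (C := D * 4) hS' ?_ ?_
    · refine Continuous.aestronglyMeasurable ?_
      have := (continuous_ridgeJet τ e).comp (f := fun p : ℝ × Eucl d => (-p.1, p.2)) (by fun_prop)
      exact (hq.comp continuous_fst).smul this
    · have a1 := Measure.quasiMeasurePreserving_snd (μ := volume.restrict (Set.uIoc (0 : ℝ) 1))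
        (ν := ρ) |>.ae hcube
      have a2 := Measure.quasiMeasurePreserving_fst (μ := volume.restrict (Set.uIoc (0 : ℝ) 1))
        (ν := ρ) |>.ae (ae_restrict_mem measurableSet_uIoc)
      filter_upwards [a1, a2] with p h1 h2
      rw [Set.uIoc_of_le zero_le_one] at h2
      rw [norm_smul]
      exact mul_le_mul (hqD _) (norm_ridgeJet_le hτ he (by
        rw [abs_neg, abs_of_pos h2.1]; exact h2.2) h1) (norm_nonneg _) hD
  refine h1.congr (Filter.Eventually.of_forall fun p => ?_)
  simp only [Function.uncurry, inner_smul_right]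

/-- A functional which is at most `P` on all neurons is controlled on every Fourier mode. -/
lemma integral_inner_modeJet_le (hcube : ∀ᵐ x ∂ρ, ∀ j, |x j| ≤ 1) (hS : Integrable S ρ)
    (hτ : 1 ≤ τ) (hP0 : 0 ≤ P)
    (hP : ∀ w b, l1norm w = 1 → |b| ≤ 1 → |∫ x, inner ℝ (S x) (ridgeJet τ w b x) ∂ρ| ≤ P)
    (z : ℂ) (w : Eucl d) :
    ∫ x, inner ℝ (S x) (modeJet z w x) ∂ρ ≤
      (2 * P + 6 / τ * ∫ x, ‖S x‖ ∂ρ) * ((1 + l1norm w) ^ 2 * ‖z‖) := by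
  have hτ0 : 0 < τ := by linarith
  have hSn : 0 ≤ ∫ x, ‖S x‖ ∂ρ := integral_nonneg fun _ => norm_nonneg _
  -- The zero frequency has no direction to normalize, but its jet vanishes because the value at the
  -- origin is subtracted.
  rcases (l1norm_nonneg w).eq_or_lt with hr | hr
  · have hw : w = 0 := by
      rw [← norm_le_zero_iff]; exact (norm_le_l1norm w).trans hr.symm.le
    subst hw
    have : ∀ x : Eucl d, modeJet z 0 x = 0 := fun x => by
      simp [modeJet, mkJet]
    simp only [this, inner_zero_right, integral_zero]
    positivity
  set r := l1norm w with hr_def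
  set e : Eucl d := r⁻¹ • w with he_def
  have he : l1norm e = 1 := by
    rw [he_def, l1norm_smul, abs_of_pos (by positivity), ← hr_def]; field_simp
  have hen : l1norm (-e) = 1 := by
    rw [← neg_one_smul ℝ, l1norm_smul, he]; simp
  have hwe : w = r • e := by rw [he_def, smul_smul, mul_inv_cancel₀ hr.ne', one_smul]
  -- Along `e = w / |w|₁` the mode is a function of one variable with second derivative `q`, bounded
  -- by `r²‖z‖`. Differentiating a mode multiplies its amplitude by `i r`.
  set q : ℝ → ℝ := mode r (Complex.I * r * (Complex.I * r * z)) with hq_def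
  set h' : ℝ → ℝ := mode r (Complex.I * r * z) with hh'_def
  set D : ℝ := r ^ 2 * ‖z‖ with hD_def
  have hD : 0 ≤ D := by positivity
  have hqc : Continuous q := continuous_mode _ _
  have hqD : ∀ t, |q t| ≤ D := fun t => (abs_mode_le _ _ _).trans_eq (by
    simp only [norm_mul, Complex.norm_I, Complex.norm_real, Real.norm_eq_abs, abs_of_pos hr]
    rw [hD_def]; ring)
  have hqD' : ∀ t, |q (-t)| ≤ D := fun t => hqD _
  have hh'0 : |h' 0| ≤ r * ‖z‖ := (abs_mode_le _ _ _).trans_eq (by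
    simp only [norm_mul, Complex.norm_I, Complex.norm_real, Real.norm_eq_abs, abs_of_pos hr]
    ring)
  set g : Eucl d → ℝ → Eucl d → ℝ := fun v t x => inner ℝ (S x) (ridgeJet τ v (-t) x) with hg_def
  -- the pointwise smoothed Taylor formula
  have hpt : ∀ x : Eucl d, (∀ j, |x j| ≤ 1) → inner ℝ (S x) (modeJet z w x) ≤
      h' 0 * (g e 0 x - g (-e) 0 x) + (∫ t in (0 : ℝ)..1, q t * g e t x) +
        (∫ t in (0 : ℝ)..1, q (-t) * g (-e) t x) + ‖S x‖ * (6 * D / τ) := by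
    intro x hx
    set ζ := inner ℝ e x with hζ
    have hζ1 : |ζ| ≤ 1 := by
      have := abs_inner_le_l1norm e hx; rwa [he, one_mul] at this
    set s₀ := (S x).fst
    set s₁ : ℝ := inner ℝ (S x).snd e with hs₁
    have hs₀ : |s₀| ≤ ‖S x‖ := abs_fst_le_norm _
    have hs₁' : |s₁| ≤ ‖S x‖ := by
      refine (abs_real_inner_le_norm _ _).trans ?_
      have h1 := norm_snd_le_norm (S x)
      have h2 := (norm_le_l1norm e).trans_eq he
      calc _ ≤ ‖S x‖ * 1 := mul_le_mul h1 h2 (norm_nonneg _) (norm_nonneg _)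
        _ = _ := mul_one _
    have ge : ∀ t, g e t x = s₀ * softplus τ (ζ - t) + s₁ * Real.sigmoid (τ * (ζ - t)) := fun t => by
      simp only [hg_def, ridgeJet, inner_mkJet, inner_smul_right, ← sub_eq_add_neg]
      rw [mul_comm s₁]
    have gne : ∀ t, g (-e) t x =
        s₀ * softplus τ (-ζ - t) - s₁ * Real.sigmoid (τ * (-ζ - t)) := fun t => by
      simp only [hg_def, ridgeJet, inner_mkJet, inner_smul_right, ← sub_eq_add_neg, inner_neg_left,
        inner_neg_right, s₀, hs₁, hζ]
      ring
    have m1 : inner ℝ (S x) (modeJet z w x) = s₀ * (mode r z ζ - mode r z 0) + s₁ * h' ζ := by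
      rw [modeJet, inner_mkJet]
      have e1 : inner ℝ w x = r * ζ := by rw [hwe, real_inner_smul_left]
      congr 1
      · rw [e1]; simp only [mode, mul_zero, Complex.ofReal_zero, Complex.exp_zero, one_mul]; rfl
      · rw [e1, inner_smul_right, hwe, inner_smul_right, hh'_def, mode]
        rw [show Complex.exp (Complex.I * ((r * ζ : ℝ) : ℂ)) * (Complex.I * r * z) =
          (r : ℂ) * (Complex.I * Complex.exp (Complex.I * ((r * ζ : ℝ) : ℂ)) * z) by ring,
          Complex.re_ofReal_mul]
        ring
    have t1 := abs_sub_smooth_taylor_le hτ (hasDerivAt_mode r z)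
      (hasDerivAt_mode r (Complex.I * r * z)) hqc hqD hζ1
    have t2 := abs_deriv_sub_smooth_taylor_le hτ0 (hasDerivAt_mode r (Complex.I * r * z))
      hqc hqD hζ1
    have ci : ∀ (f k : ℝ → ℝ) (c : ℝ), Continuous f → Continuous k →
        IntervalIntegrable (fun t => c * (f t * k t)) volume 0 1 := fun f k c hf hk =>
      Continuous.intervalIntegrable (by fun_prop) _ _
    have csp := continuous_softplus τ
    have csg := continuous_sigmoid
    have i1 : ∫ t in (0 : ℝ)..1, q t * g e t x =
        s₀ * (∫ t in (0 : ℝ)..1, q t * softplus τ (ζ - t)) +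
          s₁ * ∫ t in (0 : ℝ)..1, q t * Real.sigmoid (τ * (ζ - t)) := by
      rw [← intervalIntegral.integral_const_mul, ← intervalIntegral.integral_const_mul,
        ← intervalIntegral.integral_add (ci _ _ _ hqc (by fun_prop)) (ci _ _ _ hqc (by fun_prop))]
      refine intervalIntegral.integral_congr fun t _ => ?_
      simp only [ge]; ring
    have i2 : ∫ t in (0 : ℝ)..1, q (-t) * g (-e) t x =
        s₀ * (∫ t in (0 : ℝ)..1, q (-t) * softplus τ (-ζ - t)) -
          s₁ * ∫ t in (0 : ℝ)..1, q (-t) * Real.sigmoid (τ * (-ζ - t)) := by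
      rw [← intervalIntegral.integral_const_mul, ← intervalIntegral.integral_const_mul,
        ← intervalIntegral.integral_sub (ci (fun t => q (-t)) _ _ (by fun_prop) (by fun_prop))
          (ci (fun t => q (-t)) _ _ (by fun_prop) (by fun_prop))]
      refine intervalIntegral.integral_congr fun t _ => ?_
      simp only [gne]; ring
    -- Opposite neurons of zero bias give the linear function exactly, and their gradients add up to
    -- `e` because the two sigmoids sum to one.
    have i3 : g e 0 x - g (-e) 0 x = s₀ * ζ + s₁ := by
      rw [ge, gne]
      have k1 := softplus_sub_softplus_neg hτ0 ζ
      have k2 := Real.sigmoid_neg (τ * ζ)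
      simp only [sub_zero, mul_neg, k2]
      linear_combination s₀ * k1
    rw [m1, i1, i2, i3]
    set A1 := ∫ t in (0 : ℝ)..1, q t * softplus τ (ζ - t)
    set A2 := ∫ t in (0 : ℝ)..1, q (-t) * softplus τ (-ζ - t)
    set B1 := ∫ t in (0 : ℝ)..1, q t * Real.sigmoid (τ * (ζ - t))
    set B2 := ∫ t in (0 : ℝ)..1, q (-t) * Real.sigmoid (τ * (-ζ - t))
    have u1 : s₀ * (mode r z ζ - mode r z 0 - (h' 0 * ζ + (A1 + A2))) ≤ ‖S x‖ * (3 * D / τ) := by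
      refine (le_abs_self _).trans ?_
      rw [abs_mul]
      exact mul_le_mul hs₀ t1 (abs_nonneg _) (norm_nonneg _)
    have u2 : s₁ * (h' ζ - (h' 0 + (B1 - B2))) ≤ ‖S x‖ * (3 * D / τ) := by
      refine (le_abs_self _).trans ?_
      rw [abs_mul]
      exact mul_le_mul hs₁' t2 (abs_nonneg _) (norm_nonneg _)
    have u3 : ‖S x‖ * (6 * D / τ) = ‖S x‖ * (3 * D / τ) + ‖S x‖ * (3 * D / τ) := by ring
    rw [u3]
    linarith
  -- integrate it
  have ig : ∀ v, l1norm v = 1 → Integrable (g v 0) ρ := fun v hv => by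
    refine integrable_inner_of_bound (C := 4) hS ?_ ?_
    · exact ((continuous_ridgeJet τ v).comp
        (f := fun x : Eucl d => (-(0 : ℝ), x)) (by fun_prop)).aestronglyMeasurable
    · filter_upwards [hcube] with x hx
      exact norm_ridgeJet_le hτ hv (by simp) hx
  have f1 := integrable_ridge_pairing hcube hS hτ he hqc hqD
  have f2 := integrable_ridge_pairing (q := fun t => q (-t)) hcube hS hτ hen (by fun_prop) hqD'
  have j1 : Integrable (fun x => ∫ t in (0 : ℝ)..1, q t * g e t x) ρ := by
    have := f1.integral_prod_right
    simpa only [Function.uncurry, intervalIntegral.integral_of_le zero_le_one,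
      Set.uIoc_of_le (zero_le_one (α := ℝ))] using this
  have j2 : Integrable (fun x => ∫ t in (0 : ℝ)..1, q (-t) * g (-e) t x) ρ := by
    have := f2.integral_prod_right
    simpa only [Function.uncurry, intervalIntegral.integral_of_le zero_le_one,
      Set.uIoc_of_le (zero_le_one (α := ℝ))] using this
  have j0 : Integrable (fun x => h' 0 * (g e 0 x - g (-e) 0 x)) ρ :=
    ((ig e he).sub (ig (-e) hen)).const_mul _
  have j3 : Integrable (fun x => ‖S x‖ * (6 * D / τ)) ρ := hS.norm.mul_const _
  have jm : Integrable (fun x => inner ℝ (S x) (modeJet z w x)) ρ := by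
    refine integrable_inner_of_bound (C := 3 * ((1 + l1norm w) ^ 2 * ‖z‖)) hS ?_
      (Filter.Eventually.of_forall fun x => norm_modeJet_le z w x)
    exact (continuous_mkJet.comp (f := fun x : Eucl d =>
      ((Complex.exp (Complex.I * ((inner ℝ w x : ℝ) : ℂ)) * z).re - z.re,
       (Complex.I * Complex.exp (Complex.I * ((inner ℝ w x : ℝ) : ℂ)) * z).re • w))
      (by fun_prop)).aestronglyMeasurable
  have hint : ∫ x, inner ℝ (S x) (modeJet z w x) ∂ρ ≤
      ∫ x, (h' 0 * (g e 0 x - g (-e) 0 x) + (∫ t in (0 : ℝ)..1, q t * g e t x) +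
        (∫ t in (0 : ℝ)..1, q (-t) * g (-e) t x) + ‖S x‖ * (6 * D / τ)) ∂ρ := by
    refine integral_mono_ae jm (((j0.add j1).add j2).add j3) ?_
    filter_upwards [hcube] with x hx using hpt x hx
  refine hint.trans ?_
  have j01 : Integrable (fun x => h' 0 * (g e 0 x - g (-e) 0 x) +
      ∫ t in (0 : ℝ)..1, q t * g e t x) ρ := j0.add j1
  have j012 : Integrable (fun x => h' 0 * (g e 0 x - g (-e) 0 x) +
      (∫ t in (0 : ℝ)..1, q t * g e t x) + ∫ t in (0 : ℝ)..1, q (-t) * g (-e) t x) ρ := j01.add j2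
  -- Exchanging the integrals in the bias and the point leaves, for each bias, the pairing of `S`
  -- with one neuron, where the bound `P` applies.
  rw [integral_add j012 j3, integral_add j01 j2, integral_add j0 j1,
    integral_const_mul, integral_sub (ig e he) (ig (-e) hen), integral_mul_const,
    ← intervalIntegral_integral_swap f1, ← intervalIntegral_integral_swap f2]
  have bias : ∀ t ∈ Set.uIoc (0 : ℝ) 1, |(-t)| ≤ 1 := fun t ht => by
    rw [Set.uIoc_of_le zero_le_one] at ht
    rw [abs_neg, abs_of_pos ht.1]; exact ht.2
  have b0 : ∀ v, l1norm v = 1 → |∫ x, g v 0 x ∂ρ| ≤ P := fun v hv => hP v (-0) hv (by simp)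
  have b1 : |∫ t in (0 : ℝ)..1, ∫ x, q t * inner ℝ (S x) (ridgeJet τ e (-t) x) ∂ρ| ≤ D * P := by
    have := intervalIntegral.norm_integral_le_of_norm_le_const (a := (0 : ℝ)) (b := 1) (C := D * P)
      (f := fun t => ∫ x, q t * inner ℝ (S x) (ridgeJet τ e (-t) x) ∂ρ) fun t ht => by
        rw [integral_const_mul, Real.norm_eq_abs, abs_mul]
        exact mul_le_mul (hqD t) (hP e _ he (bias t ht)) (abs_nonneg _) hD
    simpa using this
  have b2 : |∫ t in (0 : ℝ)..1, ∫ x, q (-t) * inner ℝ (S x) (ridgeJet τ (-e) (-t) x) ∂ρ| ≤ D * P := by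
    have := intervalIntegral.norm_integral_le_of_norm_le_const (a := (0 : ℝ)) (b := 1) (C := D * P)
      (f := fun t => ∫ x, q (-t) * inner ℝ (S x) (ridgeJet τ (-e) (-t) x) ∂ρ) fun t ht => by
        rw [integral_const_mul, Real.norm_eq_abs, abs_mul]
        exact mul_le_mul (hqD' t) (hP (-e) _ hen (bias t ht)) (abs_nonneg _) hD
    simpa using this
  have b3 : h' 0 * ((∫ x, g e 0 x ∂ρ) - ∫ x, g (-e) 0 x ∂ρ) ≤ (r * ‖z‖) * (P + P) := by
    refine (le_abs_self _).trans ?_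
    rw [abs_mul]
    exact mul_le_mul hh'0 ((abs_sub _ _).trans (add_le_add (b0 e he) (b0 (-e) hen)))
      (abs_nonneg _) (by positivity)
  have c1 := (le_abs_self _).trans b1
  have c2 := (le_abs_self _).trans b2
  have hz := norm_nonneg z
  -- The linear term has mass `2r‖z‖` and each remainder at most `r²‖z‖`, and `r + r² ≤ (1 + r)²`.
  -- This is where the second-order moment is used in full.
  calc _ ≤ (r * ‖z‖) * (P + P) + D * P + D * P + (∫ x, ‖S x‖ ∂ρ) * (6 * D / τ) :=
        add_le_add (add_le_add (add_le_add b3 c1) c2) le_rfl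
    _ = 2 * P * ((r + r ^ 2) * ‖z‖) + (6 / τ * ∫ x, ‖S x‖ ∂ρ) * (r ^ 2 * ‖z‖) := by
        rw [hD_def]; ring
    _ ≤ 2 * P * ((1 + r) ^ 2 * ‖z‖) + (6 / τ * ∫ x, ‖S x‖ ∂ρ) * ((1 + r) ^ 2 * ‖z‖) := by
        gcongr <;> nlinarith
    _ = _ := by ring

variable {F : Eucl d → ℂ}

/-- A functional which is at most `P` on all neurons is controlled on every Barron function. -/
theorem integral_inner_barron_le (hF : AEStronglyMeasurable F volume)
    (hI : Integrable (fun w => (1 + l1norm w) ^ 2 * ‖F w‖) volume)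
    (hcube : ∀ᵐ x ∂ρ, ∀ j, |x j| ≤ 1) (hS : Integrable S ρ) (hτ : 1 ≤ τ) (hP0 : 0 ≤ P)
    (hP : ∀ w b, l1norm w = 1 → |b| ≤ 1 → |∫ x, inner ℝ (S x) (ridgeJet τ w b x) ∂ρ| ≤ P) :
    ∫ x, inner ℝ (S x) (mkJet (barronExt F x - barronExt F 0) (barronGrad F x)) ∂ρ ≤
      (2 * P + 6 / τ * ∫ x, ‖S x‖ ∂ρ) * ∫ w, (1 + l1norm w) ^ 2 * ‖F w‖ := by
  -- The target jet is the superposition of its mode jets, so the estimate for one mode can be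
  -- integrated over frequencies.
  have e1 : ∀ x, inner ℝ (S x) (mkJet (barronExt F x - barronExt F 0) (barronGrad F x)) =
      ∫ w, inner ℝ (S x) (modeJet (F w) w x) := fun x => by
    have k1 := integrable_barron_integrand hF hI x
    have k2 := integrable_barron_integrand hF hI 0
    have k3 := integrable_barronGrad_integrand hF hI x
    have k4 : Integrable (fun w => inner ℝ (S x).snd
        ((Complex.I * Complex.exp (Complex.I * ((inner ℝ w x : ℝ) : ℂ)) * F w).re • w)) volume :=
      k3.const_inner _
    simp only [modeJet, inner_mkJet]
    have k2' : (fun w => (F w).re) =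
        fun w => (Complex.exp (Complex.I * ((inner ℝ w (0 : Eucl d) : ℝ) : ℂ)) * F w).re := by
      ext w; simp
    have k5 : Integrable (fun w => (F w).re) volume := by rw [k2']; exact k2
    have k6 : Integrable (fun w => (S x).fst *
        ((Complex.exp (Complex.I * ((inner ℝ w x : ℝ) : ℂ)) * F w).re - (F w).re)) volume :=
      (k1.sub k5).const_mul _
    rw [integral_add k6 k4, integral_const_mul, integral_sub k1 k5, k2',
      integral_inner k3]
    rfl
  simp only [e1]
  have hmeas : AEStronglyMeasurable (fun p : Eucl d × Eucl d => modeJet (F p.2) p.2 p.1)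
      (ρ.prod volume) := by
    have hF2 : AEStronglyMeasurable (fun p : Eucl d × Eucl d => F p.2) (ρ.prod volume) := hF.comp_snd
    have hexp : AEStronglyMeasurable (fun p : Eucl d × Eucl d =>
        Complex.exp (Complex.I * ((inner ℝ p.2 p.1 : ℝ) : ℂ))) (ρ.prod volume) :=
      Continuous.aestronglyMeasurable (by fun_prop)
    refine continuous_mkJet.comp_aestronglyMeasurable (AEStronglyMeasurable.prodMk ?_ ?_)
    · exact (Complex.continuous_re.comp_aestronglyMeasurable (hexp.mul hF2)).sub
        (Complex.continuous_re.comp_aestronglyMeasurable hF2)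
    · exact (Complex.continuous_re.comp_aestronglyMeasurable
        ((aestronglyMeasurable_const.mul hexp).mul hF2)).smul
        continuous_snd.aestronglyMeasurable
  have hfub : Integrable (Function.uncurry fun x w => inner ℝ (S x) (modeJet (F w) w x))
      (ρ.prod volume) := by
    have hb : Integrable (fun p : Eucl d × Eucl d =>
        ‖S p.1‖ * (3 * ((1 + l1norm p.2) ^ 2 * ‖F p.2‖))) (ρ.prod volume) :=
      hS.norm.mul_prod (hI.const_mul 3)
    refine hb.mono' ?_ (Filter.Eventually.of_forall fun p => ?_)
    · exact AEStronglyMeasurable.inner (𝕜 := ℝ) hS.1.comp_fst hmeas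
    · exact (norm_inner_le_norm _ _).trans
        (mul_le_mul_of_nonneg_left (norm_modeJet_le _ _ _) (norm_nonneg _))
  rw [integral_integral_swap hfub, ← integral_const_mul]
  refine integral_mono hfub.integral_prod_right (hI.const_mul _) fun w => ?_
  exact integral_inner_modeJet_le hcube hS hτ hP0 hP (F w) w

end Duality

/-! ### Approximation of Barron functions by softplus networks -/

section Approximation

/-- A supremum need not be attained, but half of it is exceeded when it is positive; when it is zero
any index serves. The loss is a factor, not an additive error. -/
lemma exists_forall_le_two_mul {ι : Type*} [Nonempty ι] {u : ι → ℝ} (hu : ∀ i, 0 ≤ u i)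
    {K : ℝ} (hK : ∀ i, u i ≤ K) : ∃ i₀, ∀ i, u i ≤ 2 * u i₀ := by
  have hb : BddAbove (Set.range u) := ⟨K, by rintro _ ⟨i, rfl⟩; exact hK i⟩
  rcases le_or_gt (⨆ i, u i) 0 with h | h
  · obtain ⟨i₀⟩ := ‹Nonempty ι›
    exact ⟨i₀, fun i => by linarith [le_ciSup hb i, hu i₀]⟩
  · obtain ⟨i₀, hi₀⟩ := exists_lt_of_lt_ciSup (half_lt_self h)
    exact ⟨i₀, fun i => by linarith [le_ciSup hb i]⟩

lemma integral_norm_le_norm_L2 {α E : Type*} [MeasurableSpace α] {μ : Measure α}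
    [IsProbabilityMeasure μ] [NormedAddCommGroup E] (S : Lp E 2 μ) : ∫ x, ‖S x‖ ∂μ ≤ ‖S‖ := by
  rw [integral_norm_eq_lintegral_enorm (Lp.aestronglyMeasurable S), Lp.norm_def,
    ← eLpNorm_one_eq_lintegral_enorm]
  exact ENNReal.toReal_mono (Lp.eLpNorm_ne_top S)
    (eLpNorm_le_eLpNorm_of_exponent_le one_le_two (Lp.aestronglyMeasurable S))

lemma norm_L2_sq {α E : Type*} [MeasurableSpace α] {μ : Measure α}
    [NormedAddCommGroup E] [InnerProductSpace ℝ E] (S : Lp E 2 μ) :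
    ‖S‖ ^ 2 = ∫ x, ‖S x‖ ^ 2 ∂μ := by
  rw [← real_inner_self_eq_norm_sq, L2.inner_def]
  simp only [real_inner_self_eq_norm_sq]

variable {d m : ℕ} {B : ℝ}

/-- Writes the approximation error as a mean of `m` differences with a common target, the form
required by the greedy lemma. The additive constant of the network is moved into the target. -/
lemma average_ridgeJet_sub (θ : NetParam d m B) (hm : 1 ≤ m) (τ : ℝ) (u : ℝ) (v x : Eucl d) :
    mkJet (network (softplus τ) θ x - u) (networkGrad τ θ x - v) =
      (1 / (m : ℝ)) • ∑ k, ((θ.2.1 k : ℝ) • ridgeJet τ (θ.2.2 k).1.1 (θ.2.2 k).1.2 x -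
        mkJet (u - θ.1) v) := by
  have hsum : ∀ (s : Finset (Fin m)) (a : Fin m → ℝ) (w : Fin m → Eucl d),
      ∑ k ∈ s, mkJet (a k) (w k) = mkJet (∑ k ∈ s, a k) (∑ k ∈ s, w k) := fun s a w => by
    induction s using Finset.cons_induction with
    | empty => rfl
    | cons k s hk ih => rw [Finset.sum_cons, Finset.sum_cons, Finset.sum_cons, ih, mkJet_add]
  have hm' : (m : ℝ) ≠ 0 := by exact_mod_cast (by omega : m ≠ 0)
  simp only [ridgeJet, smul_mkJet, mkJet_sub]
  rw [hsum, smul_mkJet]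
  congr 1
  · rw [Finset.sum_sub_distrib, Finset.sum_const, Finset.card_univ, Fintype.card_fin, nsmul_eq_mul,
      network, mul_sub]
    simp only [preact]
    field_simp
    ring
  · rw [Finset.sum_sub_distrib, Finset.sum_const, Finset.card_univ, Fintype.card_fin, networkGrad,
      smul_sub, ← Nat.cast_smul_eq_nsmul ℝ, smul_smul, one_div_mul_cancel hm', one_smul]
    simp only [preact, smul_smul]

lemma exists_l1norm_eq_one (hd : 0 < d) : ∃ w : Eucl d, l1norm w = 1 := by
  refine ⟨EuclideanSpace.single ⟨0, hd⟩ 1, ?_⟩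
  rw [l1norm, Finset.sum_eq_single ⟨0, hd⟩]
  · simp
  · intro j _ hj; simp [hj]
  · simp

/-- A Barron function is approximated in `H¹` by softplus networks of width `m` with
temperature `√m` at the rate `1 / √m`. -/
theorem exists_network_approx {ρ : Measure (Eucl d)} [IsProbabilityMeasure ρ] (hd : 0 < d)
    (hm : 1 ≤ m) {F : Eucl d → ℂ} (hF : AEStronglyMeasurable F volume)
    (hI : Integrable (fun w => (1 + l1norm w) ^ 2 * ‖F w‖) volume)
    (hB : ∫ w, (1 + l1norm w) ^ 2 * ‖F w‖ ≤ B) (hcube : ∀ᵐ x ∂ρ, ∀ j, |x j| ≤ 1) :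
    ∃ θ : NetParam d m B,
      ∫ x, ((network (softplus (Real.sqrt m)) θ x - barronExt F x) ^ 2 +
        ‖networkGrad (Real.sqrt m) θ x - barronGrad F x‖ ^ 2) ∂ρ ≤
      625 * (∫ w, (1 + l1norm w) ^ 2 * ‖F w‖) ^ 2 / m := by
  set γ := ∫ w, (1 + l1norm w) ^ 2 * ‖F w‖ with hγ_def
  have hm' : (0 : ℝ) < m := by exact_mod_cast hm
  set τ := Real.sqrt m with hτ_def
  have hτ : 1 ≤ τ := by
    rw [hτ_def, Real.one_le_sqrt]; exact_mod_cast hm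
  have hτ0 : 0 < τ := by linarith
  have hτ2 : τ ^ 2 = m := Real.sq_sqrt hm'.le
  have hγ : 0 ≤ γ := integral_nonneg fun w => by positivity
  set J : Eucl d → Jet d := fun x => mkJet (barronExt F x - barronExt F 0) (barronGrad F x) with hJ
  have hJc : Continuous J := continuous_mkJet.comp
    (f := fun x => (barronExt F x - barronExt F 0, barronGrad F x)) (by
      have h1 := continuous_barronExt hF hI
      have h2 := continuous_barronGrad hF hI
      fun_prop)
  have hJb : ∀ x, ‖J x‖ ≤ 3 * γ := fun x => by
    refine (norm_mkJet_le _ _).trans ?_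
    have h1 := (abs_sub (barronExt F x) (barronExt F 0)).trans
      (add_le_add (abs_barronExt_le hI x) (abs_barronExt_le hI 0))
    have h2 := norm_barronGrad_le hI x
    linarith
  have hJL : MemLp J 2 ρ := MemLp.of_bound hJc.aestronglyMeasurable _
    (Filter.Eventually.of_forall hJb)
  set f : Lp (Jet d) 2 ρ := hJL.toLp J
  have hf : f =ᵐ[ρ] J := hJL.coeFn_toLp
  have hRc : ∀ w b, Continuous (ridgeJet (d := d) τ w b) := fun w b =>
    (continuous_ridgeJet τ w).comp (f := fun x : Eucl d => (b, x)) (by fun_prop)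
  -- The coefficient `4γ` is the factor `2` from the duality estimate times the factor `2` from a
  -- near-maximal neuron; it is well within the allowed `16B`.
  set G : Set (Lp (Jet d) 2 ρ) := {g | ∃ (a : ℝ) (p : NeuronParam d), |a| ≤ 4 * γ ∧
    g =ᵐ[ρ] fun x => a • ridgeJet τ p.1.1 p.1.2 x} with hG
  -- Here `19 = 4 · 4 + 3`: neuron jets have norm at most `4` on the cube and the target jet at most
  -- `3γ`.
  have hdist : ∀ g ∈ G, ‖g - f‖ ≤ 19 * γ := by
    rintro g ⟨a, p, ha, hg⟩
    have := Lp.norm_le_of_ae_bound (f := g - f) (C := 19 * γ) (by positivity) (by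
      filter_upwards [hg, hf, Lp.coeFn_sub g f, hcube] with x h1 h2 h3 h4
      rw [h3, Pi.sub_apply, h1, h2]
      refine (norm_sub_le _ _).trans ?_
      rw [norm_smul, Real.norm_eq_abs]
      have h5 := mul_le_mul ha (norm_ridgeJet_le hτ p.2.1 p.2.2 h4) (norm_nonneg _) (by positivity)
      have := hJb x
      linarith)
    simpa [measureUnivNNReal] using this
  have hne : Nonempty (NeuronParam d) := by
    obtain ⟨w, hw⟩ := exists_l1norm_eq_one hd
    exact ⟨⟨(w, 0), hw, by simp⟩⟩
  have hdual : ∀ S : Lp (Jet d) 2 ρ, ∃ g ∈ G, inner ℝ S f ≤ inner ℝ S g + (6 * γ / τ) * ‖S‖ := by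
    intro S
    have hS : Integrable S ρ := (Lp.memLp S).integrable one_le_two
    set l : NeuronParam d → ℝ := fun p => ∫ x, inner ℝ (S x) (ridgeJet τ p.1.1 p.1.2 x) ∂ρ with hl
    have hlb : ∀ p, |l p| ≤ (∫ x, ‖S x‖ ∂ρ) * 4 := fun p => by
      have := norm_integral_le_of_norm_le (f := fun x => inner ℝ (S x) (ridgeJet τ p.1.1 p.1.2 x))
        (hS.norm.mul_const 4) (by
          filter_upwards [hcube] with x hx
          exact (norm_inner_le_norm _ _).trans
            (mul_le_mul_of_nonneg_left (norm_ridgeJet_le hτ p.2.1 p.2.2 hx) (norm_nonneg _)))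
      rwa [integral_mul_const] at this
    obtain ⟨p₀, hp₀⟩ := exists_forall_le_two_mul (fun p => abs_nonneg (l p)) hlb
    have hduality := integral_inner_barron_le hF hI hcube hS hτ (P := 2 * |l p₀|) (by positivity)
      fun w b hw hb => hp₀ ⟨(w, b), hw, hb⟩
    obtain ⟨a, ha, hal⟩ : ∃ a : ℝ, |a| ≤ 4 * γ ∧ a * l p₀ = 4 * γ * |l p₀| := by
      rcases le_total 0 (l p₀) with h | h
      · exact ⟨4 * γ, by rw [abs_of_nonneg (by positivity)], by rw [abs_of_nonneg h]⟩
      · exact ⟨-(4 * γ), by rw [abs_neg, abs_of_nonneg (by positivity)], by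
          rw [abs_of_nonpos h]; ring⟩
    have hgL : MemLp (fun x => a • ridgeJet τ p₀.1.1 p₀.1.2 x) 2 ρ := by
      refine MemLp.of_bound ((hRc _ _).const_smul a).aestronglyMeasurable (|a| * 4) ?_
      filter_upwards [hcube] with x hx
      rw [norm_smul, Real.norm_eq_abs]
      exact mul_le_mul_of_nonneg_left (norm_ridgeJet_le hτ p₀.2.1 p₀.2.2 hx) (abs_nonneg _)
    refine ⟨hgL.toLp _, ⟨a, p₀, ha, hgL.coeFn_toLp⟩, ?_⟩
    have e1 : inner ℝ S f = ∫ x, inner ℝ (S x) (J x) ∂ρ := by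
      rw [L2.inner_def]
      refine integral_congr_ae ?_
      filter_upwards [hf] with x hx
      rw [hx]
    have e2 : inner ℝ S (hgL.toLp _) = a * l p₀ := by
      rw [L2.inner_def, hl, ← integral_const_mul]
      refine integral_congr_ae ?_
      filter_upwards [hgL.coeFn_toLp] with x hx
      rw [hx, inner_smul_right]
    rw [e1, e2, hal]
    refine hduality.trans ?_
    have h3 := integral_norm_le_norm_L2 S
    calc (2 * (2 * |l p₀|) + 6 / τ * ∫ x, ‖S x‖ ∂ρ) * γ
        ≤ (2 * (2 * |l p₀|) + 6 / τ * ‖S‖) * γ := by gcongr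
      _ = _ := by ring
  obtain ⟨g, hgG, hg⟩ := exists_norm_sum_sub_le (by positivity) (by positivity) hdist hdual m
  choose a p ha hga using hgG
  have hB0 : 0 ≤ B := hγ.trans hB
  have hc : |barronExt F 0| ≤ 2 * B := by
    have := abs_barronExt_le hI 0
    linarith
  refine ⟨⟨⟨barronExt F 0, hc⟩, fun k => ⟨a k, (ha k).trans (by linarith)⟩, p⟩, ?_⟩
  set θ : NetParam d m B := ⟨⟨barronExt F 0, hc⟩, fun k => ⟨a k, (ha k).trans (by linarith)⟩, p⟩
  -- With `τ² = m` both terms are multiples of `γτ`, and `6 + 19 = 25`.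
  have hbound : ‖∑ k, (g k - f)‖ ≤ 25 * γ * τ := by
    refine hg.trans (le_of_eq ?_)
    rw [← hτ_def, ← hτ2]; field_simp; ring
  have hcoe : ∀ s : Finset (Fin m), (∑ k ∈ s, (g k - f) : Lp (Jet d) 2 ρ) =ᵐ[ρ]
      fun x => ∑ k ∈ s, (a k • ridgeJet τ (p k).1.1 (p k).1.2 x - J x) := fun s => by
    induction s using Finset.cons_induction with
    | empty => simp only [Finset.sum_empty]; exact Lp.coeFn_zero (Jet d) 2 ρ
    | cons k s hk ih =>
      rw [Finset.sum_cons]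
      filter_upwards [Lp.coeFn_add (g k - f) (∑ k ∈ s, (g k - f)), Lp.coeFn_sub (g k) f, ih, hga k,
        hf] with x h1 h2 h3 h4 h5
      rw [h1, Pi.add_apply, h2, Pi.sub_apply, h3, h4, h5, Finset.sum_cons]
  have hfin : ∫ x, ((network (softplus τ) θ x - barronExt F x) ^ 2 +
      ‖networkGrad τ θ x - barronGrad F x‖ ^ 2) ∂ρ = (1 / (m : ℝ)) ^ 2 * ‖∑ k, (g k - f)‖ ^ 2 := by
    rw [norm_L2_sq, ← integral_const_mul]
    refine integral_congr_ae ?_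
    filter_upwards [hcoe Finset.univ] with x hx
    rw [hx, ← norm_mkJet_sq, average_ridgeJet_sub θ hm, norm_smul, mul_pow, Real.norm_eq_abs, sq_abs]
  rw [hfin]
  calc (1 / (m : ℝ)) ^ 2 * ‖∑ k, (g k - f)‖ ^ 2 ≤ (1 / (m : ℝ)) ^ 2 * (25 * γ * τ) ^ 2 := by gcongr
    _ = 625 * γ ^ 2 / m := by
      rw [mul_pow, hτ2]; field_simp; ring

end Approximation

/-! ### Weak gradients and the Tikhonov functional -/

section WeakGradient

variable {d : ℕ} {Ω : Set (Eucl d)}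

lemma LocallyIntegrableOn.integrable_smul_of_tsupport_subset {E : Type*} [NormedAddCommGroup E]
    [NormedSpace ℝ E] {f : Eucl d → E} (hf : LocallyIntegrableOn f Ω volume) {ψ : Eucl d → ℝ}
    (hψ : Continuous ψ) (hc : HasCompactSupport ψ) (hs : tsupport ψ ⊆ Ω) :
    Integrable (fun x => ψ x • f x) volume := by
  have h1 : IntegrableOn f (tsupport ψ) volume := hf.integrableOn_compact_subset hs hc
  refine (h1.continuousOn_smul hψ.continuousOn hc).integrable_of_forall_notMem_eq_zero
    fun x hx => ?_
  rw [image_eq_zero_of_notMem_tsupport hx, zero_smul]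

lemma continuous_fderiv_apply_of_contDiff {ψ : Eucl d → ℝ} (hψ : ContDiff ℝ ∞ ψ) (v : Eucl d) :
    Continuous fun x => fderiv ℝ ψ x v :=
  (hψ.continuous_fderiv (by simp)).clm_apply continuous_const

namespace HasWeakGradient

variable {u u' : Eucl d → ℝ} {G G' : Eucl d → Eucl d}

lemma integrable_mul_fderiv (h : HasWeakGradient Ω u G) {ψ : Eucl d → ℝ} (hψ : ContDiff ℝ ∞ ψ)
    (hc : HasCompactSupport ψ) (hs : tsupport ψ ⊆ Ω) (v : Eucl d) :
    Integrable (fun x => u x * fderiv ℝ ψ x v) volume := by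
  have := LocallyIntegrableOn.integrable_smul_of_tsupport_subset h.1
    (continuous_fderiv_apply_of_contDiff hψ v) (hc.fderiv_apply (𝕜 := ℝ) v)
    ((tsupport_fderiv_apply_subset ℝ v).trans hs)
  simpa only [smul_eq_mul, mul_comm] using this

lemma integrable_smul (h : HasWeakGradient Ω u G) {ψ : Eucl d → ℝ} (hψ : ContDiff ℝ ∞ ψ)
    (hc : HasCompactSupport ψ) (hs : tsupport ψ ⊆ Ω) :
    Integrable (fun x => ψ x • G x) volume :=
  LocallyIntegrableOn.integrable_smul_of_tsupport_subset h.2.1 hψ.continuous hc hs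

lemma integrable_inner_mul (h : HasWeakGradient Ω u G) {ψ : Eucl d → ℝ} (hψ : ContDiff ℝ ∞ ψ)
    (hc : HasCompactSupport ψ) (hs : tsupport ψ ⊆ Ω) (v : Eucl d) :
    Integrable (fun x => inner ℝ (G x) v * ψ x) volume := by
  refine ((h.integrable_smul hψ hc hs).inner_const (𝕜 := ℝ) v).congr
    (Filter.Eventually.of_forall fun x => ?_)
  simp only [real_inner_smul_left, mul_comm]

/-- Weak gradients are unique up to null sets. -/
lemma ae_eq (hΩ : IsOpen Ω) (h : HasWeakGradient Ω u G) (h' : HasWeakGradient Ω u G') :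
    G =ᵐ[volume.restrict Ω] G' := by
  have key := hΩ.ae_eq_zero_of_integral_contDiff_smul_eq_zero (μ := volume) (h.2.1.sub h'.2.1)
    fun ψ hψ hc hs => by
      have i1 := h.integrable_smul hψ hc hs
      have i2 := h'.integrable_smul hψ hc hs
      simp only [Pi.sub_apply, smul_sub]
      rw [integral_sub i1 i2, sub_eq_zero]
      refine ext_inner_left ℝ fun v => ?_
      rw [← integral_inner i1, ← integral_inner i2]
      have e : ∀ {G : Eucl d → Eucl d}, ∫ x, inner ℝ v (ψ x • G x) =
          ∫ x in Ω, inner ℝ (G x) v * ψ x := fun {G} => by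
        rw [setIntegral_eq_integral_of_forall_compl_eq_zero]
        · refine integral_congr_ae (Filter.Eventually.of_forall fun x => ?_)
          simp only [inner_smul_right, real_inner_comm, mul_comm]
        · intro x hx
          rw [image_eq_zero_of_notMem_tsupport fun hx' => hx (hs hx'), mul_zero]
      rw [e, e]
      have h1 := h.2.2 ψ hψ hc hs v
      have h2 := h'.2.2 ψ hψ hc hs v
      linarith
  rw [Filter.EventuallyEq, ae_restrict_iff' hΩ.measurableSet]
  filter_upwards [key] with x hx hxΩ
  exact sub_eq_zero.1 (hx hxΩ)

lemma add_mul (h : HasWeakGradient Ω u G) (h' : HasWeakGradient Ω u' G') (c : ℝ) :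
    HasWeakGradient Ω (fun x => u x + c * u' x) (fun x => G x + c • G' x) := by
  refine ⟨h.1.add (h'.1.smul c), h.2.1.add (h'.2.1.smul c), fun ψ hψ hc hs v => ?_⟩
  have i1 := (h.integrable_mul_fderiv hψ hc hs v).restrict (s := Ω)
  have i2 := ((h'.integrable_mul_fderiv hψ hc hs v).restrict (s := Ω)).const_mul c
  have i3 := (h.integrable_inner_mul hψ hc hs v).restrict (s := Ω)
  have i4 := ((h'.integrable_inner_mul hψ hc hs v).restrict (s := Ω)).const_mul c
  have e1 : ∀ x, (u x + c * u' x) * fderiv ℝ ψ x v =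
      u x * fderiv ℝ ψ x v + c * (u' x * fderiv ℝ ψ x v) := fun x => by ring
  have e2 : ∀ x, inner ℝ (G x + c • G' x) v * ψ x =
      inner ℝ (G x) v * ψ x + c * (inner ℝ (G' x) v * ψ x) := fun x => by
    rw [inner_add_left, real_inner_smul_left]; ring
  simp only [e1, e2]
  rw [integral_add i1 i2, integral_add i3 i4, integral_const_mul, integral_const_mul,
    h.2.2 ψ hψ hc hs v, h'.2.2 ψ hψ hc hs v]
  ring

/-- The chosen weak gradient may be replaced by any explicit one under the integral. -/
lemma weakGradient_ae_eq (hΩ : IsOpen Ω) (h : HasWeakGradient Ω u G) :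
    weakGradient Ω u =ᵐ[volume.restrict Ω] G := by
  have hex : ∃ G, HasWeakGradient Ω u G := ⟨G, h⟩
  rw [weakGradient, dif_pos hex]
  exact hex.choose_spec.ae_eq hΩ h

end HasWeakGradient

/-- A classical `C¹` gradient is a weak gradient. -/
lemma hasWeakGradient_of_hasGradientAt (hΩ : IsOpen Ω) {u f : Eucl d → ℝ} {g : Eucl d → Eucl d}
    (hf : ∀ x, HasGradientAt f (g x) x) (hg : Continuous g) (huf : ∀ x ∈ Ω, u x = f x)
    (hu : IntegrableOn u Ω volume) (hgi : IntegrableOn g Ω volume) : HasWeakGradient Ω u g := by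
  refine ⟨hu.locallyIntegrableOn, hgi.locallyIntegrableOn, fun ψ hψ hc hs v => ?_⟩
  have hfc : Continuous f := continuous_iff_continuousAt.2 fun x => (hf x).hasFDerivAt.continuousAt
  have hψ' := continuous_fderiv_apply_of_contDiff hψ v
  have hfd : ∀ x, fderiv ℝ f x v = inner ℝ (g x) v := fun x => by
    rw [(hf x).hasFDerivAt.fderiv]; simp
  have hgv : Continuous fun x => inner ℝ (g x) v := by fun_prop
  -- The test function is supported in `Ω`, so both integrals extend to the whole space; integration
  -- by parts there has no boundary term and asks nothing of `∂Ω`.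
  have e1 : ∫ x in Ω, u x * fderiv ℝ ψ x v = ∫ x, f x * fderiv ℝ ψ x v := by
    rw [← setIntegral_eq_integral_of_forall_compl_eq_zero (s := Ω) (μ := volume)
      (f := fun x => f x * fderiv ℝ ψ x v)]
    · refine setIntegral_congr_fun hΩ.measurableSet fun x hx => ?_
      simp only [huf x hx]
    · intro x hx
      have : x ∉ tsupport fun x => fderiv ℝ ψ x v := fun hx' =>
        hx (hs (tsupport_fderiv_apply_subset ℝ v hx'))
      rw [image_eq_zero_of_notMem_tsupport this, mul_zero]
  have e2 : ∫ x in Ω, inner ℝ (g x) v * ψ x = ∫ x, inner ℝ (g x) v * ψ x := by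
    rw [setIntegral_eq_integral_of_forall_compl_eq_zero]
    intro x hx
    rw [image_eq_zero_of_notMem_tsupport fun hx' => hx (hs hx'), mul_zero]
  rw [e1, e2]
  have := integral_mul_fderiv_eq_neg_fderiv_mul_of_integrable (μ := (volume : Measure (Eucl d)))
    (f := f) (g := ψ) (v := v) ?_ ?_ ?_ (fun x _ => (hf x).hasFDerivAt.differentiableAt)
    (fun x _ => (hψ.differentiable (by simp)) x)
  · simpa only [hfd] using this
  · simp only [hfd]
    exact (hgv.mul hψ.continuous).integrable_of_hasCompactSupport hc.mul_left
  · exact (hfc.mul hψ').integrable_of_hasCompactSupport (hc.fderiv_apply (𝕜 := ℝ) v).mul_left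
  · exact (hfc.mul hψ.continuous).integrable_of_hasCompactSupport hc.mul_left

/-- A function which agrees on `Ω` with a `C¹` function that is bounded there with its gradient. -/
lemma hasWeakGradient_and_memLp (hΩ : IsOpen Ω) (hfin : volume Ω ≠ ⊤) {u f : Eucl d → ℝ}
    {g : Eucl d → Eucl d} (hf : ∀ x, HasGradientAt f (g x) x) (hg : Continuous g)
    (huf : ∀ x ∈ Ω, u x = f x) {K : ℝ} (hfK : ∀ x ∈ Ω, |f x| ≤ K) (hgK : ∀ x ∈ Ω, ‖g x‖ ≤ K) :
    HasWeakGradient Ω u g ∧ MemLp u 2 (volume.restrict Ω) ∧ MemLp g 2 (volume.restrict Ω) := by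
  have : IsFiniteMeasure (volume.restrict Ω) := ⟨by simpa using hfin.lt_top⟩
  have hfc : Continuous f := continuous_iff_continuousAt.2 fun x => (hf x).hasFDerivAt.continuousAt
  have hgL : MemLp g 2 (volume.restrict Ω) := MemLp.of_bound hg.aestronglyMeasurable K
    ((ae_restrict_iff' hΩ.measurableSet).2 (Filter.Eventually.of_forall hgK))
  have hfL : MemLp f 2 (volume.restrict Ω) := MemLp.of_bound hfc.aestronglyMeasurable K
    ((ae_restrict_iff' hΩ.measurableSet).2 (Filter.Eventually.of_forall hfK))
  have huf' : u =ᵐ[volume.restrict Ω] f :=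
    (ae_restrict_iff' hΩ.measurableSet).2 (Filter.Eventually.of_forall huf)
  have huL : MemLp u 2 (volume.restrict Ω) := (memLp_congr_ae huf').2 hfL
  exact ⟨hasWeakGradient_of_hasGradientAt hΩ hf hg huf (huL.integrable one_le_two)
    (hgL.integrable one_le_two), huL, hgL⟩

lemma MemH1.add_mul {u v : Eucl d → ℝ} (hu : MemH1 Ω u) (hv : MemH1 Ω v) (c : ℝ) :
    MemH1 Ω fun x => u x + c * v x := by
  obtain ⟨hu, G, hG, hGL⟩ := hu
  obtain ⟨hv, H, hH, hHL⟩ := hv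
  exact ⟨hu.add (hv.const_smul c), _, hG.add_mul hH c, hGL.add (hHL.const_smul c)⟩

lemma MemH1.sub {u v : Eucl d → ℝ} (hu : MemH1 Ω u) (hv : MemH1 Ω v) :
    MemH1 Ω fun x => u x - v x := by
  have := hu.add_mul hv (-1)
  simpa only [neg_one_mul, ← sub_eq_add_neg] using this

lemma ae_uniformLaw {p : Eucl d → Prop} (h : ∀ᵐ x ∂(volume.restrict Ω), p x) :
    ∀ᵐ x ∂(uniformLaw Ω), p x := Measure.ae_smul_measure h _

lemma MemLp.uniformLaw {E : Type*} [NormedAddCommGroup E] {f : Eucl d → E} (h0 : volume Ω ≠ 0)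
    (hf : MemLp f 2 (volume.restrict Ω)) : MemLp f 2 (uniformLaw Ω) :=
  hf.smul_measure (ENNReal.inv_ne_top.2 h0)

lemma isProbabilityMeasure_uniformLaw (h0 : volume Ω ≠ 0) (hfin : volume Ω ≠ ⊤) :
    IsProbabilityMeasure (uniformLaw Ω) :=
  ⟨by simp [uniformLaw, ENNReal.inv_mul_cancel h0 hfin]⟩

lemma tikLoss_eq (hΩ : IsOpen Ω) {y u : Eucl d → ℝ} {G : Eucl d → Eucl d}
    (h : HasWeakGradient Ω u G) :
    tikLoss Ω y u = ∫ x, (u x ^ 2 - 2 * u x * y x + ‖G x‖ ^ 2) ∂(uniformLaw Ω) := by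
  refine integral_congr_ae ?_
  filter_upwards [ae_uniformLaw (h.weakGradient_ae_eq hΩ)] with x hx
  rw [hx]

lemma h1NormSq_eq (hΩ : IsOpen Ω) {u : Eucl d → ℝ} {G : Eucl d → Eucl d}
    (h : HasWeakGradient Ω u G) :
    h1NormSq Ω u = ∫ x, (u x ^ 2 + ‖G x‖ ^ 2) ∂(uniformLaw Ω) := by
  refine integral_congr_ae ?_
  filter_upwards [ae_uniformLaw (h.weakGradient_ae_eq hΩ)] with x hx
  rw [hx]

/-- The excess Tikhonov loss over a minimizer is the squared `H¹` distance. -/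
theorem tikLoss_sub_eq_h1NormSq (hΩ : IsOpen Ω) (h0 : volume Ω ≠ 0) (hfin : volume Ω ≠ ⊤)
    {y : Eucl d → ℝ} (hy : AEMeasurable y (volume.restrict Ω)) {Y : ℝ} (hY : ∀ x ∈ Ω, |y x| ≤ Y)
    {u v : Eucl d → ℝ} (hu : MemH1 Ω u)
    (hmin : ∀ v, MemH1 Ω v → tikLoss Ω y u ≤ tikLoss Ω y v) (hv : MemH1 Ω v) :
    h1NormSq Ω (fun x => v x - u x) = tikLoss Ω y v - tikLoss Ω y u := by
  have : IsFiniteMeasure (volume.restrict Ω) := ⟨by simpa using hfin.lt_top⟩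
  obtain ⟨w, hw_def⟩ : ∃ w : Eucl d → ℝ, w = fun x => v x - u x := ⟨_, rfl⟩
  have hw : MemH1 Ω w := hw_def ▸ hv.sub hu
  have hwv : v = fun x => u x + 1 * w x := by ext x; rw [hw_def]; ring
  rw [← hw_def]
  have hyL := MemLp.uniformLaw h0 (MemLp.of_bound (p := 2) hy.aestronglyMeasurable Y
    ((ae_restrict_iff' hΩ.measurableSet).2 (Filter.Eventually.of_forall hY)))
  have hu' := hu
  obtain ⟨huL, G, hG, hGL⟩ := hu
  have hw' := hw
  obtain ⟨hwL, H, hH, hHL⟩ := hw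
  replace huL := MemLp.uniformLaw h0 huL
  replace hwL := MemLp.uniformLaw h0 hwL
  replace hGL := MemLp.uniformLaw h0 hGL
  replace hHL := MemLp.uniformLaw h0 hHL
  have iuy : Integrable (fun x => u x * y x) (uniformLaw Ω) := huL.integrable_mul hyL
  have iwy : Integrable (fun x => w x * y x) (uniformLaw Ω) := hwL.integrable_mul hyL
  have iuw : Integrable (fun x => u x * w x) (uniformLaw Ω) := huL.integrable_mul hwL
  have iu2 := huL.integrable_sq
  have iw2 := hwL.integrable_sq
  have iG2 := hGL.norm.integrable_sq
  have iH2 := hHL.norm.integrable_sq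
  have iGH : Integrable (fun x => inner ℝ (G x) (H x)) (uniformLaw Ω) := by
    have : Integrable (fun x => ‖G x‖ * ‖H x‖) (uniformLaw Ω) := hGL.norm.integrable_mul hHL.norm
    exact this.mono' (hGL.1.inner hHL.1) (Filter.Eventually.of_forall fun x => norm_inner_le_norm _ _)
  set a := tikLoss Ω y u
  set b := ∫ x, (u x * w x - w x * y x + inner ℝ (G x) (H x)) ∂(uniformLaw Ω) with hb
  set h := h1NormSq Ω w with hh
  have iA : Integrable (fun x => u x ^ 2 - 2 * (u x * y x) + ‖G x‖ ^ 2) (uniformLaw Ω) :=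
    (iu2.sub (iuy.const_mul 2)).add iG2
  have iB : Integrable (fun x => u x * w x - w x * y x + inner ℝ (G x) (H x)) (uniformLaw Ω) :=
    (iuw.sub iwy).add iGH
  have iC : Integrable (fun x => w x ^ 2 + ‖H x‖ ^ 2) (uniformLaw Ω) := iw2.add iH2
  -- Along a line through the minimizer the loss is a quadratic polynomial, with leading coefficient
  -- the squared norm of the direction.
  have expand : ∀ s : ℝ, tikLoss Ω y (fun x => u x + s * w x) = a + 2 * s * b + s ^ 2 * h := by
    intro s
    rw [tikLoss_eq hΩ (hG.add_mul hH s), show a = _ from tikLoss_eq hΩ hG, hh, h1NormSq_eq hΩ hH,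
      hb, ← integral_const_mul, ← integral_const_mul]
    simp only [mul_assoc (2 : ℝ) (u _)]
    have iAB : Integrable (fun x => u x ^ 2 - 2 * (u x * y x) + ‖G x‖ ^ 2 +
      2 * s * (u x * w x - w x * y x + inner ℝ (G x) (H x))) (uniformLaw Ω) :=
      iA.add (iB.const_mul _)
    rw [← integral_add iA (iB.const_mul _), ← integral_add iAB (iC.const_mul _)]
    refine integral_congr_ae (Filter.Eventually.of_forall fun x => ?_)
    simp only
    rw [norm_add_sq_real, inner_smul_right, norm_smul, mul_pow, Real.norm_eq_abs, sq_abs]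
    ring
  have hpos : 0 ≤ h := integral_nonneg fun x => by positivity
  have hb0 : b = 0 := by
    have hs : ∀ s : ℝ, 0 ≤ 2 * s * b + s ^ 2 * h := fun s => by
      have := hmin _ (hu'.add_mul hw' s)
      rw [expand] at this
      linarith
    -- The vertex of the parabola would be `-b/h`; the added `1` keeps the step defined when `h =
    -- 0`.
    have h1 := hs (-b / (h + 1))
    have h2 : 2 * (-b / (h + 1)) * b + (-b / (h + 1)) ^ 2 * h =
        -(b ^ 2 * (h + 2)) / (h + 1) ^ 2 := by
      field_simp; ring
    rw [h2, le_div_iff₀ (by positivity), zero_mul] at h1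
    have h3 : b ^ 2 * (h + 2) ≤ 0 := by linarith
    have h4 : b ^ 2 ≤ 0 := by
      by_contra hcon
      push Not at hcon
      have : 0 < b ^ 2 * (h + 2) := by positivity
      linarith
    exact pow_eq_zero_iff two_ne_zero |>.1 (le_antisymm h4 (sq_nonneg b))
  rw [hwv, expand, hb0]
  ring

end WeakGradient

/-! ### Generalization error of the Tikhonov loss over softplus networks -/

section Generalization

variable {d m N : ℕ} {Ω : Set (Eucl d)} {B Y : ℝ}

lemma volume_ne_top_of_cube (h : ∀ x ∈ Ω, ∀ i, |x i| ≤ 1) : volume Ω ≠ ⊤ := by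
  have hsub : Ω ⊆ Metric.closedBall 0 d := fun x hx => by
    rw [mem_closedBall_zero_iff]
    refine (norm_le_l1norm x).trans ?_
    calc l1norm x ≤ ∑ _i : Fin d, (1 : ℝ) := Finset.sum_le_sum fun i _ => h x hx i
      _ = d := by simp
  exact ((measure_mono hsub).trans_lt measure_closedBall_lt_top).ne

lemma network_hasWeakGradient (hΩ : IsOpen Ω) (hcube : ∀ x ∈ Ω, ∀ i, |x i| ≤ 1) (hB : 0 ≤ B)
    {τ : ℝ} (hτ : 1 ≤ τ) (θ : NetParam d m B) :
    HasWeakGradient Ω (network (softplus τ) θ) (networkGrad τ θ) ∧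
      MemLp (network (softplus τ) θ) 2 (volume.restrict Ω) ∧
      MemLp (networkGrad τ θ) 2 (volume.restrict Ω) :=
  hasWeakGradient_and_memLp hΩ (volume_ne_top_of_cube hcube)
    (hasGradientAt_network (by linarith) θ) (continuous_networkGrad τ θ) (fun _ _ => rfl)
    (K := 50 * B) (fun x hx => abs_network_le hB hτ θ (hcube x hx))
    fun x _ => (norm_networkGrad_le hB τ θ x).trans (by linarith)

lemma network_memH1 (hΩ : IsOpen Ω) (hcube : ∀ x ∈ Ω, ∀ i, |x i| ≤ 1) (hB : 0 ≤ B)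
    {τ : ℝ} (hτ : 1 ≤ τ) (θ : NetParam d m B) : MemH1 Ω (network (softplus τ) θ) :=
  have h := network_hasWeakGradient hΩ hcube hB hτ θ
  ⟨h.2.1, _, h.1, h.2.2⟩

lemma exists_measurableSet_subset_of_ae {α : Type*} [MeasurableSpace α] {μ : Measure α}
    {p : α → Prop} (h : ∀ᵐ x ∂μ, p x) :
    ∃ S, MeasurableSet S ∧ (∀ x ∈ S, p x) ∧ ∀ᵐ x ∂μ, x ∈ S := by
  obtain ⟨t, ht, htm, ht0⟩ := exists_measurable_superset_of_null (mem_ae_iff.1 h)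
  refine ⟨tᶜ, htm.compl, fun x hx => ?_, ?_⟩
  · by_contra hp
    exact hx (ht hp)
  · exact measure_eq_zero_iff_ae_notMem.1 ht0

/-- With high probability, the empirical Tikhonov loss is uniformly close to the expected one over
all softplus networks, relative to a reference network. -/
theorem tikLoss_deviation_confidence (hΩ : IsOpen Ω) (hne : Ω.Nonempty)
    (hcube : ∀ x ∈ Ω, ∀ i, |x i| ≤ 1) {y : Eucl d → ℝ} (hy : AEMeasurable y (volume.restrict Ω))
    (hY0 : 0 < Y) (hY : ∀ x ∈ Ω, |y x| ≤ Y) (hB : 0 < B) (hm : 1 ≤ m) (hN : 1 ≤ N) {τ : ℝ}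
    (hτ : 1 ≤ τ) {ε : ℝ} (hε : 0 < ε) (hε1 : ε < 1) (θ₀ : NetParam d m B) :
    ∃ A : Set (Fin N → Eucl d), MeasurableSet A ∧
      ENNReal.ofReal (1 - ε) ≤ Measure.pi (fun _ : Fin N => uniformLaw Ω) A ∧
      ∀ X ∈ A, ∀ θ : NetParam d m B,
        (tikLoss Ω y (network (softplus τ) θ) - tikLossEmp y X (network (softplus τ) θ)) -
          (tikLoss Ω y (network (softplus τ) θ₀) - tikLossEmp y X (network (softplus τ) θ₀)) ≤
        2 * (((100 * B + 2 * Y) * (2 * B + 16 * B * (2 * (d + 1) + 3)) +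
          d * (32 * B * (16 * B * (2 * (d + 1) + 1)))) * (τ * Real.sqrt N)) / N +
          4 * (2756 * B ^ 2 + 100 * B * Y) * (Real.sqrt (-2 * Real.log ε) / Real.sqrt N) := by
  have hτ0 : 0 < τ := by linarith
  have h0 : volume Ω ≠ 0 := (hΩ.measure_pos volume hne).ne'
  have := isProbabilityMeasure_uniformLaw h0 (volume_ne_top_of_cube hcube)
  set ρ := uniformLaw Ω with hρ
  set M : ℝ := 2756 * B ^ 2 + 100 * B * Y with hM_def
  have hM : 0 < M := by positivity
  -- The labels are only a.e. measurable and bounded only on `Ω`. Passing to a measurable version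
  -- and cutting off outside a measurable set of full measure makes the losses measurable and
  -- bounded everywhere.
  obtain ⟨y', hy'm, hyy'⟩ := hy
  obtain ⟨S, hSm, hS, hSae⟩ : ∃ S : Set (Eucl d), MeasurableSet S ∧
      (∀ x ∈ S, x ∈ Ω ∧ y x = y' x) ∧ ∀ᵐ x ∂ρ, x ∈ S :=
    exists_measurableSet_subset_of_ae (ae_uniformLaw ((ae_restrict_mem hΩ.measurableSet).and hyy'))
  set g : NetParam d m B → Eucl d → ℝ :=
    fun θ => S.indicator fun x => networkLoss τ θ x (y' x) with hg_def
  have hg_eq : ∀ θ, ∀ x ∈ S, g θ x = networkLoss τ θ x (y x) := fun θ x hx => by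
    simp only [hg_def, Set.indicator_of_mem hx, (hS x hx).2]
  have hgm : ∀ θ, Measurable (g θ) := fun θ => by
    have h1 := (continuous_network τ θ).measurable
    have h2 := (continuous_networkGrad τ θ).norm.measurable
    have : Measurable fun x => networkLoss τ θ x (y' x) := by
      unfold networkLoss
      exact ((h1.pow_const 2).sub ((h1.const_mul 2).mul hy'm)).add (h2.pow_const 2)
    exact this.indicator hSm
  have hgb : ∀ θ x, |g θ x| ≤ M := fun θ x => by
    by_cases hx : x ∈ S
    · rw [hg_eq θ x hx]
      exact abs_networkLoss_le hB.le hτ θ (hcube x (hS x hx).1) (hY x (hS x hx).1)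
    · simp only [hg_def, Set.indicator_of_notMem hx, abs_zero]
      exact hM.le
  have hgc : ∀ x, Continuous fun θ => g θ x := fun x => by
    by_cases hx : x ∈ S
    · simp only [hg_def, Set.indicator_of_mem hx]
      have h1 := continuous_network_param (B := B) (m := m) τ x
      have h2 := continuous_networkGrad_param (B := B) (m := m) τ x
      unfold networkLoss
      fun_prop
    · simp only [hg_def, Set.indicator_of_notMem hx]
      exact continuous_const
  have hL : ∀ θ, tikLoss Ω y (network (softplus τ) θ) = ∫ x, g θ x ∂ρ := fun θ => by
    rw [tikLoss_eq hΩ (network_hasWeakGradient hΩ hcube hB.le hτ θ).1]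
    refine integral_congr_ae ?_
    filter_upwards [hSae] with x hx
    rw [hg_eq θ x hx, networkLoss]
  -- Measurability of the supremum requires a countable class. The reference network is adjoined
  -- because the dense set may miss it.
  obtain ⟨T, hTc, hTd⟩ := TopologicalSpace.exists_countable_dense (NetParam d m B)
  have hT'c : (insert θ₀ T).Countable := hTc.insert θ₀
  have : Countable ↥(insert θ₀ T) := hT'c.to_subtype
  have : Nonempty ↥(insert θ₀ T) := ⟨⟨θ₀, Set.mem_insert _ _⟩⟩
  have hXae : ∀ᵐ X ∂(Measure.pi fun _ : Fin N => ρ), ∀ i, X i ∈ S :=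
    ae_all_iff.2 fun i =>
      (measurePreserving_eval (fun _ : Fin N => ρ) i).quasiMeasurePreserving.ae hSae
  obtain ⟨A, hAm, hA, hdev⟩ := uniform_deviation_confidence (N := N)
    (⟨θ₀, Set.mem_insert _ _⟩ : ↥(insert θ₀ T)) ρ hN (g := fun t => g t.1) hM
    (fun t => hgm t.1) (fun t => hgb t.1)
    (r := ((100 * B + 2 * Y) * (2 * B + 16 * B * (2 * (d + 1) + 3)) +
          d * (32 * B * (16 * B * (2 * (d + 1) + 1)))) * (τ * Real.sqrt N)) (by
      filter_upwards [hXae] with X hX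
      have := signAvg_networkLoss_le (T := ↥(insert θ₀ T)) hB.le hm hτ (x := X)
        (fun i => hcube _ (hS _ (hX i)).1) (v := fun i => y (X i)) hY0.le
        (fun i => hY _ (hS _ (hX i)).1) fun t => t.1
      simpa only [hg_eq _ _ (hX _)] using this) hε hε1
  refine ⟨A ∩ {X | ∀ i, X i ∈ S}, hAm.inter ?_, ?_, fun X hX θ => ?_⟩
  · rw [Set.ofPred_forall]
    exact MeasurableSet.iInter fun i => measurable_pi_apply i hSm
  · rwa [measure_inter_conull (mem_ae_iff.1 hXae)]
  · obtain ⟨hXA, hXS⟩ := hX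
    rw [Set.mem_ofPred_eq] at hXS
    have hLN : ∀ θ, tikLossEmp y X (network (softplus τ) θ) = (1 / (N : ℝ)) * ∑ i, g θ (X i) :=
      fun θ => by
        unfold tikLossEmp
        congr 1
        refine Finset.sum_congr rfl fun i _ => ?_
        rw [gradient_network hτ0, hg_eq θ _ (hXS i), networkLoss]
    simp only [hL, hLN]
    have hcont : Continuous fun θ => (∫ x, g θ x ∂ρ) - (1 / (N : ℝ)) * ∑ i, g θ (X i) := by
      refine Continuous.sub ?_ (continuous_const.mul (continuous_finsetSum _ fun i _ => hgc _))
      exact continuous_of_dominated (bound := fun _ => M)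
        (fun θ => (hgm θ).aestronglyMeasurable)
        (fun θ => Filter.Eventually.of_forall (hgb θ)) (integrable_const _)
        (Filter.Eventually.of_forall hgc)
    -- For a fixed sample the inequality is a closed condition on the parameters, so it extends from
    -- the dense set.
    have hclosed := isClosed_le (hcont.sub (continuous_const (y :=
      (∫ x, g θ₀ x ∂ρ) - (1 / (N : ℝ)) * ∑ i, g θ₀ (X i)))) (continuous_const (y :=
        2 * (((100 * B + 2 * Y) * (2 * B + 16 * B * (2 * (d + 1) + 3)) +
          d * (32 * B * (16 * B * (2 * (d + 1) + 1)))) * (τ * Real.sqrt N)) / N +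
          4 * M * (Real.sqrt (-2 * Real.log ε) / Real.sqrt N)))
    have hsub := hclosed.closure_subset_iff.2 fun t ht =>
      hdev X hXA ⟨t, Set.mem_insert_of_mem _ ht⟩
    exact hsub (hTd θ)

/-- A Barron function is close in `H¹(Ω)` to a softplus network. -/
theorem exists_network_h1NormSq_le (hd : 0 < d) (hΩ : IsOpen Ω) (hne : Ω.Nonempty)
    (hcube : ∀ x ∈ Ω, ∀ i, |x i| ≤ 1) (hm : 1 ≤ m) {u : Eucl d → ℝ} {F : Eucl d → ℂ}
    (hF : IsBarronRep 2 Ω u F) (hFB : ∫ w, (1 + l1norm w) ^ 2 * ‖F w‖ ≤ B) :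
    ∃ θ : NetParam d m B,
      h1NormSq Ω (fun x => network (softplus (Real.sqrt m)) θ x - u x) ≤
        625 * (∫ w, (1 + l1norm w) ^ 2 * ‖F w‖) ^ 2 / m := by
  have h0 : volume Ω ≠ 0 := (hΩ.measure_pos volume hne).ne'
  have hfin := volume_ne_top_of_cube hcube
  have := isProbabilityMeasure_uniformLaw h0 hfin
  have hΩae : ∀ᵐ x ∂(uniformLaw Ω), x ∈ Ω := ae_uniformLaw (ae_restrict_mem hΩ.measurableSet)
  have hB : 0 ≤ B := (integral_nonneg fun w => by positivity).trans hFB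
  have hτ : 1 ≤ Real.sqrt m := by rw [Real.one_le_sqrt]; exact_mod_cast hm
  obtain ⟨θ, hθ⟩ := exists_network_approx (ρ := uniformLaw Ω) hd hm hF.1 hF.2.1 hFB
    (hΩae.mono hcube)
  refine ⟨θ, ?_⟩
  have w1 := (network_hasWeakGradient hΩ hcube hB hτ θ).1
  have w2 := (hasWeakGradient_and_memLp hΩ hfin (hasGradientAt_barronExt hF.1 hF.2.1)
    (continuous_barronGrad hF.1 hF.2.1) (fun x hx => hF.eq_barronExt hx)
    (fun x _ => abs_barronExt_le hF.2.1 x) fun x _ => norm_barronGrad_le hF.2.1 x).1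
  have w3 := w1.add_mul w2 (-1)
  simp only [neg_one_mul, neg_one_smul, ← sub_eq_add_neg] at w3
  rw [h1NormSq_eq hΩ w3]
  refine le_trans (le_of_eq (integral_congr_ae ?_)) hθ
  filter_upwards [hΩae] with x hx
  rw [hF.eq_barronExt hx]

lemma barronNorm_nonneg {s : ℕ} {u : Eucl d → ℝ} : 0 ≤ barronNorm s Ω u := by
  refine Real.sInf_nonneg ?_
  rintro _ ⟨F, _, rfl⟩
  exact integral_nonneg fun w => mul_nonneg (pow_nonneg (by linarith [l1norm_nonneg w]) _)
    (norm_nonneg _)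

lemma exists_isBarronRep_lt {s : ℕ} {u : Eucl d → ℝ} (hu : MemBarron s Ω u) {c : ℝ}
    (hc : barronNorm s Ω u < c) :
    ∃ F, IsBarronRep s Ω u F ∧ ∫ w, (1 + l1norm w) ^ s * ‖F w‖ < c := by
  obtain ⟨F₀, hF₀⟩ := hu
  obtain ⟨_, ⟨F, hF, rfl⟩, h⟩ := exists_lt_of_csInf_lt
    (s := {r | ∃ F, IsBarronRep s Ω u F ∧ r = ∫ w, (1 + l1norm w) ^ s * ‖F w‖})
    ⟨_, F₀, hF₀, rfl⟩ hc
  exact ⟨F, hF, h⟩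

end Generalization

/-! ### The `H¹` error bound for `δ`-minimizers -/

theorem theorem5 :
    -- the constants depend only on `(B, d, Y)`, on `(B, d)` and on `(B, Y)`, respectively
    ∃ (Z₁ : ℝ → ℕ → ℝ → ℝ) (Z₃ : ℝ → ℕ → ℝ) (M₂ : ℝ → ℝ → ℝ),
      ∀ (d : ℕ) (Ω : Set (Eucl d)) (y uhat : Eucl d → ℝ) (B Y δ ε : ℝ) (m N : ℕ),
        -- the domain, and the data function bounded by `Y`
        IsOpen Ω → Ω.Nonempty → (∀ x ∈ Ω, ∀ i, |x i| ≤ 1) →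
        AEMeasurable y (volume.restrict Ω) → 0 < Y → (∀ x ∈ Ω, |y x| ≤ Y) →
        -- `uhat` minimizes the Tikhonov loss over `H¹(Ω)`
        MemH1 Ω uhat → (∀ v, MemH1 Ω v → tikLoss Ω y uhat ≤ tikLoss Ω y v) →
        -- and is a Barron function of norm less than `B`
        0 < B → MemBarron 2 Ω uhat → barronNorm 2 Ω uhat < B →
        1 ≤ m → 1 ≤ N → 0 < ε → ε < 1 →
        -- an event of probability at least `1 - ε` over the i.i.d. uniform sample `X`
        ∃ A : Set (Fin N → Eucl d), MeasurableSet A ∧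
          ENNReal.ofReal (1 - ε) ≤ Measure.pi (fun _ : Fin N => uniformLaw Ω) A ∧
          ∀ X ∈ A, ∀ φ : Eucl d → ℝ,
            IsDeltaMinimizer (tikLossEmp y X) (twoLayer d m (softplus (Real.sqrt m)) B) δ φ →
            MemH1 Ω (fun x => φ x - uhat x) ∧
            h1NormSq Ω (fun x => φ x - uhat x) ≤
              barronNorm 2 Ω uhat ^ 2 / m * (24 * Real.log m + 65) ^ 2
              + 4 * (Real.sqrt m / Real.sqrt N) * (Z₁ B d Y + Z₃ B d * Real.sqrt (Real.log m))
              + 2 * M₂ B Y * (Real.sqrt (-2 * Real.log ε) / Real.sqrt N)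
              + 2 * δ := by
  -- The `+ 1` in `Z₁` pays for choosing a representation that need not attain the Barron norm. `Z₃`
  -- can be zero since no covering numbers enter.
  refine ⟨fun B d Y => (2 * ((100 * B + 2 * Y) * (2 * B + 16 * B * (2 * (d + 1) + 3)) +
      d * (32 * B * (16 * B * (2 * (d + 1) + 1)))) + 1) / 4, fun _ _ => 0,
    fun B Y => 2 * (2756 * B ^ 2 + 100 * B * Y), ?_⟩
  intro d Ω y u B Y δ ε m N hΩ hne hcube hy hY0 hY hu hmin hB hbar hnorm hm hN hε hε1
  have h0 : volume Ω ≠ 0 := (hΩ.measure_pos volume hne).ne'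
  have hfin := volume_ne_top_of_cube hcube
  have := isProbabilityMeasure_uniformLaw h0 hfin
  -- In dimension zero no vector has `ℓ¹` norm one, so for `m ≥ 1` the class of networks is empty.
  rcases Nat.eq_zero_or_pos d with rfl | hd
  · refine ⟨Set.univ, MeasurableSet.univ, ?_, fun X _ φ hφ => ?_⟩
    · rw [measure_univ]
      exact ENNReal.ofReal_le_one.2 (by linarith)
    · obtain ⟨c, a, w, b, -, -, hw, -⟩ := hφ.1
      simpa [l1norm] using hw ⟨0, hm⟩
  have hm' : (1 : ℝ) ≤ m := by exact_mod_cast hm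
  have hN' : (1 : ℝ) ≤ N := by exact_mod_cast hN
  have hτ : 1 ≤ Real.sqrt m := Real.one_le_sqrt.2 hm'
  have hsN : 0 < Real.sqrt N := Real.sqrt_pos.2 (by linarith)
  set n := barronNorm 2 Ω u with hn_def
  have hn : 0 ≤ n := barronNorm_nonneg
  -- A representation with mass below `B` keeps the network in the class. The second entry makes
  -- `625γ² ≤ 65²n² + 1/√N`; the term `1/√N` is what gives strict inequality when `n = 0`.
  have hlt : n < min B (Real.sqrt ((4225 * n ^ 2 + 1 / Real.sqrt N) / 625)) := by
    refine lt_min hnorm (Real.lt_sqrt_of_sq_lt ?_)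
    have : 0 < 1 / Real.sqrt N := by positivity
    rw [lt_div_iff₀ (by norm_num)]
    nlinarith [sq_nonneg n]
  obtain ⟨F, hF, hFlt⟩ := exists_isBarronRep_lt hbar hlt
  set γ := ∫ w, (1 + l1norm w) ^ 2 * ‖F w‖ with hγ_def
  have hγ0 : 0 ≤ γ := integral_nonneg fun w => by positivity
  have hγ : 625 * γ ^ 2 ≤ 4225 * n ^ 2 + 1 / Real.sqrt N := by
    have := (Real.lt_sqrt hγ0).1 (hFlt.trans_le (min_le_right _ _))
    rw [lt_div_iff₀ (by norm_num)] at this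
    linarith
  obtain ⟨θ₀, hθ₀⟩ := exists_network_h1NormSq_le (m := m) hd hΩ hne hcube hm hF
    (hFlt.le.trans (min_le_left _ _))
  obtain ⟨A, hAm, hA, hdev⟩ := tikLoss_deviation_confidence (N := N) hΩ hne hcube hy hY0 hY hB hm hN
    hτ hε hε1 θ₀
  refine ⟨A, hAm, hA, fun X hX φ hφ => ?_⟩
  obtain ⟨hφmem, hφmin⟩ := hφ
  rw [twoLayer_eq_range] at hφmem hφmin
  -- Comparing the minimizer with itself. The error decomposition produces one `δ`, and its sign
  -- lets it be enlarged to `2δ`.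
  have hδ : 0 ≤ δ := by linarith [hφmin φ hφmem]
  obtain ⟨θ, rfl⟩ := hφmem
  have hH1 := network_memH1 hΩ hcube hB.le hτ θ
  refine ⟨hH1.sub hu, ?_⟩
  have e1 := tikLoss_sub_eq_h1NormSq hΩ h0 hfin hy hY hu hmin hH1
  have e2 := tikLoss_sub_eq_h1NormSq hΩ h0 hfin hy hY hu hmin (network_memH1 hΩ hcube hB.le hτ θ₀)
  have e3 := hφmin _ ⟨θ₀, rfl⟩
  have e4 := hdev X hX θ
  rw [e2] at hθ₀
  rw [e1]
  set C : ℝ := (100 * B + 2 * Y) * (2 * B + 16 * B * (2 * (d + 1) + 3)) +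
      d * (32 * B * (16 * B * (2 * (d + 1) + 1)))
  have a1 : 625 * γ ^ 2 / m ≤ n ^ 2 / m * (24 * Real.log m + 65) ^ 2 +
      Real.sqrt m / Real.sqrt N := by
    have hlog : 0 ≤ Real.log m := Real.log_nonneg hm'
    calc 625 * γ ^ 2 / m ≤ (4225 * n ^ 2 + 1 / Real.sqrt N) / m := by gcongr
      _ = n ^ 2 / m * 65 ^ 2 + (1 / Real.sqrt N) / m := by ring
      _ ≤ n ^ 2 / m * (24 * Real.log m + 65) ^ 2 + Real.sqrt m / Real.sqrt N := by
        refine add_le_add ?_ ?_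
        · gcongr
          linarith
        · calc (1 / Real.sqrt N) / m ≤ 1 / Real.sqrt N := div_le_self (by positivity) hm'
            _ ≤ _ := by gcongr
  have a2 : 2 * (C * (Real.sqrt m * Real.sqrt N)) / N = 2 * C * (Real.sqrt m / Real.sqrt N) := by
    rw [show 2 * (C * (Real.sqrt m * Real.sqrt N)) / N = 2 * C * Real.sqrt m * (Real.sqrt N / N) by
      ring, Real.sqrt_div_self]
    ring
  rw [a2] at e4
  have a3 : 4 * (Real.sqrt m / Real.sqrt N) *
      ((2 * C + 1) / 4 + 0 * Real.sqrt (Real.log m)) =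
      2 * C * (Real.sqrt m / Real.sqrt N) + Real.sqrt m / Real.sqrt N := by ring
  have a4 : 2 * (2 * (2756 * B ^ 2 + 100 * B * Y)) *
      (Real.sqrt (-2 * Real.log ε) / Real.sqrt N) =
      4 * (2756 * B ^ 2 + 100 * B * Y) * (Real.sqrt (-2 * Real.log ε) / Real.sqrt N) := by ring
  rw [a3, a4]
  -- Adds the deviation bound `e4`, the near-minimality `e3` and the approximation bound `hθ₀`; the
  -- losses of the reference network cancel.
  linarith
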